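/- Let $\mu\subseteq\lambda$ be partitions (Young diagrams in English notation, boxes $(i,j)$ = (row, column)), let $\lambda',\mu'$ be their conjugates, and let $x=(x_1,x_2,\dots)$. A *skew specialized Macdonald filling* of shape $\lambda/\mu$ is a map $F:\lambda/\mu\to\{1,2,\dots\}$ such that each column has distinct entries, the first column is strictly decreasing from top to bottom, and every triple is an inversion triple. Here, for $b=(i,j)\in\lambda/\mu$ with $j\ge 2$ and $c=(i',j)\in\lambda/\mu$ with $i'>i$, the boxes $a=(i,j-1)$, $b$, $c$ form a triple; putting $F=\infty$ on boxes outside $\lambda/\mu$, it is an inversion triple if $F(a),F(c),F(b)$, in this order, are increasing up to cyclic rotation, where ties are broken by $b<c<a$. (So if $a\in\mu$ the condition is $F(b)>F(c)$.) Let $\mathrm{COF}(\lambda/\mu)$ be the set of these fillings. A descent of $F$ is a box $(i,j)\in\lambda/\mu$ with $j\ge2$ and $F(i,j-1)<F(i,j)$, $\mathrm{maj}(F)=\sum_{(i,j)\text{ descent}}(\lambda_i-j+1)$, $x^F=\prod_{(i,j)\in\lambda/\mu}x_{F(i,j)}$, and $$\mathrm{E}_{\lambda/\mu}(x;q,0)=\sum_{F\in\mathrm{COF}(\lambda/\mu)}x^F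 q^{\mathrm{maj}(F)} .$$ For a permutation $\sigma$ of $\{1,\dots,k\}$ let $\mathrm{charge}(\sigma)$ be the sum of $k-i$ over all $i\in\{1,\dots,k-1\}$ such that $i$ stands to the left of $i+1$ in $\sigma_1\cdots\sigma_k$. For a word $w$ whose content is a partition, mark the rightmost $1$; from there go left to the first $2$, then to the first $3$, and so on, wrapping around the end of $w$ if necessary, until every letter that occurs in $w$ has been marked once. The marked letters form the first standard subword; remove it and repeat. Let $\mathrm{charge}(w)$ be the sum of the charges of the standard subwords. For a partition $\kappa$ with $\ell$ parts put $\mathrm{charge}_\kappa(w)=\mathrm{charge}(w\cdot \ell^{\kappa_\ell}\cdots2^{\kappa_2}1^{\kappa_1})$, where the dot is concatenation, and for a semistandard Young tableau $T$ let $\mathrm{charge}_\kappa(T)=\mathrm{charge}_\kappa(\mathrm{rw}(T))$, where $\mathrm{rw}(T)$ reads the rows of $T$ from bottom to top, each from left to right. **Theorem.** Let $\alpha$ be the weak composition $\alpha_i=\lambda'_i-\mu'_i$. Then $$\mathrm{E}_{\lambda/\mu}(x;q,0)=\sum_{\nu\vdash|\lambda/\mu|}\mathrm{s}_{\nu'}(x)\sum_{T\in\mathrm{SSYT}(\nu,\alpha)}q^{\mathrm{charge}_{\mu'}(T)},$$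 where $\mathrm{SSYT}(\nu,\alpha)$ is the set of semistandard Young tableaux of shape $\nu$ and content $\alpha$, and $\mathrm{s}_{\nu'}$ is the Schur function of the conjugate partition $\nu'$. In particular $\mathrm{E}_{\lambda/\mu}(x;q,0)$ is a symmetric function and is Schur-positive: it is a finite linear combination of Schur functions with coefficients in $\mathbb{N}[q]$. -/

import Mathlib

/-!
Conventions.  As in Mathlib's `YoungDiagram` and `SemistandardYoungTableau`, everything is indexed
from `0`: rows, columns, letters and variables.  So the letter `k` stands for the positive integer
`k + 1`, the variable `X k` for `x_{k+1}`, and column `j` for the column with number `j + 1`.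
Diagrams are drawn in English notation, a box is a pair (row, column).

Symmetric functions in `x_1, x_2, …` over `ℤ[q]` are formal power series of bounded degree in
countably many variables with coefficients in `Polynomial ℤ`; the variable of the coefficients
is `q`.
-/

namespace SkewMacdonald

open Polynomial

/-! ### Contents of fillings -/

/-- The content (weight) of the restriction of `F` to the finite set `D` of boxes: the exponent
vector of the monomial `∏_{(i,j) ∈ D} x_{F(i,j)}`. -/
noncomputable def content (D : Finset (ℕ × ℕ)) (F : ℕ → ℕ → ℕ) : ℕ →₀ ℕ :=
  ∑ c ∈ D, Finsupp.single (F c.1 c.2) 1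

theorem mem_support_content {D : Finset (ℕ × ℕ)} {F : ℕ → ℕ → ℕ} {c : ℕ × ℕ} (hc : c ∈ D) :
    F c.1 c.2 ∈ (content D F).support := by
  rw [Finsupp.mem_support_iff, content, Finsupp.finsetSum_apply]
  intro h
  have := Finset.sum_eq_zero_iff.1 h c hc
  simp at this

/-- There are finitely many fillings of a finite set of boxes with a given content. -/
theorem finite_fillings (D : Finset (ℕ × ℕ)) (d : ℕ →₀ ℕ) :
    {F : ℕ → ℕ → ℕ | (∀ i j, (i, j) ∉ D → F i j = 0) ∧ content D F = d}.Finite := by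
  refine Set.Finite.of_injOn (f := fun F (c : D) => F c.1.1 c.1.2)
    (t := Set.pi Set.univ fun _ => (d.support : Set ℕ)) ?_ ?_
    (Set.Finite.pi fun _ => Finset.finite_toSet _)
  · rintro F ⟨-, rfl⟩ c -
    exact mem_support_content c.2
  · rintro F ⟨hF, -⟩ G ⟨hG, -⟩ h
    funext i j
    by_cases hij : (i, j) ∈ D
    · exact congrFun h ⟨(i, j), hij⟩
    · rw [hF i j hij, hG i j hij]

/-! ### Skew specialized Macdonald fillings -/

/-- The set of boxes of the skew shape `lam / mu`. -/
def skewCells (lam mu : YoungDiagram) : Finset (ℕ × ℕ) := lam.cells \ mu.cells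

/-- The value of a filling at a box: boxes outside `lam / mu` have value `∞`. -/
def extValue (lam mu : YoungDiagram) (F : ℕ → ℕ → ℕ) (i j : ℕ) : WithTop ℕ :=
  if (i, j) ∈ skewCells lam mu then (F i j : WithTop ℕ) else ⊤

/-- The values `a`, `b`, `c` of a triple, where `a` is just to the left of `b` and `c` is somewhere
below `b`, form an inversion triple: read counter-clockwise (`a`, then `c`, then `b`) they are
increasing up to a cyclic rotation.  Equal values are compared by the subscripts in
`a_3`, `b_1`, `c_2`, the larger subscript being the bigger one. -/
def IsInversionTriple (a b c : WithTop ℕ) : Prop :=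
  let A : WithTop ℕ ×ₗ ℕ := toLex (a, 3)
  let B : WithTop ℕ ×ₗ ℕ := toLex (b, 1)
  let C : WithTop ℕ ×ₗ ℕ := toLex (c, 2)
  (A < C ∧ C < B) ∨ (C < B ∧ B < A) ∨ (B < A ∧ A < C)

/-- The set `COF(lam / mu)`: skew specialized Macdonald fillings of shape `lam / mu`.  The function
`entry` is normalized to be `0` outside the skew shape. -/
@[ext]
structure COF (lam mu : YoungDiagram) where
  entry : ℕ → ℕ → ℕ
  zeros : ∀ i j, (i, j) ∉ skewCells lam mu → entry i j = 0
  /-- Each column has distinct entries. -/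
  column_distinct : ∀ i i' j, (i, j) ∈ skewCells lam mu → (i', j) ∈ skewCells lam mu →
    entry i j = entry i' j → i = i'
  /-- The first column is strictly decreasing from top to bottom. -/
  first_column : ∀ i i', i < i' → (i, 0) ∈ skewCells lam mu → (i', 0) ∈ skewCells lam mu →
    entry i' 0 < entry i 0
  /-- Every triple is an inversion triple. -/
  triples : ∀ i i' j, i < i' → (i, j + 1) ∈ skewCells lam mu → (i', j + 1) ∈ skewCells lam mu →
    IsInversionTriple (extValue lam mu entry i j) (entry i (j + 1)) (entry i' (j + 1))

/-- The leg of a box: the number of boxes of the diagram strictly to the right of it. -/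
def leg (lam : YoungDiagram) (c : ℕ × ℕ) : ℕ := lam.rowLen c.1 - (c.2 + 1)

/-- The descents of a filling: boxes not in the first column whose entry is bigger than the value
of the box just to the left. -/
def descents (lam mu : YoungDiagram) (F : ℕ → ℕ → ℕ) : Finset (ℕ × ℕ) :=
  {c ∈ skewCells lam mu | 1 ≤ c.2 ∧ extValue lam mu F c.1 (c.2 - 1) < (F c.1 c.2 : WithTop ℕ)}

/-- The major index of a filling. -/
def maj (lam mu : YoungDiagram) (F : ℕ → ℕ → ℕ) : ℕ :=
  ∑ c ∈ descents lam mu F, (leg lam c + 1)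

/-- There are finitely many skew specialized Macdonald fillings with a given content. -/
theorem COF.finite_content (lam mu : YoungDiagram) (d : ℕ →₀ ℕ) :
    {F : COF lam mu | content (skewCells lam mu) F.entry = d}.Finite :=
  Set.Finite.of_injOn (f := COF.entry) (t := {G | (∀ i j, (i, j) ∉ skewCells lam mu → G i j = 0) ∧
      content (skewCells lam mu) G = d}) (fun F hF => ⟨F.zeros, hF⟩)
    (fun _ _ _ _ h => COF.ext h) (finite_fillings (skewCells lam mu) d)

/-- The skew specialized non-symmetric Macdonald polynomial
`E_{lam/mu}(x; q, 0) = ∑_{F ∈ COF(lam/mu)} x^F q^{maj F}`, in the variables `x_1, x_2, …`. -/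
noncomputable def skewE (lam mu : YoungDiagram) : MvPowerSeries ℕ ℤ[X] :=
  fun d => ∑ F ∈ (COF.finite_content lam mu d).toFinset, X ^ maj lam mu F.entry

/-! ### Semistandard tableaux and Schur functions -/

/-- There are finitely many semistandard Young tableaux with a given shape and content. -/
theorem finite_SSYT (nu : YoungDiagram) (d : ℕ →₀ ℕ) :
    {T : SemistandardYoungTableau nu | content nu.cells T = d}.Finite :=
  Set.Finite.of_injOn (f := fun (T : SemistandardYoungTableau nu) i j => T i j)
    (t := {G | (∀ i j, (i, j) ∉ nu.cells → G i j = 0) ∧ content nu.cells G = d})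
    (fun T hT => ⟨fun _ _ h => T.zeros (fun h' => h ((YoungDiagram.mem_cells _).2 h')), hT⟩)
    (fun _ _ _ _ h => SemistandardYoungTableau.ext fun i j => congrFun (congrFun h i) j)
    (finite_fillings nu.cells d)

/-- The set `SSYT(nu, d)` of semistandard Young tableaux of shape `nu` and content `d`. -/
noncomputable def SSYT (nu : YoungDiagram) (d : ℕ →₀ ℕ) : Finset (SemistandardYoungTableau nu) :=
  (finite_SSYT nu d).toFinset

/-- The Schur function `s_nu(x) = ∑_{T ∈ SSYT(nu)} x^T`, in the variables `x_1, x_2, …`. -/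
noncomputable def schur (nu : YoungDiagram) : MvPowerSeries ℕ ℤ[X] :=
  fun d => ((SSYT nu d).card : ℤ[X])

/-- There are finitely many Young diagrams with `n` boxes. -/
theorem finite_card_eq (n : ℕ) : {nu : YoungDiagram | nu.card = n}.Finite := by
  refine Set.Finite.of_injOn (f := YoungDiagram.cells)
    (t := ((Finset.range n ×ˢ Finset.range n).powerset : Set (Finset (ℕ × ℕ)))) ?_ ?_
    (Finset.finite_toSet _)
  · rintro nu rfl
    simp only [Finset.mem_coe, Finset.mem_powerset]
    rintro ⟨i, j⟩ h
    have h' : (i, j) ∈ nu := (YoungDiagram.mem_cells _).1 h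
    simp only [Finset.mem_product, Finset.mem_range]
    constructor
    · have h1 := YoungDiagram.mem_iff_lt_colLen.1 h'
      rw [YoungDiagram.colLen_eq_card] at h1
      exact h1.trans_le (Finset.card_le_card (Finset.filter_subset _ _))
    · have h1 := YoungDiagram.mem_iff_lt_rowLen.1 h'
      rw [YoungDiagram.rowLen_eq_card] at h1
      exact h1.trans_le (Finset.card_le_card (Finset.filter_subset _ _))
  · intro a _ b _ h
    exact YoungDiagram.ext h

/-- The set of partitions of `n`, as Young diagrams. -/
noncomputable def partitions (n : ℕ) : Finset YoungDiagram := (finite_card_eq n).toFinset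

/-- The sequence `(lam'_1, lam'_2, …)` of column lengths of `lam`. -/
noncomputable def columnLengths (lam : YoungDiagram) : ℕ →₀ ℕ :=
  Finsupp.onFinset (Finset.range (lam.rowLen 0)) lam.colLen (by
    intro j hj
    have h0 : (0, j) ∈ lam := YoungDiagram.mem_iff_lt_colLen.2 (Nat.pos_of_ne_zero hj)
    exact Finset.mem_range.2 (YoungDiagram.mem_iff_lt_rowLen.1 h0))

/-! ### Charge -/

/-- The rightmost position of the letter `a` in `w` that is strictly to the left of position `p`,
if there is one. -/
def lastBefore (w : List ℕ) (a p : ℕ) : Option ℕ :=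
  ((List.range p).filter fun r => w[r]? = some a).getLast?

/-- The first occurrence of `a` in `w` that is met when going to the left from position `p`,
wrapping around the end if necessary. -/
def nextMark (w : List ℕ) (a p : ℕ) : Option ℕ :=
  (lastBefore w a p).or (lastBefore w a w.length)

/-- Starting at position `p`, mark occurrences of the letters `a`, `a + 1`, `a + 2`, … one after the
other, moving to the left and wrapping around, as long as the letter occurs in `w`; at most `fuel`
positions are marked. -/
def marksFrom (w : List ℕ) : (fuel a p : ℕ) → List ℕ
  | 0, _, _ => []
  | fuel + 1, a, p =>
    match nextMark w a p with
    | none => []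
    | some r => r :: marksFrom w fuel (a + 1) r

/-- The positions of the first standard subword of `w`: the search starts at the right end of `w`
with the smallest letter.  Distinct marks carry distinct letters, so `w.length` steps suffice. -/
def marks (w : List ℕ) : List ℕ := marksFrom w w.length 0 w.length

/-- The first standard subword of `w`. -/
def firstSubword (w : List ℕ) : List ℕ :=
  (w.zipIdx.filter fun x => x.2 ∈ marks w).map Prod.fst

/-- What is left of `w` when its first standard subword is removed. -/
def removeFirstSubword (w : List ℕ) : List ℕ :=
  (w.zipIdx.filter fun x => x.2 ∉ marks w).map Prod.fst

/-- The charge of a permutation `s` of the letters `0, …, k - 1` in one-line notation: the sum of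
`k - i` over all `i ∈ {1, …, k - 1}` such that the `i`-th smallest letter is to the left of the
`(i + 1)`-st, that is, over the `i` that are not descents of the inverse of `s`. -/
def permCharge (s : List ℕ) : ℕ :=
  ∑ i ∈ Finset.range (s.length - 1),
    if s.idxOf i < s.idxOf (i + 1) then s.length - (i + 1) else 0

/-- The sum of the charges of the first `n` standard subwords of `w`. -/
def chargeAux : (n : ℕ) → List ℕ → ℕ
  | 0, _ => 0
  | n + 1, w => permCharge (firstSubword w) + chargeAux n (removeFirstSubword w)

/-- The charge of a word whose content is a partition: the sum of the charges of its standard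
subwords, of which there are at most `w.length` non-empty ones. -/
def charge (w : List ℕ) : ℕ := chargeAux w.length w

/-- The word `ℓ^{kap_ℓ} ⋯ 2^{kap_2} 1^{kap_1}` for the partition `kap` with `ℓ` parts. -/
def chargeSuffix (kap : YoungDiagram) : List ℕ :=
  (List.range (kap.colLen 0)).reverse.flatMap fun i => List.replicate (kap.rowLen i) i

/-- The postfix charge `charge_kap(w)`. -/
def postfixCharge (kap : YoungDiagram) (w : List ℕ) : ℕ := charge (w ++ chargeSuffix kap)

/-- The reading word of a tableau: the rows from bottom to top, each from left to right. -/
def readingWord {nu : YoungDiagram} (T : SemistandardYoungTableau nu) : List ℕ :=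
  (List.range (nu.colLen 0)).reverse.flatMap fun i => (List.range (nu.rowLen i)).map fun j => T i j

/-! ### Symmetry and Schur positivity -/

/-- A power series in `x_1, x_2, …` is a symmetric function: it has bounded degree and it is
invariant under all permutations of the variables. -/
def IsSymmetricFunction (f : MvPowerSeries ℕ ℤ[X]) : Prop :=
  (∃ N : ℕ, ∀ d : ℕ →₀ ℕ, MvPowerSeries.coeff d f ≠ 0 → d.degree ≤ N) ∧
    ∀ (s : Equiv.Perm ℕ) (d : ℕ →₀ ℕ),
      MvPowerSeries.coeff (d.mapDomain s) f = MvPowerSeries.coeff d f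

/-- A power series is Schur-positive: it is a finite linear combination of Schur functions whose
coefficients are polynomials in `q` with non-negative integer coefficients. -/
def IsSchurPositive (f : MvPowerSeries ℕ ℤ[X]) : Prop :=
  ∃ K : YoungDiagram →₀ ℕ[X],
    f = ∑ nu ∈ K.support, (K nu).map (Nat.castRingHom ℤ) • schur nu

end SkewMacdonald

/-!
The proof compares both sides through 0-1 matrices, that is, finite sets of cells `(row, column)`.

A skew specialized Macdonald filling `F` is encoded by the matrix of the pairs (entry, column).
The triple conditions say that each column is obtained from the one before by a greedy cyclic
matching (`run`), so `F` is determined by the sets of entries of its columns, and every matrix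
with column content `lam' - mu'` occurs (`fillMatrix_injective`, `exists_fillMatrix`). The boxes
of `mu`, whose value is `∞`, may be filled with large numbers; a convenient choice is the
positions of the letters of the charge suffix of `mu'` written behind the rows of the matrix. Then
`maj` becomes a weighted number of rises between neighbouring columns (`maj_eq_matStat`).

The marking procedure of the charge is the same greedy matching, applied to the sets of positions
of the letters of a word: the standard subwords are the rows of the resulting filling
(`chargeAux_eq`). A word is a matrix with one cell in each row, so both statistics are instances
of `matStat`.

Row operators (the crystal raising operators on the rows `v`, `v + 1` of the matrix, defined by a
bracketing rule) do not change the rises (`cong_rowMove`, which rests on `riseList_lower`). They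
connect every matrix to exactly one matrix in which each row is dominated by the previous one
(`RowHW`), and such matrices are the same as semistandard tableaux `T`, the rows being the columns
of `T` (`tabMatrix`). Since moreover the reading word of `T` is congruent to its word of columns
(`cong_readingWord`), the statistic on the class of `T` is the postfix charge of `T`
(`matStat_tabMatrix`).

It remains to count the matrices of given row content `d` in the class of `T`. Column operators
commute with row operators (the lemmas `diamond_of_span`, `diamond_of_row_col`,
`diamond_of_col_row`, `diamond_of_cospan`), hence carry classes bijectively to classes, and one
may assume that `T` is of highest weight for the column operators too. Its class then consists of
all column highest weight matrices with a given column content (`exists_ncard_class`). Turned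
upside down these are the tableaux of the conjugate shape (`hwCount_eq`), and row operators on
them show that their number is symmetric in `d` (`SSYT_card_mapDomain`), which also gives the
symmetry of Schur functions.
-/

namespace SkewMacdonald

/-! ### Greedy cyclic matching -/

/-- The element of `B` met first when going down from `a` (inclusive), wrapping around. -/
def pick (a : ℕ) (B : Finset ℕ) : ℕ :=
  if (B.filter (· ≤ a)).Nonempty then (B.filter (· ≤ a)).sup id else B.sup id

/-- `b` is the last element of `B` in the cyclic order that starts just after `a`. -/
def IsPick (a : ℕ) (B : Finset ℕ) (b : ℕ) : Prop :=
  b ∈ B ∧ ∀ c ∈ B, c ≠ b → (a < c ∧ c < b) ∨ (c < b ∧ b ≤ a) ∨ (b ≤ a ∧ a < c)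

theorem IsPick.eq {a b b' : ℕ} {B : Finset ℕ} (h : IsPick a B b) (h' : IsPick a B b') :
    b = b' := by
  by_contra hne
  have h1 := h.2 b' h'.1 (Ne.symm hne)
  have h2 := h'.2 b h.1 hne
  omega

theorem isPick_pick {a : ℕ} {B : Finset ℕ} (h : B.Nonempty) : IsPick a B (pick a B) := by
  unfold pick
  split_ifs with h1
  · obtain ⟨b, hb, hb'⟩ := Finset.exists_mem_eq_sup _ h1 id
    rw [hb']
    rw [Finset.mem_filter] at hb
    refine ⟨hb.1, fun c hc hcb => ?_⟩
    by_cases hca : c ≤ a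
    · have : id c ≤ _ := Finset.le_sup (f := id)
        (show c ∈ B.filter (· ≤ a) from Finset.mem_filter.2 ⟨hc, hca⟩)
      rw [hb'] at this
      simp only [id] at *
      omega
    · simp only [id] at *
      omega
  · obtain ⟨b, hb, hb'⟩ := Finset.exists_mem_eq_sup _ h id
    rw [hb']
    refine ⟨hb, fun c hc hcb => ?_⟩
    have h2 : ¬ c ≤ a := fun h2 => h1 ⟨c, by simp [hc, h2]⟩
    have : id c ≤ _ := Finset.le_sup (f := id) hc
    rw [hb'] at this
    simp only [id] at *
    omega

theorem IsPick.pick_eq {a b : ℕ} {B : Finset ℕ} (h : IsPick a B b) : pick a B = b :=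
  (isPick_pick ⟨b, h.1⟩).eq h

theorem pick_mem {a : ℕ} {B : Finset ℕ} (h : B.Nonempty) : pick a B ∈ B := (isPick_pick h).1

/-- The letters of the list `l`, one after the other, each take the element of the remaining set
that is met first when going down cyclically. -/
def run : List ℕ → Finset ℕ → List ℕ
  | [], _ => []
  | a :: l, B => if B.Nonempty then pick a B :: run l (B.erase (pick a B)) else []

@[simp] theorem run_nil (B : Finset ℕ) : run [] B = [] := rfl

@[simp] theorem run_empty (l : List ℕ) : run l ∅ = [] := by cases l <;> simp [run]

theorem run_cons {a : ℕ} {l : List ℕ} {B : Finset ℕ} (h : B.Nonempty) :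
    run (a :: l) B = pick a B :: run l (B.erase (pick a B)) := by simp [run, h]

theorem run_cons_of_isPick {a b : ℕ} {l : List ℕ} {B : Finset ℕ} (h : IsPick a B b) :
    run (a :: l) B = b :: run l (B.erase b) := by
  rw [run_cons ⟨b, h.1⟩, h.pick_eq]

theorem mem_of_mem_run {l : List ℕ} {B : Finset ℕ} {x : ℕ} (h : x ∈ run l B) : x ∈ B := by
  induction l generalizing B with
  | nil => simp at h
  | cons a l ih =>
    rcases B.eq_empty_or_nonempty with rfl | hB
    · simp at h
    · rw [run_cons hB, List.mem_cons] at h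
      rcases h with rfl | h
      · exact pick_mem hB
      · exact Finset.mem_of_mem_erase (ih h)

theorem nodup_run (l : List ℕ) (B : Finset ℕ) : (run l B).Nodup := by
  induction l generalizing B with
  | nil => simp
  | cons a l ih =>
    rcases B.eq_empty_or_nonempty with rfl | hB
    · simp
    · rw [run_cons hB, List.nodup_cons]
      exact ⟨fun h => by simpa using mem_of_mem_run h, ih _⟩

theorem length_run (l : List ℕ) (B : Finset ℕ) : (run l B).length = min l.length B.card := by
  induction l generalizing B with
  | nil => simp
  | cons a l ih =>
    rcases B.eq_empty_or_nonempty with rfl | hB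
    · simp
    · rw [run_cons hB, List.length_cons, ih, Finset.card_erase_of_mem (pick_mem hB)]
      have := hB.card_pos
      simp only [List.length_cons]
      omega

/-- The positions at which the second of two lists is bigger than the first. -/
def rises (l l' : List ℕ) : List Bool := List.zipWith (fun a b => decide (a < b)) l l'

/-- Matching only depends on the relative order of the letters. -/
theorem run_map {φ ψ : ℕ → ℕ} {l : List ℕ} {B : Finset ℕ}
    (hφ : ∀ b ∈ B, ∀ b' ∈ B, b < b' → φ b < φ b')
    (hψ : ∀ a ∈ l, ∀ b ∈ B, φ b ≤ ψ a ↔ b ≤ a) :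
    run (l.map ψ) (B.image φ) = (run l B).map φ ∧
      rises (l.map ψ) (run (l.map ψ) (B.image φ)) = rises l (run l B) := by
  induction l generalizing B with
  | nil => simp [rises]
  | cons a l ih =>
    rcases B.eq_empty_or_nonempty with rfl | hB
    · simp [rises]
    · have hp := isPick_pick (a := a) hB
      set b := pick a B with hb
      have hp' : IsPick (ψ a) (B.image φ) (φ b) := by
        refine ⟨Finset.mem_image_of_mem _ hp.1, fun c hc hcb => ?_⟩
        obtain ⟨c, hc', rfl⟩ := Finset.mem_image.1 hc
        replace hc := hc'
        have h1 := hp.2 c hc (fun h => hcb (by rw [h]))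
        have h2 := hφ c hc b hp.1
        have h3 := hφ b hp.1 c hc
        have h4 := hψ a (by simp) c hc
        have h5 := hψ a (by simp) b hp.1
        omega
      have he : (B.image φ).erase (φ b) = (B.erase b).image φ := by
        ext x
        simp only [Finset.mem_erase, Finset.mem_image]
        constructor
        · rintro ⟨h1, c, hc, rfl⟩
          exact ⟨c, ⟨fun h => h1 (by rw [h]), hc⟩, rfl⟩
        · rintro ⟨c, ⟨h1, hc⟩, rfl⟩
          refine ⟨fun h => ?_, c, hc, rfl⟩
          rcases lt_trichotomy c b with h2 | h2 | h2
          · exact absurd (hφ c hc b hp.1 h2) (by omega)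
          · exact h1 h2
          · exact absurd (hφ b hp.1 c hc h2) (by omega)
      have ih' := ih (B := B.erase b)
        (fun x hx y hy => hφ x (Finset.mem_of_mem_erase hx) y (Finset.mem_of_mem_erase hy))
        (fun x hx y hy => hψ x (List.mem_cons_of_mem _ hx) y (Finset.mem_of_mem_erase hy))
      rw [List.map_cons, run_cons_of_isPick hp', run_cons_of_isPick hp, he]
      refine ⟨by rw [ih'.1, List.map_cons], ?_⟩
      have h5 := hψ a (by simp) b hp.1
      have ih2 := ih'.2
      simp only [rises, List.zipWith_cons_cons] at ih2 ⊢
      rw [ih2]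
      congr 1
      simp only [decide_eq_decide]
      omega

/-- In the list, no `y` stands before the first `x`. -/
def Precedes (x y : ℕ) : List ℕ → Prop
  | [] => True
  | a :: l => a = x ∨ (a ≠ y ∧ Precedes x y l)

theorem precedes_of_notMem {x y : ℕ} {l : List ℕ} (h : y ∉ l) : Precedes x y l := by
  induction l with
  | nil => trivial
  | cons a l ih =>
    rw [List.mem_cons, not_or] at h
    exact Or.inr ⟨Ne.symm h.1, ih h.2⟩

theorem precedes_run {v : ℕ} {l : List ℕ} {B : Finset ℕ} (hl : Precedes (v + 1) v l)
    (hB : v + 1 ∈ B) : Precedes (v + 1) v (run l B) := by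
  induction l generalizing B with
  | nil => trivial
  | cons a l ih =>
    have hp := isPick_pick (a := a) ⟨_, hB⟩
    rw [run_cons_of_isPick hp]
    by_cases hb : pick a B = v + 1
    · exact Or.inl hb
    · have h1 := hp.2 _ hB (Ne.symm hb)
      rcases hl with rfl | ⟨hav, hl⟩
      · omega
      · refine Or.inr ⟨by omega, ih hl (Finset.mem_erase.2 ⟨Ne.symm hb, hB⟩)⟩

theorem swap_of_ne {v x : ℕ} (h : x ≠ v) (h' : x ≠ v + 1) : Equiv.swap v (v + 1) x = x :=
  Equiv.swap_apply_of_ne_of_ne h h'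

theorem map_swap_eq_self {v : ℕ} {l : List ℕ} (h : v ∉ l) (h' : v + 1 ∉ l) :
    l.map (Equiv.swap v (v + 1)) = l := by
  conv_rhs => rw [← List.map_id l]
  refine List.map_congr_left fun x hx => ?_
  exact swap_of_ne (fun e => h (e ▸ hx)) (fun e => h' (e ▸ hx))

theorem mem_image_swap {v x : ℕ} {B : Finset ℕ} :
    x ∈ B.image (Equiv.swap v (v + 1)) ↔ Equiv.swap v (v + 1) x ∈ B := by
  rw [Finset.mem_image]
  constructor
  · rintro ⟨y, hy, rfl⟩
    rwa [Equiv.swap_apply_self]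
  · intro h
    exact ⟨_, h, Equiv.swap_apply_self _ _ _⟩

/-- Lowering an element of the target from `v + 1` to `v` changes nothing else, provided that no
source `v` comes before the first source `v + 1`: such a source is the only one to which `v` and
`v + 1` look different. -/
theorem run_image_swap {v : ℕ} {l : List ℕ} {B : Finset ℕ} (hl : Precedes (v + 1) v l)
    (hB : v + 1 ∈ B) (hB' : v ∉ B) :
    run l (B.image (Equiv.swap v (v + 1))) = (run l B).map (Equiv.swap v (v + 1)) ∧
      rises l (run l (B.image (Equiv.swap v (v + 1)))) = rises l (run l B) := by
  induction l generalizing B with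
  | nil => simp [rises]
  | cons a l ih =>
    have hp := isPick_pick (a := a) ⟨_, hB⟩
    set σ := Equiv.swap v (v + 1) with hσ
    by_cases hb : pick a B = v + 1
    -- `a` takes `v + 1`, or `v` after the exchange; what remains contains neither of them
    · rw [hb] at hp
      have hav : a ≠ v := by
        rintro rfl
        rcases hl with h | h
        · omega
        · exact h.1 rfl
      have hp' : IsPick a (B.image σ) v := by
        refine ⟨mem_image_swap.2 (by rwa [Equiv.swap_apply_left]), fun c hc hcv => ?_⟩
        have hc := mem_image_swap.1 hc
        have hcv' : c ≠ v + 1 := by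
          rintro rfl
          rw [Equiv.swap_apply_right] at hc
          exact hB' hc
        rw [swap_of_ne hcv hcv'] at hc
        have := hp.2 c hc hcv'
        omega
      have he : (B.image σ).erase v = B.erase (v + 1) := by
        ext x
        simp only [Finset.mem_erase, hσ, mem_image_swap]
        by_cases h1 : x = v
        · subst h1; simp [hB']
        · by_cases h2 : x = v + 1
          · subst h2; simp [hB']
          · rw [swap_of_ne h1 h2]; simp [h1, h2]
      rw [run_cons_of_isPick hp', run_cons_of_isPick hp, he]
      have h1 : v ∉ run l (B.erase (v + 1)) := fun h =>
        hB' (Finset.mem_of_mem_erase (mem_of_mem_run h))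
      have h2 : v + 1 ∉ run l (B.erase (v + 1)) := fun h => by
        simpa using mem_of_mem_run h
      refine ⟨by rw [List.map_cons, map_swap_eq_self h1 h2, hσ, Equiv.swap_apply_right], ?_⟩
      simp only [rises, List.zipWith_cons_cons]
      congr 1
      simp only [decide_eq_decide]
      omega
    · have h1 := hp.2 _ hB (Ne.symm hb)
      set b := pick a B with hbb
      have hbv : b ≠ v := fun h => hB' (h ▸ hp.1)
      have hl' : a ≠ v ∧ Precedes (v + 1) v l := by
        rcases hl with rfl | hl
        · omega
        · exact hl
      have hp' : IsPick a (B.image σ) b := by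
        refine ⟨mem_image_swap.2 (by rw [swap_of_ne hbv hb]; exact hp.1), fun c hc hcb => ?_⟩
        have hc := mem_image_swap.1 hc
        by_cases h3 : c = v
        · have := hl'.1
          omega
        · have h4 : c ≠ v + 1 := by
            rintro rfl
            rw [Equiv.swap_apply_right] at hc
            exact hB' hc
          rw [swap_of_ne h3 h4] at hc
          exact hp.2 c hc hcb
      have he : (B.image σ).erase b = (B.erase b).image σ := by
        ext x
        simp only [Finset.mem_erase, hσ, mem_image_swap]
        refine and_congr_left fun _ => not_congr ?_
        constructor
        · rintro rfl
          exact swap_of_ne hbv hb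
        · intro h
          rw [← swap_of_ne hbv hb, ← h, Equiv.swap_apply_self]
      have ih' := ih (B := B.erase b) hl'.2 (Finset.mem_erase.2 ⟨Ne.symm hb, hB⟩)
        (fun h => hB' (Finset.mem_of_mem_erase h))
      rw [run_cons_of_isPick hp', run_cons_of_isPick hp, he]
      refine ⟨by rw [ih'.1, List.map_cons, swap_of_ne hbv hb], ?_⟩
      have ih2 := ih'.2
      simp only [rises, List.zipWith_cons_cons] at ih2 ⊢
      rw [ih2]

theorem run_map_swap_of_notMem {v : ℕ} {l : List ℕ} {B : Finset ℕ} (hB : v + 1 ∉ B) :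
    run (l.map (Equiv.swap v (v + 1))) B = run l B ∧
      rises (l.map (Equiv.swap v (v + 1))) (run (l.map (Equiv.swap v (v + 1))) B) =
        rises l (run l B) := by
  have h := run_map (φ := id) (ψ := Equiv.swap v (v + 1)) (l := l) (B := B)
    (fun b _ b' _ h => h) (fun a _ b hb => ?_)
  · simpa using h
  · have hb' : b ≠ v + 1 := fun h => hB (h ▸ hb)
    simp only [id]
    rw [Equiv.swap_apply_def]
    split_ifs <;> omega

theorem run_map_swap_image_swap {v : ℕ} {l : List ℕ} {B : Finset ℕ} (hl : v + 1 ∉ l)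
    (hB : v + 1 ∉ B) :
    run (l.map (Equiv.swap v (v + 1))) (B.image (Equiv.swap v (v + 1))) =
        (run l B).map (Equiv.swap v (v + 1)) ∧
      rises (l.map (Equiv.swap v (v + 1)))
        (run (l.map (Equiv.swap v (v + 1))) (B.image (Equiv.swap v (v + 1)))) =
        rises l (run l B) := by
  refine run_map (fun b hb b' hb' h => ?_) (fun a ha b hb => ?_)
  · have h1 : b ≠ v + 1 := fun h => hB (h ▸ hb)
    have h2 : b' ≠ v + 1 := fun h => hB (h ▸ hb')
    simp only [Equiv.swap_apply_def]
    split_ifs <;> omega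
  · have h1 : b ≠ v + 1 := fun h => hB (h ▸ hb)
    have h2 : a ≠ v + 1 := fun h => hl (h ▸ ha)
    simp only [Equiv.swap_apply_def]
    split_ifs <;> omega

/-- Exchanging the sources `v` and `v + 1` either has no effect on the matching or exchanges the
targets `v` and `v + 1`. -/
theorem run_map_swap {v : ℕ} {l : List ℕ} {B : Finset ℕ} (hl : Precedes (v + 1) v l)
    (hd : l.Nodup) (hB : v + 1 ∈ B) (hB' : v ∈ B) :
    (run (l.map (Equiv.swap v (v + 1))) B = run l B ∨
      run (l.map (Equiv.swap v (v + 1))) B = (run l B).map (Equiv.swap v (v + 1))) ∧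
      rises (l.map (Equiv.swap v (v + 1))) (run (l.map (Equiv.swap v (v + 1))) B) =
        rises l (run l B) := by
  induction l generalizing B with
  | nil => simp [rises]
  | cons a l ih =>
    have hp := isPick_pick (a := a) ⟨_, hB⟩
    set σ := Equiv.swap v (v + 1) with hσ
    rw [List.nodup_cons] at hd
    by_cases ha : a = v + 1
    -- both `v + 1` and `v` take the element equal to them, so the exchange is passed on
    · subst ha
      have hp1 : IsPick (v + 1) B (v + 1) := ⟨hB, fun c hc hcb => by omega⟩
      have hp2 : IsPick v B v := ⟨hB', fun c hc hcb => by omega⟩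
      have he : B.erase v = (B.erase (v + 1)).image σ := by
        ext x
        simp only [Finset.mem_erase, hσ, mem_image_swap]
        by_cases h1 : x = v
        · subst h1; simp
        · by_cases h2 : x = v + 1
          · subst h2; simp [hB, hB']
          · rw [swap_of_ne h1 h2]; simp [h1, h2]
      rw [List.map_cons, hσ, Equiv.swap_apply_right, run_cons_of_isPick hp1,
        run_cons_of_isPick hp2, he]
      have h := run_map_swap_image_swap (v := v) (B := B.erase (v + 1)) hd.1 (by simp)
      refine ⟨Or.inr (by rw [h.1, List.map_cons, Equiv.swap_apply_right]), ?_⟩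
      have h2 := h.2
      simp only [rises, List.zipWith_cons_cons] at h2 ⊢
      rw [h2]
      simp
    obtain ⟨hav, hl⟩ := hl.resolve_left ha
    rw [List.map_cons, hσ, swap_of_ne hav ha, run_cons_of_isPick hp, run_cons_of_isPick hp]
    by_cases hb : pick a B = v + 1
    -- once `v + 1` is taken, the sources `v` and `v + 1` see the same targets
    · rw [hb]
      have h := run_map_swap_of_notMem (v := v) (l := l) (B := B.erase (v + 1)) (by simp)
      refine ⟨Or.inl (by rw [h.1]), ?_⟩
      have h2 := h.2
      simp only [rises, List.zipWith_cons_cons] at h2 ⊢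
      rw [h2]
    · have h1 := hp.2 _ hB (Ne.symm hb)
      have hbv : pick a B ≠ v := by omega
      have h := ih (B := B.erase (pick a B)) hl hd.2 (Finset.mem_erase.2 ⟨Ne.symm hb, hB⟩)
        (Finset.mem_erase.2 ⟨Ne.symm hbv, hB'⟩)
      refine ⟨?_, ?_⟩
      · rw [List.map_cons, swap_of_ne hbv hb]
        exact h.1.imp (congrArg _) (congrArg _)
      · have h2 := h.2
        simp only [rises, List.zipWith_cons_cons] at h2 ⊢
        rw [h2]

/-! ### The columns built from a sequence of sets -/

/-- Column `j` of the filling that is determined by the column sets `S`, as a list from top to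
bottom: the first column is decreasing, every other one is matched greedily to the one before. -/
def cols (S : ℕ → Finset ℕ) : ℕ → List ℕ
  | 0 => (S 0).sort (· ≥ ·)
  | j + 1 => run (cols S j) (S (j + 1))

/-- The rises between the columns `j` and `j + 1`, from top to bottom. -/
def riseList (S : ℕ → Finset ℕ) (j : ℕ) : List Bool := rises (cols S j) (cols S (j + 1))

theorem sort_ge_eq_run {B : Finset ℕ} {a n : ℕ} (ha : ∀ b ∈ B, b ≤ a) (hn : B.card ≤ n) :
    B.sort (· ≥ ·) = run (List.replicate n a) B := by
  induction n generalizing B with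
  | zero =>
    have : B = ∅ := Finset.card_eq_zero.1 (by omega)
    subst this
    simp
  | succ n ih =>
    rcases B.eq_empty_or_nonempty with rfl | hB
    · simp
    · have hp := isPick_pick (a := a) hB
      set b := pick a B
      have hlt : ∀ c ∈ B.erase b, c < b := by
        intro c hc
        rw [Finset.mem_erase] at hc
        have h1 := hp.2 c hc.2 hc.1
        have h2 := ha c hc.2
        have h3 := ha b hp.1
        omega
      rw [List.replicate_succ, run_cons_of_isPick hp, ← ih
        (fun c hc => ha c (Finset.mem_of_mem_erase hc))
        (by rw [Finset.card_erase_of_mem hp.1]; omega)]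
      conv_lhs => rw [← Finset.insert_erase hp.1]
      rw [Finset.sort_insert _ (fun c hc => (hlt c hc).le) (by simp)]

theorem mem_of_mem_cols {S : ℕ → Finset ℕ} {j x : ℕ} (h : x ∈ cols S j) : x ∈ S j := by
  cases j with
  | zero => simpa [cols] using h
  | succ j => exact mem_of_mem_run h

theorem nodup_cols (S : ℕ → Finset ℕ) (j : ℕ) : (cols S j).Nodup := by
  cases j with
  | zero => exact Finset.sort_nodup _ _
  | succ j => exact nodup_run _ _

/-- Two sequences of sets with columnwise the same relative order have the same rises. -/
theorem riseList_image {S : ℕ → Finset ℕ} {φ : ℕ → ℕ → ℕ}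
    (h1 : ∀ j, ∀ b ∈ S j, ∀ b' ∈ S j, b < b' → φ j b < φ j b')
    (h2 : ∀ j, ∀ a ∈ S j, ∀ b ∈ S (j + 1), φ (j + 1) b ≤ φ j a ↔ b ≤ a) (j : ℕ) :
    cols (fun k => (S k).image (φ k)) j = (cols S j).map (φ j) ∧
      riseList (fun k => (S k).image (φ k)) j = riseList S j := by
  have key : ∀ j, cols (fun k => (S k).image (φ k)) j = (cols S j).map (φ j) := by
    intro j
    induction j with
    | zero =>
      have e1 := sort_ge_eq_run (B := S 0) (a := (S 0).sup id + ((S 0).image (φ 0)).sup id)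
        (n := (S 0).card) (fun b hb => le_add_right (Finset.le_sup (f := id) hb)) le_rfl
      have e2 := sort_ge_eq_run (B := (S 0).image (φ 0))
        (a := (S 0).sup id + ((S 0).image (φ 0)).sup id)
        (n := (S 0).card) (fun b hb => le_add_left (Finset.le_sup (f := id) hb))
        Finset.card_image_le
      simp only [cols]
      rw [e1, e2]
      have := (run_map (φ := φ 0) (ψ := id)
        (l := List.replicate (S 0).card ((S 0).sup id + ((S 0).image (φ 0)).sup id))
        (h1 0) (fun a ha b hb => ?_)).1
      · simpa using this
      · rw [List.eq_of_mem_replicate ha]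
        have h3 : id b ≤ _ := Finset.le_sup (f := id) hb
        have h4 : id (φ 0 b) ≤ _ :=
          Finset.le_sup (f := id) (Finset.mem_image_of_mem (φ 0) hb)
        simp only [id] at *
        exact iff_of_true (by omega) (by omega)
    | succ j ih =>
      simp only [cols]
      rw [ih]
      exact (run_map (h1 _) (fun a ha b hb => h2 j a (mem_of_mem_cols ha) b hb)).1
  refine ⟨key j, ?_⟩
  have := (run_map (ψ := φ j) (l := cols S j) (h1 (j + 1))
    (fun a ha b hb => h2 j a (mem_of_mem_cols ha) b hb)).2
  rw [← key j] at this
  exact this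

/-- Lowering one element of the set number `j` from `v + 1` to `v` does not change the rises,
provided that on both sides the columns containing both `v` and `v + 1` separate it from columns
that cannot tell the difference. -/
theorem riseList_lower {S S' : ℕ → Finset ℕ} {j v : ℕ} (h1 : v + 1 ∈ S j) (h2 : v ∉ S j)
    (hj : S' j = (S j).image (Equiv.swap v (v + 1))) (hne : ∀ k, k ≠ j → S' k = S k)
    (low : ∃ k₀ ≤ j, (∀ k, k₀ ≤ k → k < j → v + 1 ∈ S k) ∧ ∀ k, k + 1 = k₀ → v ∉ S k)
    (up : ∃ m, j < m ∧ (∀ k, j < k → k < m → v ∈ S k ∧ v + 1 ∈ S k) ∧ v + 1 ∉ S m) (k : ℕ) :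
    riseList S' k = riseList S k := by
  set σ := Equiv.swap v (v + 1) with hσ
  have hlt : ∀ k, k < j → cols S' k = cols S k := by
    intro k
    induction k with
    | zero => intro hk; simp only [cols]; rw [hne _ hk.ne]
    | succ k ih => intro hk; simp only [cols]; rw [hne _ hk.ne, ih (by omega)]
  obtain ⟨k₀, hk₀, low1, low2⟩ := low
  -- from column `k₀` on, an entry `v + 1` precedes every entry `v`: column `k₀ - 1` has no `v`,
  -- and the property is inherited by columns containing `v + 1`
  have hpre : ∀ k, k₀ ≤ k + 1 → k < j → Precedes (v + 1) v (cols S k) := by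
    intro k
    induction k with
    | zero =>
      intro hk hkj
      rcases Nat.lt_or_ge 0 k₀ with h | h
      · exact precedes_of_notMem fun hm => low2 0 (by omega) (mem_of_mem_cols hm)
      · simp only [cols]
        rw [sort_ge_eq_run (a := (S 0).sup id + v + 1)
          (fun b hb => (Finset.le_sup (f := id) hb).trans (by omega)) le_rfl]
        refine precedes_run (precedes_of_notMem fun hm => ?_) (low1 0 h hkj)
        have := List.eq_of_mem_replicate hm
        omega
    | succ k ih =>
      intro hk hkj
      rcases Nat.lt_or_ge (k + 1) k₀ with h | h
      · exact precedes_of_notMem fun hm => low2 (k + 1) (by omega) (mem_of_mem_cols hm)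
      · exact precedes_run (ih (by omega) (by omega)) (low1 _ h hkj)
  have hcj : cols S' j = (cols S j).map σ ∧ ∀ i, i + 1 = j → riseList S' i = riseList S i := by
    cases j with
    | zero =>
      refine ⟨?_, fun i hi => by omega⟩
      simp only [cols]
      rw [hj]
      have e1 := sort_ge_eq_run (B := S 0) (a := (S 0).sup id + ((S 0).image σ).sup id + v + 1)
        (n := (S 0).card) (fun b hb => (Finset.le_sup (f := id) hb).trans (by omega)) le_rfl
      have e2 := sort_ge_eq_run (B := (S 0).image σ)
        (a := (S 0).sup id + ((S 0).image σ).sup id + v + 1)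
        (n := (S 0).card) (fun b hb => (Finset.le_sup (f := id) hb).trans (by omega))
        Finset.card_image_le
      rw [e1, e2]
      refine (run_image_swap (precedes_of_notMem fun hm => ?_) h1 h2).1
      have := List.eq_of_mem_replicate hm
      omega
    | succ i =>
      have h := run_image_swap (hpre i hk₀ (Nat.lt_succ_self i)) h1 h2
      constructor
      · simp only [cols]
        rw [hj, hlt i (Nat.lt_succ_self i)]
        exact h.1
      · intro i' hi'
        obtain rfl : i' = i := by omega
        simp only [riseList, cols]
        rw [hj, hlt i' (Nat.lt_succ_self i')]
        exact h.2
  obtain ⟨m, hm, up1, up2⟩ := up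
  -- to the right of column `j`, the columns agree or differ by the exchange of `v` and `v + 1`,
  -- and the difference has disappeared at column `m`
  have hge : ∀ n, cols S' (j + n) = cols S (j + n) ∨
      (cols S' (j + n) = (cols S (j + n)).map σ ∧ Precedes (v + 1) v (cols S (j + n)) ∧
        j + n < m) := by
    intro n
    induction n with
    | zero =>
      exact Or.inr ⟨hcj.1, precedes_of_notMem fun hm => h2 (mem_of_mem_cols hm), hm⟩
    | succ n ih =>
      have e : S' (j + n + 1) = S (j + n + 1) := hne _ (by omega)
      rcases ih with ih | ⟨ih, hp, hlm⟩
      · exact Or.inl (by rw [← add_assoc]; simp only [cols]; rw [ih, e])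
      · rw [← add_assoc]
        simp only [cols]
        rw [ih, e]
        rcases Nat.lt_or_ge (j + n + 1) m with h | h
        · obtain ⟨h3, h4⟩ := up1 (j + n + 1) (by omega) h
          rcases (run_map_swap hp (nodup_cols _ _) h4 h3).1 with h5 | h5
          · exact Or.inl h5
          · exact Or.inr ⟨h5, precedes_run hp h4, h⟩
        · obtain rfl : m = j + n + 1 := by omega
          exact Or.inl (run_map_swap_of_notMem up2).1
  rcases lt_trichotomy (k + 1) j with hk | hk | hk
  · simp only [riseList]
    rw [hlt k (by omega), hlt (k + 1) hk]
  · exact hcj.2 k hk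
  · obtain ⟨n, rfl⟩ : ∃ n, k = j + n := ⟨k - j, by omega⟩
    have e : S' (j + n + 1) = S (j + n + 1) := hne _ (by omega)
    simp only [riseList, cols]
    rcases hge n with ih | ⟨ih, hp, hlm⟩
    · rw [ih, e]
    · rw [ih, e]
      rcases Nat.lt_or_ge (j + n + 1) m with h | h
      · obtain ⟨h3, h4⟩ := up1 (j + n + 1) (by omega) h
        exact (run_map_swap hp (nodup_cols _ _) h4 h3).2
      · obtain rfl : m = j + n + 1 := by omega
        exact (run_map_swap_of_notMem up2).2

/-! ### Raising operators on rows and on columns of 0-1 matrices -/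

/-- The number of cells of row `v + 1` minus the number of cells of row `v`, in columns `< x`. -/
def rowDiff (M : Finset (ℕ × ℕ)) (v x : ℕ) : ℤ :=
  Nat.count (fun y => (v + 1, y) ∈ M) x - Nat.count (fun y => (v, y) ∈ M) x

/-- The number of cells of column `j + 1` minus the number of cells of column `j`, in rows
`< x`. -/
def colDiff (M : Finset (ℕ × ℕ)) (j x : ℕ) : ℤ :=
  Nat.count (fun y => (y, j + 1) ∈ M) x - Nat.count (fun y => (y, j) ∈ M) x

/-- Moving the cell `(v + 1, c)` up to `(v, c)`. -/
structure RowStep (v c : ℕ) (M M' : Finset (ℕ × ℕ)) : Prop where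
  mem : (v + 1, c) ∈ M
  notMem : (v, c) ∉ M
  mem_iff : ∀ p, p ∈ M' ↔ p = (v, c) ∨ (p ≠ (v + 1, c) ∧ p ∈ M)

/-- Moving the cell `(r, j + 1)` left to `(r, j)`. -/
structure ColStep (j r : ℕ) (M M' : Finset (ℕ × ℕ)) : Prop where
  mem : (r, j + 1) ∈ M
  notMem : (r, j) ∉ M
  mem_iff : ∀ p, p ∈ M' ↔ p = (r, j) ∨ (p ≠ (r, j + 1) ∧ p ∈ M)

/-- Reading row `v` as opening and row `v + 1` as closing brackets, from left to right, with
opening brackets first in each column, the columns left of `c` have no unmatched opening bracket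
and the columns right of `c` no unmatched closing bracket. -/
def RowPivot (v c : ℕ) (M : Finset (ℕ × ℕ)) : Prop :=
  (∀ x ≤ c, rowDiff M v x ≤ rowDiff M v c) ∧ ∀ x, c < x → rowDiff M v x ≤ rowDiff M v (c + 1)

/-- Reading column `j + 1` as opening and column `j` as closing brackets, from top to bottom, with
opening brackets first in each row, the rows above `r` have no unmatched opening bracket and the
rows below `r` no unmatched closing bracket. -/
def ColPivot (j r : ℕ) (M : Finset (ℕ × ℕ)) : Prop :=
  (∀ x ≤ r, colDiff M j r ≤ colDiff M j x) ∧ ∀ x, r < x → colDiff M j (r + 1) ≤ colDiff M j x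

/-- The raising operator between the rows `v` and `v + 1`, as the graph of a partial function: it
moves the cell of the last unmatched closing bracket, in column `c`. -/
def RowMove (v c : ℕ) (M M' : Finset (ℕ × ℕ)) : Prop := RowStep v c M M' ∧ RowPivot v c M

/-- The raising operator between the columns `j` and `j + 1`, as the graph of a partial function:
it moves the cell of the first unmatched opening bracket, in row `r`. -/
def ColMove (j r : ℕ) (M M' : Finset (ℕ × ℕ)) : Prop := ColStep j r M M' ∧ ColPivot j r M

/-- The indicator function of a set of cells. -/
def ind (M : Finset (ℕ × ℕ)) (p : ℕ × ℕ) : ℤ := if p ∈ M then 1 else 0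

theorem ind_of_mem {M : Finset (ℕ × ℕ)} {p : ℕ × ℕ} (h : p ∈ M) : ind M p = 1 := if_pos h

theorem ind_of_notMem {M : Finset (ℕ × ℕ)} {p : ℕ × ℕ} (h : p ∉ M) : ind M p = 0 := if_neg h

theorem ind_nonneg (M : Finset (ℕ × ℕ)) (p : ℕ × ℕ) : 0 ≤ ind M p := by
  unfold ind; split_ifs <;> simp

theorem ind_le_one (M : Finset (ℕ × ℕ)) (p : ℕ × ℕ) : ind M p ≤ 1 := by
  unfold ind; split_ifs <;> simp

theorem mem_of_ind_pos {M : Finset (ℕ × ℕ)} {p : ℕ × ℕ} (h : 0 < ind M p) : p ∈ M := by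
  by_contra h'
  rw [ind_of_notMem h'] at h
  omega

theorem notMem_of_ind_lt {M : Finset (ℕ × ℕ)} {p : ℕ × ℕ} (h : ind M p < 1) : p ∉ M := by
  intro h'
  rw [ind_of_mem h'] at h
  omega

theorem rowDiff_succ (M : Finset (ℕ × ℕ)) (v x : ℕ) :
    rowDiff M v (x + 1) = rowDiff M v x + ind M (v + 1, x) - ind M (v, x) := by
  simp only [rowDiff, Nat.count_succ, ind]
  push_cast
  ring

theorem colDiff_succ (M : Finset (ℕ × ℕ)) (j x : ℕ) :
    colDiff M j (x + 1) = colDiff M j x + ind M (x, j + 1) - ind M (x, j) := by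
  simp only [colDiff, Nat.count_succ, ind]
  push_cast
  ring

@[simp] theorem rowDiff_zero (M : Finset (ℕ × ℕ)) (v : ℕ) : rowDiff M v 0 = 0 := by
  simp [rowDiff]

@[simp] theorem colDiff_zero (M : Finset (ℕ × ℕ)) (j : ℕ) : colDiff M j 0 = 0 := by
  simp [colDiff]

section steps

variable {v c j r : ℕ} {M A B C : Finset (ℕ × ℕ)}

theorem RowStep.ind_eq (h : RowStep v c M A) (p : ℕ × ℕ) :
    ind A p = if p = (v, c) then 1 else if p = (v + 1, c) then 0 else ind M p := by
  have := h.mem_iff p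
  unfold ind
  split_ifs <;> simp_all

theorem ColStep.ind_eq (h : ColStep j r M A) (p : ℕ × ℕ) :
    ind A p = if p = (r, j) then 1 else if p = (r, j + 1) then 0 else ind M p := by
  have := h.mem_iff p
  unfold ind
  split_ifs <;> simp_all

theorem RowStep.colDiff_eq (h : RowStep v c M A) (j x : ℕ) :
    colDiff A j x = colDiff M j x +
      if x = v + 1 then (if c = j + 1 then 1 else 0) - (if c = j then 1 else 0) else 0 := by
  have h1 := ind_of_mem h.mem
  have h2 := ind_of_notMem h.notMem
  induction x with
  | zero => simp
  | succ x ih =>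
    rw [colDiff_succ, colDiff_succ, ih, h.ind_eq, h.ind_eq]
    simp only [Prod.mk.injEq]
    grind

theorem ColStep.rowDiff_eq (h : ColStep j r M B) (v x : ℕ) :
    rowDiff B v x = rowDiff M v x +
      if x = j + 1 then (if r = v + 1 then 1 else 0) - (if r = v then 1 else 0) else 0 := by
  have h1 := ind_of_mem h.mem
  have h2 := ind_of_notMem h.notMem
  induction x with
  | zero => simp
  | succ x ih =>
    rw [rowDiff_succ, rowDiff_succ, ih, h.ind_eq, h.ind_eq]
    simp only [Prod.mk.injEq]
    grind

theorem RowStep.rowDiff_eq (h : RowStep v c M A) (x : ℕ) :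
    rowDiff A v x = rowDiff M v x - if c < x then 2 else 0 := by
  have h1 := ind_of_mem h.mem
  have h2 := ind_of_notMem h.notMem
  induction x with
  | zero => simp
  | succ x ih =>
    rw [rowDiff_succ, rowDiff_succ, ih, h.ind_eq, h.ind_eq]
    simp only [Prod.mk.injEq]
    grind

theorem ColStep.colDiff_eq (h : ColStep j r M B) (x : ℕ) :
    colDiff B j x = colDiff M j x - if r < x then 2 else 0 := by
  have h1 := ind_of_mem h.mem
  have h2 := ind_of_notMem h.notMem
  induction x with
  | zero => simp
  | succ x ih =>
    rw [colDiff_succ, colDiff_succ, ih, h.ind_eq, h.ind_eq]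
    simp only [Prod.mk.injEq]
    grind

/-- Whether column `c` is the pivot does not depend on the cells in column `c`. -/
theorem RowStep.rowPivot_iff (h : RowStep v c M A) : RowPivot v c A ↔ RowPivot v c M := by
  unfold RowPivot
  refine and_congr (forall₂_congr fun x hx => ?_) (forall₂_congr fun x hx => ?_)
  · rw [h.rowDiff_eq, h.rowDiff_eq, if_neg (by omega), if_neg (by omega)]; simp
  · rw [h.rowDiff_eq, h.rowDiff_eq, if_pos (by omega), if_pos (by omega)]; simp

theorem ColStep.colPivot_iff (h : ColStep j r M B) : ColPivot j r B ↔ ColPivot j r M := by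
  unfold ColPivot
  refine and_congr (forall₂_congr fun x hx => ?_) (forall₂_congr fun x hx => ?_)
  · rw [h.colDiff_eq, h.colDiff_eq, if_neg (by omega), if_neg (by omega)]; simp
  · rw [h.colDiff_eq, h.colDiff_eq, if_pos (by omega), if_pos (by omega)]; simp

/-- A row move does not affect the column pivots in the other rows. -/
theorem RowMove.colPivot_iff (h : RowMove v c M A) (h1 : r ≠ v ∧ r ≠ v + 1) :
    ColPivot j r A ↔ ColPivot j r M := by
  obtain ⟨hs, hp⟩ := h
  have i1 := ind_of_mem hs.mem
  have i2 := ind_of_notMem hs.notMem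
  have e := hs.colDiff_eq j
  have s1 := colDiff_succ M j v
  have s2 := colDiff_succ M j (v + 1)
  have er := e r
  have er1 := e (r + 1)
  rw [if_neg (by omega)] at er er1
  have ev1 := e (v + 1)
  rw [if_pos rfl] at ev1
  have n1 := ind_nonneg M (v, j)
  have n2 := ind_nonneg M (v, j + 1)
  have n3 := ind_le_one M (v + 1, j)
  have n4 := ind_le_one M (v + 1, j + 1)
  have n5 := ind_le_one M (v, j)
  have n6 := ind_le_one M (v, j + 1)
  have n7 := ind_nonneg M (v + 1, j)
  have n8 := ind_nonneg M (v + 1, j + 1)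
  -- only `colDiff` at `v + 1` changes, and the pivot condition of the row move bounds the cells of
  -- the other column of the `2 × 2` block, so that the minimum is not attained at `v + 1` alone
  have q1 : c = j → ind M (v + 1, j + 1) ≤ ind M (v, j + 1) := by
    rintro rfl
    have := hp.2 (c + 1 + 1) (by omega)
    rw [rowDiff_succ M v (c + 1)] at this
    omega
  have q2 : c = j + 1 → ind M (v, j) ≤ ind M (v + 1, j) := by
    rintro rfl
    have := hp.1 j (by omega)
    rw [rowDiff_succ M v j] at this
    omega
  have i3 : c = j → ind M (v + 1, j) = 1 ∧ ind M (v, j) = 0 := by rintro rfl; exact ⟨i1, i2⟩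
  have i4 : c = j + 1 → ind M (v + 1, j + 1) = 1 ∧ ind M (v, j + 1) = 0 := by
    rintro rfl; exact ⟨i1, i2⟩
  have ne : ∀ x, x ≠ v + 1 → colDiff A j x = colDiff M j x := by
    intro x hx; rw [e x, if_neg hx, add_zero]
  unfold ColPivot
  constructor
  · rintro ⟨l, u⟩
    refine ⟨fun x hx => ?_, fun x hx => ?_⟩
    · by_cases hxv : x = v + 1
      · subst hxv
        have l1 := l v (by omega)
        have l2 := l (v + 1) (by omega)
        have l3 := l (v + 1 + 1) (by omega)
        rw [ne v (by omega)] at l1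
        rw [ne (v + 1 + 1) (by omega)] at l3
        split_ifs at ev1 <;> omega
      · have := l x hx
        rw [ne x hxv] at this
        omega
    · by_cases hxv : x = v + 1
      · subst hxv
        have l1 := u v (by omega)
        have l2 := u (v + 1) (by omega)
        have l3 := u (v + 1 + 1) (by omega)
        rw [ne v (by omega)] at l1
        rw [ne (v + 1 + 1) (by omega)] at l3
        split_ifs at ev1 <;> omega
      · have := u x hx
        rw [ne x hxv] at this
        omega
  · rintro ⟨l, u⟩
    refine ⟨fun x hx => ?_, fun x hx => ?_⟩
    · by_cases hxv : x = v + 1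
      · subst hxv
        have l1 := l v (by omega)
        have l2 := l (v + 1) (by omega)
        have l3 := l (v + 1 + 1) (by omega)
        split_ifs at ev1 <;> omega
      · have := l x hx
        rw [ne x hxv]
        omega
    · by_cases hxv : x = v + 1
      · subst hxv
        have l1 := u v (by omega)
        have l2 := u (v + 1) (by omega)
        have l3 := u (v + 1 + 1) (by omega)
        split_ifs at ev1 <;> omega
      · have := u x hx
        rw [ne x hxv]
        omega

/-- A column move does not affect the row pivots in the other columns. -/
theorem ColMove.rowPivot_iff (h : ColMove j r M B) (h1 : c ≠ j ∧ c ≠ j + 1) :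
    RowPivot v c B ↔ RowPivot v c M := by
  obtain ⟨hs, hp⟩ := h
  have i1 := ind_of_mem hs.mem
  have i2 := ind_of_notMem hs.notMem
  have e := hs.rowDiff_eq v
  have s1 := rowDiff_succ M v j
  have s2 := rowDiff_succ M v (j + 1)
  have er := e c
  have er1 := e (c + 1)
  rw [if_neg (by omega)] at er er1
  have ev1 := e (j + 1)
  rw [if_pos rfl] at ev1
  have n1 := ind_nonneg M (v, j)
  have n2 := ind_nonneg M (v, j + 1)
  have n3 := ind_le_one M (v + 1, j)
  have n4 := ind_le_one M (v + 1, j + 1)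
  have n5 := ind_le_one M (v, j)
  have n6 := ind_le_one M (v, j + 1)
  have n7 := ind_nonneg M (v + 1, j)
  have n8 := ind_nonneg M (v + 1, j + 1)
  -- only `rowDiff` at `j + 1` changes, and the pivot condition of the column move bounds the cells
  -- of the other row of the `2 × 2` block, so that the maximum is not attained at `j + 1` alone
  have q1 : r = v → ind M (v + 1, j) ≤ ind M (v + 1, j + 1) := by
    rintro rfl
    have := hp.2 (r + 1 + 1) (by omega)
    rw [colDiff_succ M j (r + 1)] at this
    omega
  have q2 : r = v + 1 → ind M (v, j + 1) ≤ ind M (v, j) := by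
    rintro rfl
    have := hp.1 v (by omega)
    rw [colDiff_succ M j v] at this
    omega
  have i3 : r = v → ind M (v, j + 1) = 1 ∧ ind M (v, j) = 0 := by rintro rfl; exact ⟨i1, i2⟩
  have i4 : r = v + 1 → ind M (v + 1, j + 1) = 1 ∧ ind M (v + 1, j) = 0 := by
    rintro rfl; exact ⟨i1, i2⟩
  have ne : ∀ x, x ≠ j + 1 → rowDiff B v x = rowDiff M v x := by
    intro x hx; rw [e x, if_neg hx, add_zero]
  unfold RowPivot
  constructor
  · rintro ⟨l, u⟩
    refine ⟨fun x hx => ?_, fun x hx => ?_⟩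
    · by_cases hxv : x = j + 1
      · subst hxv
        have l1 := l j (by omega)
        have l2 := l (j + 1) (by omega)
        have l3 := l (j + 1 + 1) (by omega)
        rw [ne j (by omega)] at l1
        rw [ne (j + 1 + 1) (by omega)] at l3
        split_ifs at ev1 <;> omega
      · have := l x hx
        rw [ne x hxv] at this
        omega
    · by_cases hxv : x = j + 1
      · subst hxv
        have l1 := u j (by omega)
        have l2 := u (j + 1) (by omega)
        have l3 := u (j + 1 + 1) (by omega)
        rw [ne j (by omega)] at l1
        rw [ne (j + 1 + 1) (by omega)] at l3
        split_ifs at ev1 <;> omega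
      · have := u x hx
        rw [ne x hxv] at this
        omega
  · rintro ⟨l, u⟩
    refine ⟨fun x hx => ?_, fun x hx => ?_⟩
    · by_cases hxv : x = j + 1
      · subst hxv
        have l1 := l j (by omega)
        have l2 := l (j + 1) (by omega)
        have l3 := l (j + 1 + 1) (by omega)
        split_ifs at ev1 <;> omega
      · have := l x hx
        rw [ne x hxv]
        omega
    · by_cases hxv : x = j + 1
      · subst hxv
        have l1 := u j (by omega)
        have l2 := u (j + 1) (by omega)
        have l3 := u (j + 1 + 1) (by omega)
        split_ifs at ev1 <;> omega
      · have := u x hx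
        rw [ne x hxv]
        omega

end steps

/-! ### The row operators commute with the column operators -/

section diamonds

variable {v c j r : ℕ} {M A B C : Finset (ℕ × ℕ)}

theorem exists_rowStep (h : (v + 1, c) ∈ M) (h' : (v, c) ∉ M) : ∃ A, RowStep v c M A :=
  ⟨insert (v, c) (M.erase (v + 1, c)), h, h', fun p => by simp⟩

theorem exists_rowStep_symm (h : (v, c) ∈ A) (h' : (v + 1, c) ∉ A) : ∃ M, RowStep v c M A :=
  ⟨insert (v + 1, c) (A.erase (v, c)), by simp, by simp, fun p => by
    simp only [Finset.mem_insert, Finset.mem_erase]; grind⟩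

theorem exists_colStep (h : (r, j + 1) ∈ M) (h' : (r, j) ∉ M) : ∃ A, ColStep j r M A :=
  ⟨insert (r, j) (M.erase (r, j + 1)), h, h', fun p => by simp⟩

theorem RowStep.mem' (h : RowStep v c M A) : (v, c) ∈ A := (h.mem_iff _).2 (Or.inl rfl)

theorem RowStep.notMem' (h : RowStep v c M A) : (v + 1, c) ∉ A := by
  rw [h.mem_iff]; simp

theorem ColStep.mem' (h : ColStep j r M A) : (r, j) ∈ A := (h.mem_iff _).2 (Or.inl rfl)

theorem ColStep.notMem' (h : ColStep j r M A) : (r, j + 1) ∉ A := by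
  rw [h.mem_iff]; simp

theorem RowPivot.mem_right (h : RowPivot v c M) (hm : (v + 1, c + 1) ∈ M) : (v, c + 1) ∈ M := by
  have h1 := h.2 (c + 1 + 1) (by omega)
  rw [rowDiff_succ M v (c + 1), ind_of_mem hm] at h1
  exact mem_of_ind_pos (by omega)

theorem RowPivot.mem_left (h : RowPivot v (c + 1) M) (hm : (v, c) ∈ M) : (v + 1, c) ∈ M := by
  have h1 := h.1 c (by omega)
  rw [rowDiff_succ M v c, ind_of_mem hm] at h1
  exact mem_of_ind_pos (by omega)

theorem ColPivot.mem_below (h : ColPivot j r M) (hm : (r + 1, j) ∈ M) : (r + 1, j + 1) ∈ M := by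
  have h1 := h.2 (r + 1 + 1) (by omega)
  rw [colDiff_succ M j (r + 1), ind_of_mem hm] at h1
  exact mem_of_ind_pos (by omega)

theorem ColPivot.mem_above (h : ColPivot j (r + 1) M) (hm : (r, j + 1) ∈ M) : (r, j) ∈ M := by
  have h1 := h.1 r (by omega)
  rw [colDiff_succ M j r, ind_of_mem hm] at h1
  exact mem_of_ind_pos (by omega)

/-- The first exceptional position: the rows `v`, `v + 1` restricted to the columns `j`, `j + 1`
are `01/11`, and the two moves end in `11/10`. -/
theorem square_of_three (h1 : (v, j) ∉ M) (h2 : (v, j + 1) ∈ M) (h3 : (v + 1, j) ∈ M)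
    (h4 : (v + 1, j + 1) ∈ M) :
    ∃ A B C, RowStep v j M A ∧ ColStep j v M B ∧ ColStep j (v + 1) A C ∧ RowStep v (j + 1) B C ∧
      (RowPivot v (j + 1) B ↔ RowPivot v j M) ∧ (ColPivot j (v + 1) A ↔ ColPivot j v M) := by
  obtain ⟨A, hA⟩ := exists_rowStep h3 h1
  obtain ⟨B, hB⟩ := exists_colStep h2 h1
  obtain ⟨C, hC⟩ := exists_colStep (M := A) (r := v + 1) (j := j)
    (by rw [hA.mem_iff]; simp [h4]) (by rw [hA.mem_iff]; simp)
  refine ⟨A, B, C, hA, hB, hC, ⟨?_, ?_, fun p => ?_⟩, ?_, ?_⟩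
  · rw [hB.mem_iff]; simp [h4]
  · rw [hB.mem_iff]; simp
  · rw [hC.mem_iff, hA.mem_iff, hB.mem_iff]
    grind
  · have e := hB.rowDiff_eq v
    have e1 := e (j + 1)
    have e2 := e (j + 1 + 1)
    have s1 := rowDiff_succ M v j
    have s2 := rowDiff_succ M v (j + 1)
    rw [ind_of_mem h3, ind_of_notMem h1] at s1
    rw [ind_of_mem h2, ind_of_mem h4] at s2
    simp at e1 e2
    unfold RowPivot
    constructor
    · rintro ⟨l, u⟩
      refine ⟨fun x hx => ?_, fun x hx => ?_⟩
      · have := l x (by omega)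
        rw [e x, if_neg (by omega)] at this
        omega
      · by_cases hxj : x = j + 1
        · subst hxj; omega
        · have := u x (by omega)
          rw [e x, if_neg (by omega)] at this
          omega
    · rintro ⟨l, u⟩
      refine ⟨fun x hx => ?_, fun x hx => ?_⟩
      · by_cases hxj : x = j + 1
        · subst hxj; omega
        · have := l x (by omega)
          rw [e x, if_neg (by omega)]
          omega
      · have := u x (by omega)
        rw [e x, if_neg (by omega)]
        omega
  · have e := hA.colDiff_eq j
    have e1 := e (v + 1)
    have e2 := e (v + 1 + 1)
    have s1 := colDiff_succ M j v
    have s2 := colDiff_succ M j (v + 1)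
    rw [ind_of_mem h2, ind_of_notMem h1] at s1
    rw [ind_of_mem h3, ind_of_mem h4] at s2
    simp at e1 e2
    unfold ColPivot
    constructor
    · rintro ⟨l, u⟩
      refine ⟨fun x hx => ?_, fun x hx => ?_⟩
      · have := l x (by omega)
        rw [e x, if_neg (by omega)] at this
        omega
      · by_cases hxj : x = v + 1
        · subst hxj; omega
        · have := u x (by omega)
          rw [e x, if_neg (by omega)] at this
          omega
    · rintro ⟨l, u⟩
      refine ⟨fun x hx => ?_, fun x hx => ?_⟩
      · by_cases hxj : x = v + 1
        · subst hxj; omega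
        · have := l x (by omega)
          rw [e x, if_neg (by omega)]
          omega
      · have := u x (by omega)
        rw [e x, if_neg (by omega)]
        omega

/-- The second exceptional position: the rows `v`, `v + 1` restricted to the columns `j`, `j + 1`
are `00/01`, and the two moves end in `10/00`. -/
theorem square_of_single (h1 : (v, j) ∉ M) (h2 : (v, j + 1) ∉ M) (h3 : (v + 1, j) ∉ M)
    (h4 : (v + 1, j + 1) ∈ M) :
    ∃ A B C, RowStep v (j + 1) M A ∧ ColStep j (v + 1) M B ∧ ColStep j v A C ∧ RowStep v j B C ∧
      (RowPivot v j B ↔ RowPivot v (j + 1) M) ∧ (ColPivot j v A ↔ ColPivot j (v + 1) M) := by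
  obtain ⟨A, hA⟩ := exists_rowStep h4 h2
  obtain ⟨B, hB⟩ := exists_colStep h4 h3
  obtain ⟨C, hC⟩ := exists_colStep (M := A) (r := v) (j := j)
    (by rw [hA.mem_iff]; simp) (by rw [hA.mem_iff]; simp [h1])
  refine ⟨A, B, C, hA, hB, hC, ⟨?_, ?_, fun p => ?_⟩, ?_, ?_⟩
  · rw [hB.mem_iff]; simp
  · rw [hB.mem_iff]; simp [h1]
  · rw [hC.mem_iff, hA.mem_iff, hB.mem_iff]
    grind
  · have e := hB.rowDiff_eq v
    have e1 := e (j + 1)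
    have e2 := e (j + 1 + 1)
    have s1 := rowDiff_succ M v j
    have s2 := rowDiff_succ M v (j + 1)
    rw [ind_of_notMem h3, ind_of_notMem h1] at s1
    rw [ind_of_notMem h2, ind_of_mem h4] at s2
    simp at e1 e2
    have e3 := e j
    rw [if_neg (by omega)] at e3
    unfold RowPivot
    constructor
    · rintro ⟨l, u⟩
      refine ⟨fun x hx => ?_, fun x hx => ?_⟩
      · by_cases hxj : x = j + 1
        · subst hxj; omega
        · have := l x (by omega)
          rw [e x, if_neg (by omega)] at this
          omega
      · have := u x (by omega)
        rw [e x, if_neg (by omega)] at this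
        omega
    · rintro ⟨l, u⟩
      refine ⟨fun x hx => ?_, fun x hx => ?_⟩
      · have := l x (by omega)
        rw [e x, if_neg (by omega)]
        omega
      · by_cases hxj : x = j + 1
        · subst hxj; omega
        · have := u x (by omega)
          rw [e x, if_neg (by omega)]
          omega
  · have e := hA.colDiff_eq j
    have e1 := e (v + 1)
    have e2 := e (v + 1 + 1)
    have s1 := colDiff_succ M j v
    have s2 := colDiff_succ M j (v + 1)
    rw [ind_of_notMem h2, ind_of_notMem h1] at s1
    rw [ind_of_notMem h3, ind_of_mem h4] at s2
    simp at e1 e2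
    have e3 := e v
    rw [if_neg (by omega)] at e3
    unfold ColPivot
    constructor
    · rintro ⟨l, u⟩
      refine ⟨fun x hx => ?_, fun x hx => ?_⟩
      · by_cases hxj : x = v + 1
        · subst hxj; omega
        · have := l x (by omega)
          rw [e x, if_neg (by omega)] at this
          omega
      · have := u x (by omega)
        rw [e x, if_neg (by omega)] at this
        omega
    · rintro ⟨l, u⟩
      refine ⟨fun x hx => ?_, fun x hx => ?_⟩
      · have := l x (by omega)
        rw [e x, if_neg (by omega)]
        omega
      · by_cases hxj : x = v + 1
        · subst hxj; omega
        · have := u x (by omega)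
          rw [e x, if_neg (by omega)]
          omega

theorem RowStep.unique (h : RowStep v c M A) (h' : RowStep v c M B) : A = B := by
  ext p; rw [h.mem_iff, h'.mem_iff]

theorem ColStep.unique (h : ColStep j r M A) (h' : ColStep j r M B) : A = B := by
  ext p; rw [h.mem_iff, h'.mem_iff]

theorem RowStep.unique_left (h : RowStep v c M A) (h' : RowStep v c B A) : M = B := by
  ext p
  have h1 := h.mem_iff p
  have h2 := h'.mem_iff p
  have h3 := h.mem
  have h4 := h.notMem
  have h5 := h'.mem
  have h6 := h'.notMem
  grind

theorem ColStep.unique_left (h : ColStep j r M A) (h' : ColStep j r B A) : M = B := by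
  ext p
  have h1 := h.mem_iff p
  have h2 := h'.mem_iff p
  have h3 := h.mem
  have h4 := h.notMem
  have h5 := h'.mem
  have h6 := h'.notMem
  grind

/-- The four cells involved in a row step and a column step are distinct. -/
def Disj (v c j r : ℕ) : Prop := ¬((r = v ∨ r = v + 1) ∧ (c = j ∨ c = j + 1))

theorem RowMove.colPivot_iff_of_disj (h : RowMove v c M A) (h1 : Disj v c j r) :
    ColPivot j r A ↔ ColPivot j r M := by
  by_cases hr : r = v ∨ r = v + 1
  · have hc : c ≠ j ∧ c ≠ j + 1 := by unfold Disj at h1; omega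
    unfold ColPivot
    have e : ∀ x, colDiff A j x = colDiff M j x := fun x => by
      rw [h.1.colDiff_eq, if_neg hc.1, if_neg hc.2]; simp
    simp only [e]
  · exact h.colPivot_iff (by omega)

theorem ColMove.rowPivot_iff_of_disj (h : ColMove j r M B) (h1 : Disj v c j r) :
    RowPivot v c B ↔ RowPivot v c M := by
  by_cases hc : c = j ∨ c = j + 1
  · have hr : r ≠ v ∧ r ≠ v + 1 := by unfold Disj at h1; omega
    unfold RowPivot
    have e : ∀ x, rowDiff B v x = rowDiff M v x := fun x => by
      rw [h.1.rowDiff_eq, if_neg hr.1, if_neg hr.2]; simp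
    simp only [e]
  · exact h.rowPivot_iff (by omega)

/-- If a row operator and a column operator are defined at `M`, then so are their composites, and
they agree. -/
theorem diamond_of_span (hA : RowMove v c M A) (hB : ColMove j r M B) :
    ∃ C c' r', ColMove j r' A C ∧ RowMove v c' B C := by
  have a1 := hA.1.mem
  have a2 := hA.1.notMem
  have b1 := hB.1.mem
  have b2 := hB.1.notMem
  by_cases hd : Disj v c j r
  · obtain ⟨C, hC⟩ := exists_colStep (M := A) (r := r) (j := j)
      (by rw [hA.1.mem_iff]; unfold Disj at hd; grind)
      (by rw [hA.1.mem_iff]; unfold Disj at hd; grind)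
    refine ⟨C, c, r, ⟨hC, (hA.colPivot_iff_of_disj hd).2 hB.2⟩, ⟨?_, ?_, fun p => ?_⟩,
      (hB.rowPivot_iff_of_disj hd).2 hA.2⟩
    · rw [hB.1.mem_iff]; unfold Disj at hd; grind
    · rw [hB.1.mem_iff]; unfold Disj at hd; grind
    · rw [hC.mem_iff, hA.1.mem_iff, hB.1.mem_iff]; unfold Disj at hd; grind
  · unfold Disj at hd
    push Not at hd
    obtain ⟨rfl | rfl, rfl | rfl⟩ := hd
    · have h4 := hB.2.mem_below a1
      obtain ⟨A', B', C, sA, sB, sC, sC', p1, p2⟩ := square_of_three b2 b1 a1 h4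
      obtain rfl := sA.unique hA.1
      obtain rfl := sB.unique hB.1
      exact ⟨C, _, _, ⟨sC, p2.2 hB.2⟩, ⟨sC', p1.2 hA.2⟩⟩
    · exact absurd b1 a2
    · exact absurd a1 b2
    · have h1 : (v, j) ∉ M := fun h => b2 (hA.2.mem_left h)
      obtain ⟨A', B', C, sA, sB, sC, sC', p1, p2⟩ := square_of_single h1 a2 b2 a1
      obtain rfl := sA.unique hA.1
      obtain rfl := sB.unique hB.1
      exact ⟨C, _, _, ⟨sC, p2.2 hB.2⟩, ⟨sC', p1.2 hA.2⟩⟩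

/-- If a column operator is defined after a row operator, it is defined before it. -/
theorem diamond_of_row_col (hA : RowMove v c M A) (hC : ColMove j r A C) :
    ∃ B c' r', ColMove j r' M B ∧ RowMove v c' B C := by
  have a1 := hA.1.mem
  have a2 := hA.1.notMem
  have a3 := hA.1.mem'
  have a4 := hA.1.notMem'
  have b1 := hC.1.mem
  have b2 := hC.1.notMem
  by_cases hd : Disj v c j r
  · obtain ⟨B, hB⟩ := exists_colStep (M := M) (r := r) (j := j)
      (by rw [hA.1.mem_iff] at b1; unfold Disj at hd; grind)
      (by rw [hA.1.mem_iff] at b2; unfold Disj at hd; grind)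
    have hB' : ColMove j r M B := ⟨hB, (hA.colPivot_iff_of_disj hd).1 hC.2⟩
    refine ⟨B, c, r, hB', ⟨?_, ?_, fun p => ?_⟩, (hB'.rowPivot_iff_of_disj hd).2 hA.2⟩
    · rw [hB.mem_iff]; unfold Disj at hd; grind
    · rw [hB.mem_iff]; unfold Disj at hd; grind
    · rw [hC.1.mem_iff, hA.1.mem_iff, hB.mem_iff]; unfold Disj at hd; grind
  · unfold Disj at hd
    push Not at hd
    obtain ⟨rfl | rfl, rfl | rfl⟩ := hd
    · exact absurd a3 b2
    · have h1 : (r, j) ∉ M := fun h => b2 (by rw [hA.1.mem_iff]; simp [h])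
      have h3 : (r + 1, j) ∉ M := fun h => a4 (hC.2.mem_below (by rw [hA.1.mem_iff]; simp [h]))
      obtain ⟨A', B', C', sA, sB, sC, sC', p1, p2⟩ := square_of_single h1 a2 h3 a1
      obtain rfl := sA.unique hA.1
      obtain rfl := sC.unique hC.1
      exact ⟨B', _, _, ⟨sB, p2.1 hC.2⟩, ⟨sC', p1.2 hA.2⟩⟩
    · have h4 : (v + 1, c + 1) ∈ M := by
        rw [hA.1.mem_iff] at b1
        simpa using b1
      have h2 := hA.2.mem_right h4
      obtain ⟨A', B', C', sA, sB, sC, sC', p1, p2⟩ := square_of_three a2 h2 a1 h4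
      obtain rfl := sA.unique hA.1
      obtain rfl := sC.unique hC.1
      exact ⟨B', _, _, ⟨sB, p2.1 hC.2⟩, ⟨sC', p1.2 hA.2⟩⟩
    · exact absurd b1 a4

/-- If a row operator is defined after a column operator, it is defined before it. -/
theorem diamond_of_col_row (hB : ColMove j r M B) (hC : RowMove v c B C) :
    ∃ A c' r', RowMove v c' M A ∧ ColMove j r' A C := by
  have a1 := hB.1.mem
  have a2 := hB.1.notMem
  have a3 := hB.1.mem'
  have a4 := hB.1.notMem'
  have b1 := hC.1.mem
  have b2 := hC.1.notMem
  by_cases hd : Disj v c j r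
  · obtain ⟨A, hA⟩ := exists_rowStep (M := M) (v := v) (c := c)
      (by rw [hB.1.mem_iff] at b1; unfold Disj at hd; grind)
      (by rw [hB.1.mem_iff] at b2; unfold Disj at hd; grind)
    have hA' : RowMove v c M A := ⟨hA, (hB.rowPivot_iff_of_disj hd).1 hC.2⟩
    refine ⟨A, c, r, hA', ⟨?_, ?_, fun p => ?_⟩, (hA'.colPivot_iff_of_disj hd).2 hB.2⟩
    · rw [hA.mem_iff]; unfold Disj at hd; grind
    · rw [hA.mem_iff]; unfold Disj at hd; grind
    · rw [hC.1.mem_iff, hB.1.mem_iff, hA.mem_iff]; unfold Disj at hd; grind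
  · unfold Disj at hd
    push Not at hd
    obtain ⟨rfl | rfl, rfl | rfl⟩ := hd
    · exact absurd a3 b2
    · have h4 : (r + 1, j + 1) ∈ M := by
        rw [hB.1.mem_iff] at b1
        simpa using b1
      have h3 : (r + 1, j) ∈ M := by
        have := hC.2.mem_left a3
        rw [hB.1.mem_iff] at this
        simpa using this
      obtain ⟨A', B', C', sA, sB, sC, sC', p1, p2⟩ := square_of_three a2 a1 h3 h4
      obtain rfl := sB.unique hB.1
      obtain rfl := sC'.unique hC.1
      exact ⟨A', _, _, ⟨sA, p1.1 hC.2⟩, ⟨sC, p2.2 hB.2⟩⟩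
    · have h1 : (v, c) ∉ M := fun h => b2 (by rw [hB.1.mem_iff]; simp [h])
      have h2 : (v, c + 1) ∉ M := fun h => h1 (hB.2.mem_above h)
      obtain ⟨A', B', C', sA, sB, sC, sC', p1, p2⟩ := square_of_single h1 h2 a2 a1
      obtain rfl := sB.unique hB.1
      obtain rfl := sC'.unique hC.1
      exact ⟨A', _, _, ⟨sA, p1.1 hC.2⟩, ⟨sC, p2.2 hB.2⟩⟩
    · exact absurd b1 a4

/-- The inverses of a row operator and of a column operator commute. -/
theorem diamond_of_cospan (hA : ColMove j r A C) (hB : RowMove v c B C) :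
    ∃ M c' r', RowMove v c' M A ∧ ColMove j r' M B := by
  have a1 := hA.1.mem'
  have a2 := hA.1.notMem'
  have b1 := hB.1.mem'
  have b2 := hB.1.notMem'
  by_cases hd : Disj v c j r
  · have c1 := hA.1.mem_iff
    have c2 := hB.1.mem_iff
    have d1 := hA.1.mem
    have d2 := hA.1.notMem
    have d3 := hB.1.mem
    have d4 := hB.1.notMem
    obtain ⟨M, hM⟩ := exists_rowStep_symm (A := A) (v := v) (c := c)
      (by have := (c1 _).1 b1; unfold Disj at hd; grind)
      (by have := (c1 (v + 1, c)); unfold Disj at hd; grind)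
    have hp : RowPivot v c M := by
      rw [← hM.rowPivot_iff, ← hA.rowPivot_iff_of_disj hd, hB.1.rowPivot_iff]
      exact hB.2
    have e1 := hM.mem
    have e2 := hM.notMem
    have e3 := hM.mem_iff
    have hs : ColStep j r M B := by
      refine ⟨?_, ?_, fun p => ?_⟩
      · have := e3 (r, j + 1); unfold Disj at hd; grind
      · have := e3 (r, j); unfold Disj at hd; grind
      · have h1 := c1 p
        have h2 := c2 p
        have h3 := e3 p
        unfold Disj at hd
        grind
    refine ⟨M, c, r, ⟨hM, hp⟩, hs, ?_⟩
    rw [← hs.colPivot_iff, ← hB.colPivot_iff_of_disj hd, hA.1.colPivot_iff]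
    exact hA.2
  · unfold Disj at hd
    push Not at hd
    obtain ⟨rfl | rfl, rfl | rfl⟩ := hd
    · -- the block of `C` is `10/0*`
      have h4 : (r + 1, c + 1) ∉ C := fun h => by
        have hp := (hB.1.rowPivot_iff).2 hB.2
        exact a2 (hp.mem_right h)
      obtain ⟨M1, hM1⟩ := exists_rowStep_symm (A := A) (v := r) (c := c + 1) hA.1.mem
        (fun h => h4 (by rw [hA.1.mem_iff]; simp [h]))
      have k1 : (r, c) ∉ M1 := fun h => hA.1.notMem (by rw [hM1.mem_iff]; simp [h])
      have k2 : (r, c + 1) ∉ M1 := hM1.notMem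
      have k3 : (r + 1, c) ∉ M1 := fun h => b2 (by
        rw [hA.1.mem_iff, hM1.mem_iff]; simp [h])
      obtain ⟨A', B', C', sA, sB, sC, sC', p1, p2⟩ := square_of_single k1 k2 k3 hM1.mem
      obtain rfl := sA.unique hM1
      obtain rfl := sC.unique hA.1
      obtain rfl := sC'.unique_left hB.1
      exact ⟨M1, _, _, ⟨sA, p1.1 hB.2⟩, ⟨sB, p2.1 hA.2⟩⟩
    · exact absurd b1 a2
    · exact absurd a1 b2
    · -- the block of `C` is `*1/10`, and the pivot conditions force `11/10`
      have hp := (hB.1.rowPivot_iff).2 hB.2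
      have hq := (hA.1.colPivot_iff).2 hA.2
      have h1 : (v, j) ∈ C := hq.mem_above b1
      have h1A : (v, j) ∈ A := by
        rw [hA.1.mem_iff] at h1; simpa using h1
      obtain ⟨M1, hM1⟩ := exists_rowStep_symm (A := A) (v := v) (c := j) h1A hA.1.notMem
      have hb1A : (v, j + 1) ∈ A := by
        rw [hA.1.mem_iff] at b1; simpa using b1
      have k2 : (v, j + 1) ∈ M1 := by
        rw [hM1.mem_iff] at hb1A; simpa using hb1A
      have k4 : (v + 1, j + 1) ∈ M1 := by
        have := hA.1.mem
        rw [hM1.mem_iff] at this; simpa using this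
      obtain ⟨A', B', C', sA, sB, sC, sC', p1, p2⟩ := square_of_three hM1.notMem k2 hM1.mem k4
      obtain rfl := sA.unique hM1
      obtain rfl := sC.unique hA.1
      obtain rfl := sC'.unique_left hB.1
      exact ⟨M1, _, _, ⟨sA, p1.1 hB.2⟩, ⟨sB, p2.1 hA.2⟩⟩

end diamonds

/-! ### Weights, bounds and determinism of the operators -/

/-- The row content of a set of cells. -/
noncomputable def rowContent (M : Finset (ℕ × ℕ)) : ℕ →₀ ℕ := ∑ p ∈ M, Finsupp.single p.1 1

/-- The column content of a set of cells. -/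
noncomputable def colContent (M : Finset (ℕ × ℕ)) : ℕ →₀ ℕ := ∑ p ∈ M, Finsupp.single p.2 1

theorem rowContent_apply (M : Finset (ℕ × ℕ)) (v : ℕ) :
    rowContent M v = (M.filter (fun p => p.1 = v)).card := by
  rw [rowContent, Finsupp.finsetSum_apply, Finset.card_filter]
  exact Finset.sum_congr rfl fun p _ => by rw [Finsupp.single_apply]

theorem colContent_apply (M : Finset (ℕ × ℕ)) (j : ℕ) :
    colContent M j = (M.filter (fun p => p.2 = j)).card := by
  rw [colContent, Finsupp.finsetSum_apply, Finset.card_filter]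
  exact Finset.sum_congr rfl fun p _ => by rw [Finsupp.single_apply]

/-- All cells lie in the rows `0, …, N - 1`. -/
def InRows (N : ℕ) (M : Finset (ℕ × ℕ)) : Prop := ∀ p ∈ M, p.1 < N

theorem exists_col_bound (M : Finset (ℕ × ℕ)) : ∃ K, ∀ p ∈ M, p.2 < K :=
  ⟨M.sup Prod.snd + 1, fun _ hp => Nat.lt_succ_of_le (Finset.le_sup (f := Prod.snd) hp)⟩

theorem exists_row_bound (M : Finset (ℕ × ℕ)) : ∃ N, InRows N M :=
  ⟨M.sup Prod.fst + 1, fun _ hp => Nat.lt_succ_of_le (Finset.le_sup (f := Prod.fst) hp)⟩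

theorem count_row_eq {M : Finset (ℕ × ℕ)} {K x : ℕ} (hK : ∀ p ∈ M, p.2 < K) (hx : K ≤ x)
    (v : ℕ) : Nat.count (fun y => (v, y) ∈ M) x = rowContent M v := by
  rw [Nat.count_eq_card_filter_range, rowContent_apply]
  refine Finset.card_bij (fun y _ => (v, y)) (fun y hy => ?_) (fun y _ y' _ h => ?_)
    (fun p hp => ?_)
  · simp only [Finset.mem_filter] at hy ⊢
    exact ⟨hy.2, trivial⟩
  · simpa using h
  · simp only [Finset.mem_filter] at hp
    refine ⟨p.2, ?_, ?_⟩
    · simp only [Finset.mem_filter, Finset.mem_range, ← hp.2]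
      exact ⟨(hK p hp.1).trans_le hx, hp.1⟩
    · rw [← hp.2]

theorem count_col_eq {M : Finset (ℕ × ℕ)} {N x : ℕ} (hN : InRows N M) (hx : N ≤ x)
    (j : ℕ) : Nat.count (fun y => (y, j) ∈ M) x = colContent M j := by
  rw [Nat.count_eq_card_filter_range, colContent_apply]
  refine Finset.card_bij (fun y _ => (y, j)) (fun y hy => ?_) (fun y _ y' _ h => ?_)
    (fun p hp => ?_)
  · simp only [Finset.mem_filter] at hy ⊢
    exact ⟨hy.2, trivial⟩
  · simpa using h
  · simp only [Finset.mem_filter] at hp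
    refine ⟨p.1, ?_, ?_⟩
    · simp only [Finset.mem_filter, Finset.mem_range, ← hp.2]
      exact ⟨(hN p hp.1).trans_le hx, hp.1⟩
    · rw [← hp.2]

theorem rowDiff_eq_of_le {M : Finset (ℕ × ℕ)} {K x : ℕ} (hK : ∀ p ∈ M, p.2 < K) (hx : K ≤ x)
    (v : ℕ) : rowDiff M v x = rowContent M (v + 1) - rowContent M v := by
  rw [rowDiff, count_row_eq hK hx, count_row_eq hK hx]

theorem colDiff_eq_of_le {M : Finset (ℕ × ℕ)} {N x : ℕ} (hN : InRows N M) (hx : N ≤ x)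
    (j : ℕ) : colDiff M j x = colContent M (j + 1) - colContent M j := by
  rw [colDiff, count_col_eq hN hx, count_col_eq hN hx]

theorem rowDiff_le (M : Finset (ℕ × ℕ)) (v x : ℕ) : rowDiff M v x ≤ rowContent M (v + 1) := by
  obtain ⟨K, hK⟩ := exists_col_bound M
  have h := count_row_eq (x := max K x) hK (le_max_left _ _) (v + 1)
  have h2 := Nat.count_monotone (fun y => (v + 1, y) ∈ M) (le_max_right K x)
  rw [h] at h2
  rw [rowDiff]
  omega

section moves

variable {v c c' j r r' : ℕ} {M A B : Finset (ℕ × ℕ)}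

theorem RowStep.eq_insert (h : RowStep v c M A) : A = insert (v, c) (M.erase (v + 1, c)) := by
  ext p; rw [h.mem_iff]; simp

theorem ColStep.eq_insert (h : ColStep j r M A) : A = insert (r, j) (M.erase (r, j + 1)) := by
  ext p; rw [h.mem_iff]; simp

theorem RowStep.sum_eq {X : Type*} [AddCommMonoid X] (h : RowStep v c M A) (f : ℕ × ℕ → X) :
    ∑ p ∈ A, f p + f (v + 1, c) = ∑ p ∈ M, f p + f (v, c) := by
  rw [h.eq_insert, Finset.sum_insert (by simp [h.notMem]), add_assoc,
    Finset.sum_erase_add _ _ h.mem, add_comm]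

theorem ColStep.sum_eq {X : Type*} [AddCommMonoid X] (h : ColStep j r M A) (f : ℕ × ℕ → X) :
    ∑ p ∈ A, f p + f (r, j + 1) = ∑ p ∈ M, f p + f (r, j) := by
  rw [h.eq_insert, Finset.sum_insert (by simp [h.notMem]), add_assoc,
    Finset.sum_erase_add _ _ h.mem, add_comm]

theorem RowStep.rowContent_eq (h : RowStep v c M A) :
    rowContent A + Finsupp.single (v + 1) 1 = rowContent M + Finsupp.single v 1 :=
  h.sum_eq fun p => Finsupp.single p.1 1

theorem RowStep.colContent_eq (h : RowStep v c M A) : colContent A = colContent M :=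
  add_right_cancel (h.sum_eq fun p => Finsupp.single p.2 1)

theorem ColStep.rowContent_eq (h : ColStep j r M A) : rowContent A = rowContent M :=
  add_right_cancel (h.sum_eq fun p => Finsupp.single p.1 1)

theorem RowMove.col_unique (h : RowMove v c M A) (h' : RowMove v c' M B) : c = c' := by
  wlog hlt : c < c' generalizing c c' A B
  · by_contra hne
    exact hne (this h' h (by omega)).symm
  have h1 := h.2.2 (c' + 1) (by omega)
  have h2 := h'.2.1 (c + 1) (by omega)
  rw [rowDiff_succ M v c', ind_of_mem h'.1.mem, ind_of_notMem h'.1.notMem] at h1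
  omega

theorem RowMove.col_unique_left (h : RowMove v c M A) (h' : RowMove v c' B A) : c = c' := by
  wlog hlt : c < c' generalizing c c' M B
  · by_contra hne
    exact hne (this h' h (by omega)).symm
  have h1 := ((h.1.rowPivot_iff).2 h.2).2 c' (by omega)
  have h2 := ((h'.1.rowPivot_iff).2 h'.2).1 c (by omega)
  rw [rowDiff_succ A v c, ind_of_mem h.1.mem', ind_of_notMem h.1.notMem'] at h1
  omega

theorem ColMove.row_unique (h : ColMove j r M A) (h' : ColMove j r' M B) : r = r' := by
  wlog hlt : r < r' generalizing r r' A B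
  · by_contra hne
    exact hne (this h' h (by omega)).symm
  have h1 := h.2.2 r' (by omega)
  have h2 := h'.2.1 r (by omega)
  rw [colDiff_succ M j r, ind_of_mem h.1.mem, ind_of_notMem h.1.notMem] at h1
  omega

theorem ColMove.row_unique_left (h : ColMove j r M A) (h' : ColMove j r' B A) : r = r' := by
  wlog hlt : r < r' generalizing r r' M B
  · by_contra hne
    exact hne (this h' h (by omega)).symm
  have h1 := ((h.1.colPivot_iff).2 h.2).2 (r' + 1) (by omega)
  have h2 := ((h'.1.colPivot_iff).2 h'.2).1 (r + 1) (by omega)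
  rw [colDiff_succ A j r', ind_of_mem h'.1.mem', ind_of_notMem h'.1.notMem'] at h1
  omega

/-- The raising operator between the rows `v` and `v + 1`. -/
def RowRel (v : ℕ) (M A : Finset (ℕ × ℕ)) : Prop := ∃ c, RowMove v c M A

/-- The raising operator between the columns `j` and `j + 1`. -/
def ColRel (j : ℕ) (M A : Finset (ℕ × ℕ)) : Prop := ∃ r, ColMove j r M A

theorem RowRel.unique (h : RowRel v M A) (h' : RowRel v M B) : A = B := by
  obtain ⟨c, h⟩ := h
  obtain ⟨c', h'⟩ := h'
  obtain rfl := h.col_unique h'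
  exact h.1.unique h'.1

theorem RowRel.unique_left (h : RowRel v M A) (h' : RowRel v B A) : M = B := by
  obtain ⟨c, h⟩ := h
  obtain ⟨c', h'⟩ := h'
  obtain rfl := h.col_unique_left h'
  exact h.1.unique_left h'.1

theorem ColRel.unique (h : ColRel j M A) (h' : ColRel j M B) : A = B := by
  obtain ⟨c, h⟩ := h
  obtain ⟨c', h'⟩ := h'
  obtain rfl := h.row_unique h'
  exact h.1.unique h'.1

theorem ColRel.unique_left (h : ColRel j M A) (h' : ColRel j B A) : M = B := by
  obtain ⟨c, h⟩ := h
  obtain ⟨c', h'⟩ := h'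
  obtain rfl := h.row_unique_left h'
  exact h.1.unique_left h'.1

theorem RowRel.rowContent_eq (h : RowRel v M A) :
    rowContent A + Finsupp.single (v + 1) 1 = rowContent M + Finsupp.single v 1 :=
  h.choose_spec.1.rowContent_eq

theorem RowRel.colContent_eq (h : RowRel v M A) : colContent A = colContent M :=
  h.choose_spec.1.colContent_eq

theorem ColRel.rowContent_eq (h : ColRel j M A) : rowContent A = rowContent M :=
  h.choose_spec.1.rowContent_eq

theorem RowRel.inRows_iff {N : ℕ} (h : RowRel v M A) (hv : v + 1 < N) :
    InRows N A ↔ InRows N M := by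
  obtain ⟨c, h⟩ := h
  constructor
  · intro hA p hp
    by_cases hp' : p = (v + 1, c)
    · rw [hp']; exact hv
    · exact hA p ((h.1.mem_iff p).2 (Or.inr ⟨hp', hp⟩))
  · intro hM p hp
    rcases (h.1.mem_iff p).1 hp with rfl | hp
    · exact (Nat.lt_succ_self v).trans hv
    · exact hM p hp.2

theorem ColRel.inRows {N : ℕ} (h : ColRel j M A) (hM : InRows N M) : InRows N A := by
  obtain ⟨r, h⟩ := h
  intro p hp
  rcases (h.1.mem_iff p).1 hp with rfl | hp
  · exact (show r < N from hM _ h.1.mem)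
  · exact hM p hp.2

theorem ColRel.sum_lt (h : ColRel j M A) : ∑ p ∈ A, p.2 < ∑ p ∈ M, p.2 := by
  obtain ⟨r, h⟩ := h
  have := h.1.sum_eq fun p => p.2
  simp only at this
  omega

theorem RowRel.sum_lt (h : RowRel v M A) : ∑ p ∈ A, p.1 < ∑ p ∈ M, p.1 := by
  obtain ⟨c, h⟩ := h
  have := h.1.sum_eq fun p => p.1
  simp only at this
  omega

/-- The raising operator is defined as soon as some bracket is unmatched, and it decreases the
number of unmatched closing brackets by one. -/
theorem exists_rowRel {k : ℤ} (hk : 0 ≤ k) (h : ∃ x, k + 1 ≤ rowDiff M v x) :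
    ∃ A, RowRel v M A ∧ ∃ x, k ≤ rowDiff A v x := by
  obtain ⟨x, hx⟩ := h
  -- the pivot is the column just before the first maximum of `rowDiff`
  obtain ⟨u, ⟨y, hy⟩, hu⟩ := Int.exists_greatest_of_bdd (P := fun z => ∃ y, rowDiff M v y = z)
    ⟨_, fun z ⟨y, hy⟩ => hy ▸ rowDiff_le M v y⟩ ⟨_, x, rfl⟩
  have hmax : ∀ y, rowDiff M v y ≤ u := fun y => hu _ ⟨y, rfl⟩
  classical
  have hex : ∃ y, rowDiff M v y = u := ⟨y, hy⟩
  obtain ⟨c, hc⟩ : ∃ c, Nat.find hex = c + 1 := by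
    refine Nat.exists_eq_succ_of_ne_zero fun h0 => ?_
    have h1 := Nat.find_spec hex
    rw [h0, rowDiff_zero] at h1
    have := hmax x
    omega
  have h1 := Nat.find_spec hex
  rw [hc] at h1
  have h2 : ∀ y ≤ c, rowDiff M v y < u := fun y hy =>
    lt_of_le_of_ne (hmax y) (Nat.find_min hex (by omega))
  have h3 := rowDiff_succ M v c
  have h4 := h2 c le_rfl
  have n1 := ind_le_one M (v + 1, c)
  have n2 := ind_nonneg M (v, c)
  obtain ⟨A, hA⟩ := exists_rowStep (M := M) (v := v) (c := c) (mem_of_ind_pos (by omega))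
    (notMem_of_ind_lt (by omega))
  refine ⟨A, ⟨c, hA, fun y hy => ?_, fun y _ => ?_⟩, c, ?_⟩
  · have := h2 y hy; omega
  · have := hmax y; omega
  · rw [hA.rowDiff_eq, if_neg (by omega)]
    have := hmax x
    omega

/-- The inverse of the raising operator is defined as soon as there is an unmatched opening
bracket. -/
theorem exists_rowRel_symm {k : ℤ} (hk : 0 ≤ k)
    (h : ∃ x, (rowContent A (v + 1) : ℤ) - rowContent A v + k + 1 ≤ rowDiff A v x) :
    ∃ M, RowRel v M A ∧
      ∃ x, (rowContent M (v + 1) : ℤ) - rowContent M v + k ≤ rowDiff M v x := by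
  obtain ⟨x, hx⟩ := h
  -- the pivot of the inverse operator is the column just after the last maximum of `rowDiff`
  obtain ⟨u, ⟨y, hy⟩, hu⟩ := Int.exists_greatest_of_bdd (P := fun z => ∃ y, rowDiff A v y = z)
    ⟨_, fun z ⟨y, hy⟩ => hy ▸ rowDiff_le A v y⟩ ⟨_, x, rfl⟩
  have hmax : ∀ y, rowDiff A v y ≤ u := fun y => hu _ ⟨y, rfl⟩
  obtain ⟨K, hK⟩ := exists_col_bound A
  have hlt : ∀ y, rowDiff A v y = u → y < K := by
    intro y hy
    by_contra hyK
    rw [rowDiff_eq_of_le hK (by omega)] at hy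
    have := hmax x
    omega
  classical
  set c := Nat.findGreatest (fun y => rowDiff A v y = u) K with hc
  have h1 : rowDiff A v c = u :=
    Nat.findGreatest_spec (P := fun y => rowDiff A v y = u) (hlt y hy).le hy
  have h2 : ∀ y, c < y → rowDiff A v y < u := by
    intro y hy
    refine lt_of_le_of_ne (hmax y) fun h => ?_
    exact Nat.findGreatest_is_greatest (P := fun y => rowDiff A v y = u) hy (hlt y h).le h
  have h3 := rowDiff_succ A v c
  have h4 := h2 (c + 1) (by omega)
  have n1 := ind_nonneg A (v + 1, c)
  have n2 := ind_le_one A (v, c)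
  obtain ⟨M, hM⟩ := exists_rowStep_symm (A := A) (v := v) (c := c) (mem_of_ind_pos (by omega))
    (notMem_of_ind_lt (by omega))
  refine ⟨M, ⟨c, hM, hM.rowPivot_iff.1 ⟨fun y _ => ?_, fun y hy => ?_⟩⟩, c + 1, ?_⟩
  · have := hmax y; omega
  · have := h2 y hy; omega
  · have e := hM.rowDiff_eq (c + 1)
    rw [if_pos (by omega)] at e
    have e1 := DFunLike.congr_fun hM.rowContent_eq (v + 1)
    have e2 := DFunLike.congr_fun hM.rowContent_eq v
    simp only [Finsupp.add_apply, Finsupp.single_apply] at e1 e2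
    simp at e1 e2
    have := hmax x
    omega

end moves

/-! ### Highest weight matrices -/

/-- No row operator is defined: in every initial segment of columns, row `v + 1` has at most as
many cells as row `v`. -/
def RowHW (M : Finset (ℕ × ℕ)) : Prop := ∀ v x, rowDiff M v x ≤ 0

/-- No column operator is defined. -/
def ColHW (M : Finset (ℕ × ℕ)) : Prop := ∀ j B, ¬ColRel j M B

theorem rowHW_iff {M : Finset (ℕ × ℕ)} : RowHW M ↔ ∀ v A, ¬RowRel v M A := by
  constructor
  · rintro h v A ⟨c, hs, hp⟩
    have h1 := rowDiff_succ M v c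
    rw [ind_of_mem hs.mem, ind_of_notMem hs.notMem] at h1
    have h2 := hp.1 0 (Nat.zero_le _)
    rw [rowDiff_zero] at h2
    have := h v (c + 1)
    omega
  · intro h v x
    by_contra hx
    obtain ⟨A, hA, -⟩ := exists_rowRel (M := M) (v := v) le_rfl ⟨x, by omega⟩
    exact h v A hA

/-- A column operator is defined unless `colDiff` is smallest at the bottom: the pivot is the row
just after the last minimum. -/
theorem colHW_iff {N : ℕ} {M : Finset (ℕ × ℕ)} (hN : InRows N M) :
    ColHW M ↔ ∀ j, ∀ x ≤ N, colDiff M j N ≤ colDiff M j x := by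
  constructor
  · intro h j x hx
    by_contra hlt
    push Not at hlt
    classical
    obtain ⟨y, hy, hmin⟩ := Finset.exists_min_image (Finset.range (N + 1)) (colDiff M j)
      ⟨0, by simp⟩
    have hmin' : ∀ z ≤ N, colDiff M j y ≤ colDiff M j z := fun z hz =>
      hmin z (Finset.mem_range.2 (by omega))
    rw [Finset.mem_range] at hy
    set r := Nat.findGreatest (fun z => colDiff M j z = colDiff M j y) N with hr
    have h1 : colDiff M j r = colDiff M j y :=
      Nat.findGreatest_spec (P := fun z => colDiff M j z = colDiff M j y)
        (show y ≤ N by omega) rfl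
    have h2 : ∀ z, r < z → z ≤ N → colDiff M j y < colDiff M j z := by
      intro z hz hzN
      refine lt_of_le_of_ne (hmin' z hzN) fun h => ?_
      exact Nat.findGreatest_is_greatest (P := fun z => colDiff M j z = colDiff M j y)
        hz hzN h.symm
    have hrN : r < N := by
      refine lt_of_le_of_ne (Nat.findGreatest_le _) fun h => ?_
      rw [h] at h1
      have := hmin' x hx
      omega
    have h3 := colDiff_succ M j r
    have h4 := h2 (r + 1) (by omega) (by omega)
    have n1 := ind_le_one M (r, j + 1)
    have n2 := ind_nonneg M (r, j)
    obtain ⟨B, hB⟩ := exists_colStep (M := M) (r := r) (j := j) (mem_of_ind_pos (by omega))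
      (notMem_of_ind_lt (by omega))
    refine h j B ⟨r, hB, fun z hz => ?_, fun z hz => ?_⟩
    · have := hmin' z (by omega); omega
    · rcases le_total z N with hzN | hzN
      · have := h2 z hz hzN; omega
      · rw [colDiff_eq_of_le hN hzN, ← colDiff_eq_of_le hN le_rfl]
        have := h2 N hrN le_rfl
        omega
  · rintro h j B ⟨r, hs, hp⟩
    have h1 := colDiff_succ M j r
    rw [ind_of_mem hs.mem, ind_of_notMem hs.notMem] at h1
    have hr := hN _ hs.mem
    have h2 := h j r (le_of_lt hr)
    have h3 := hp.2 N hr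
    omega

/-- A matrix that is of highest weight for rows and columns is a Young diagram. -/
theorem mem_iff_lt_colContent {M : Finset (ℕ × ℕ)} (hr : RowHW M) (hc : ColHW M) (x j : ℕ) :
    (x, j) ∈ M ↔ x < colContent M j := by
  obtain ⟨N, hN⟩ := exists_row_bound M
  rw [colHW_iff hN] at hc
  -- `key n` says that the rows `≥ N - n` form a Young diagram
  have key : ∀ n ≤ N, ∀ x, N - n ≤ x →
      (∀ j, (x + 1, j) ∈ M → (x, j) ∈ M) ∧ (∀ j, (x, j + 1) ∈ M → (x, j) ∈ M) := by
    intro n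
    induction n with
    | zero =>
      intro _ x hx
      exact ⟨fun j h => absurd (hN _ h) (by simp only; omega),
        fun j h => absurd (hN _ h) (by simp only; omega)⟩
    | succ n ih =>
      intro hn x hx
      rcases Nat.lt_or_ge x (N - n) with hlt | hge
      swap
      · exact ih (by omega) x hge
      have ih := ih (by omega)
      obtain rfl : x = N - (n + 1) := by omega
      set x := N - (n + 1) with hxdef
      have hx1 : N - n = x + 1 := by omega
      have hinit : ∀ j k, k ≤ j → (x + 1, j) ∈ M → (x + 1, k) ∈ M := by
        intro j k hkj hj
        induction j, hkj using Nat.le_induction with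
        | base => exact hj
        | succ j _ ih' => exact ih' ((ih (x + 1) (by omega)).2 j hj)
      have hup : ∀ j, (x + 1, j) ∈ M → (x, j) ∈ M := by
        intro j hj
        by_contra hj'
        have h1 := hr x (j + 1)
        rw [rowDiff_succ, ind_of_mem hj, ind_of_notMem hj'] at h1
        have h2 : 0 ≤ rowDiff M x j := by
          rw [rowDiff]
          have e1 : Nat.count (fun y => (x + 1, y) ∈ M) j = j := by
            rw [Nat.count_iff_forall]
            exact fun k hk => hinit j k hk.le hj
          have e2 := Nat.count_le (p := fun y => (x, y) ∈ M) (n := j)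
          rw [e1]
          omega
        omega
      refine ⟨hup, fun j hj => ?_⟩
      by_contra hj'
      have h1 := hc j x (by omega)
      have h2 : ∀ z, x + 1 ≤ z → (z, j) ∉ M := by
        intro z hz
        induction z, hz using Nat.le_induction with
        | base => exact fun h => hj' (hup j h)
        | succ z hz ih' => exact fun h => ih' ((ih z (by omega)).1 j h)
      have h3 : ∀ z, x + 1 ≤ z → colDiff M j (x + 1) ≤ colDiff M j z := by
        intro z hz
        induction z, hz using Nat.le_induction with
        | base => exact le_rfl
        | succ z hz ih' =>
          rw [colDiff_succ M j z, ind_of_notMem (h2 z hz)]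
          have := ind_nonneg M (z, j + 1)
          omega
      have h4 := h3 N (by omega)
      rw [colDiff_succ, ind_of_mem hj, ind_of_notMem hj'] at h4
      omega
  have hdown : ∀ x j, (x + 1, j) ∈ M → (x, j) ∈ M := fun x j =>
    (key N le_rfl x (by omega)).1 j
  have hlow : ∀ x y j, x ≤ y → (y, j) ∈ M → (x, j) ∈ M := by
    intro x y j hxy hy
    induction y, hxy using Nat.le_induction with
    | base => exact hy
    | succ y _ ih' => exact ih' (hdown y j hy)
  rw [← count_col_eq hN (le_max_left N (x + 1))]
  constructor
  · intro h
    have e1 : Nat.count (fun y => (y, j) ∈ M) (x + 1) = x + 1 := by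
      rw [Nat.count_iff_forall]
      exact fun k hk => hlow k x j (by omega) h
    have e2 := Nat.count_monotone (fun y => (y, j) ∈ M) (le_max_right N (x + 1))
    omega
  · intro h
    by_contra hx
    have e : ∀ z, x ≤ z → Nat.count (fun y => (y, j) ∈ M) z ≤ x := by
      intro z hz
      induction z, hz using Nat.le_induction with
      | base => exact Nat.count_le _
      | succ z hz ih' =>
        rw [Nat.count_succ, if_neg (fun h => hx (hlow x z j hz h))]
        exact ih'
    have := e (max N (x + 1)) (by omega)
    omega

/-! ### Classes of matrices under the row operators -/

/-- The equivalence relation generated by the row operators within the first `N` rows. -/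
def RowEquiv (N : ℕ) : Finset (ℕ × ℕ) → Finset (ℕ × ℕ) → Prop :=
  Relation.EqvGen fun M A => ∃ v, v + 1 < N ∧ RowRel v M A

theorem ncard_eq_of_rel {α β : Type*} {s : Set α} {t : Set β} (R : α → β → Prop)
    (h1 : ∀ a ∈ s, ∃ b ∈ t, R a b) (h2 : ∀ b ∈ t, ∃ a ∈ s, R a b)
    (h3 : ∀ a b b', R a b → R a b' → b = b') (h4 : ∀ a a' b, R a b → R a' b → a = a') :
    s.ncard = t.ncard := by
  choose f hf hR using h1
  refine Set.ncard_congr f hf (fun a b ha hb hab => ?_) (fun b hb => ?_)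
  · exact h4 a b _ (hR a ha) (hab ▸ hR b hb)
  · obtain ⟨a, ha, hab⟩ := h2 b hb
    exact ⟨a, ha, h3 _ _ _ (hR a ha) hab⟩

section equiv

variable {N j : ℕ} {M M' B : Finset (ℕ × ℕ)}

theorem RowEquiv.colContent_eq (h : RowEquiv N M M') : colContent M = colContent M' := by
  induction h with
  | rel x y h => obtain ⟨v, -, h⟩ := h; exact h.colContent_eq.symm
  | refl x => rfl
  | symm x y _ ih => exact ih.symm
  | trans x y z _ _ h1 h2 => exact h1.trans h2

theorem RowEquiv.inRows_iff (h : RowEquiv N M M') : InRows N M ↔ InRows N M' := by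
  induction h with
  | rel x y h => obtain ⟨v, hv, h⟩ := h; exact (h.inRows_iff hv).symm
  | refl x => rfl
  | symm x y _ ih => exact ih.symm
  | trans x y z _ _ h1 h2 => exact h1.trans h2

/-- Column operators lift along the equivalence. -/
theorem RowEquiv.lift (h : RowEquiv N M M') :
    (∀ B, ColRel j M B → ∃ B', ColRel j M' B' ∧ RowEquiv N B B') ∧
      ∀ B, ColRel j M' B → ∃ B', ColRel j M B' ∧ RowEquiv N B B' := by
  induction h with
  | rel x y h =>
    obtain ⟨v, hv, c, h⟩ := h
    constructor
    · rintro B ⟨r, hB⟩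
      obtain ⟨C, c', r', h1, h2⟩ := diamond_of_span h hB
      exact ⟨C, ⟨r', h1⟩, .rel _ _ ⟨v, hv, c', h2⟩⟩
    · rintro B ⟨r, hB⟩
      obtain ⟨C, c', r', h1, h2⟩ := diamond_of_row_col h hB
      exact ⟨C, ⟨r', h1⟩, .symm _ _ (.rel _ _ ⟨v, hv, c', h2⟩)⟩
  | refl x => exact ⟨fun B h => ⟨B, h, .refl _⟩, fun B h => ⟨B, h, .refl _⟩⟩
  | symm x y _ ih => exact ih.symm
  | trans x y z _ _ h1 h2 =>
    constructor
    · intro B hB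
      obtain ⟨C, hC, e1⟩ := h1.1 B hB
      obtain ⟨D, hD, e2⟩ := h2.1 C hC
      exact ⟨D, hD, .trans _ _ _ e1 e2⟩
    · intro B hB
      obtain ⟨C, hC, e1⟩ := h2.2 B hB
      obtain ⟨D, hD, e2⟩ := h1.2 C hC
      exact ⟨D, hD, .trans _ _ _ e1 e2⟩

/-- Inverses of column operators lift along the equivalence. -/
theorem RowEquiv.lift_symm (h : RowEquiv N M M') :
    (∀ B, ColRel j B M → ∃ B', ColRel j B' M' ∧ RowEquiv N B B') ∧
      ∀ B, ColRel j B M' → ∃ B', ColRel j B' M ∧ RowEquiv N B B' := by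
  induction h with
  | rel x y h =>
    obtain ⟨v, hv, c, h⟩ := h
    constructor
    · rintro B ⟨r, hB⟩
      obtain ⟨A, c', r', h1, h2⟩ := diamond_of_col_row hB h
      exact ⟨A, ⟨r', h2⟩, .rel _ _ ⟨v, hv, c', h1⟩⟩
    · rintro B ⟨r, hB⟩
      obtain ⟨A, c', r', h1, h2⟩ := diamond_of_cospan hB h
      exact ⟨A, ⟨r', h2⟩, .symm _ _ (.rel _ _ ⟨v, hv, c', h1⟩)⟩
  | refl x => exact ⟨fun B h => ⟨B, h, .refl _⟩, fun B h => ⟨B, h, .refl _⟩⟩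
  | symm x y _ ih => exact ih.symm
  | trans x y z _ _ h1 h2 =>
    constructor
    · intro B hB
      obtain ⟨C, hC, e1⟩ := h1.1 B hB
      obtain ⟨D, hD, e2⟩ := h2.1 C hC
      exact ⟨D, hD, .trans _ _ _ e1 e2⟩
    · intro B hB
      obtain ⟨C, hC, e1⟩ := h2.2 B hB
      obtain ⟨D, hD, e2⟩ := h1.2 C hC
      exact ⟨D, hD, .trans _ _ _ e1 e2⟩

theorem RowEquiv.colHW (h : RowEquiv N M M') (hM : ColHW M) : ColHW M' := by
  intro j B hB
  obtain ⟨B', hB', -⟩ := h.lift.2 B hB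
  exact hM j B' hB'

theorem RowHW.colRel (hM : RowHW M) (h : ColRel j M B) : RowHW B := by
  rw [rowHW_iff] at hM ⊢
  rintro v C ⟨c, hC⟩
  obtain ⟨r, h⟩ := h
  obtain ⟨A, c', r', h1, -⟩ := diamond_of_col_row h hC
  exact hM v A ⟨c', h1⟩

theorem eq_of_rowHW_of_colHW (h1 : RowHW M) (h2 : ColHW M) (h1' : RowHW M') (h2' : ColHW M')
    (h : colContent M = colContent M') : M = M' := by
  ext ⟨x, y⟩
  rw [mem_iff_lt_colContent h1 h2, mem_iff_lt_colContent h1' h2', h]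

/-- Each class contains at most one highest weight matrix. -/
theorem RowEquiv.eq_of_rowHW (h : RowEquiv N M M') (h1 : RowHW M) (h2 : RowHW M') : M = M' := by
  induction hn : ∑ p ∈ M, p.2 using Nat.strong_induction_on generalizing M M' with
  | _ n ih =>
    by_cases hc : ColHW M
    · exact eq_of_rowHW_of_colHW h1 hc h2 (h.colHW hc) h.colContent_eq
    · unfold ColHW at hc
      push Not at hc
      obtain ⟨j, B, hB⟩ := hc
      obtain ⟨B', hB', hE⟩ := h.lift.1 B hB
      obtain rfl := ih _ (hn ▸ hB.sum_lt) hE (h1.colRel hB) (h2.colRel hB') rfl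
      exact hB.unique_left hB'

/-- Each class contains a highest weight matrix. -/
theorem exists_rowHW (hM : InRows N M) : ∃ T, RowEquiv N M T ∧ RowHW T := by
  induction hn : ∑ p ∈ M, p.1 using Nat.strong_induction_on generalizing M with
  | _ n ih =>
    by_cases hc : RowHW M
    · exact ⟨M, .refl _, hc⟩
    · rw [rowHW_iff] at hc
      push Not at hc
      obtain ⟨v, A, hA⟩ := hc
      have hv : v + 1 < N := hM _ hA.choose_spec.1.mem
      obtain ⟨T, hT, hT'⟩ := ih _ (hn ▸ hA.sum_lt) ((hA.inRows_iff hv).2 hM) rfl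
      exact ⟨T, .trans _ _ _ (.rel _ _ ⟨v, hv, hA⟩) hT, hT'⟩

/-- The number of column highest weight matrices in `N` rows with column content `κ` and row
content `d`. -/
noncomputable def hwCount (N : ℕ) (κ d : ℕ →₀ ℕ) : ℕ :=
  {M | InRows N M ∧ ColHW M ∧ colContent M = κ ∧ rowContent M = d}.ncard

/-- The number of matrices of given row content in the class of a highest weight matrix `T` only
depends on the row content of `T`. -/
theorem exists_ncard_class (hN : InRows N M) (hM : RowHW M) :
    ∃ T, RowHW T ∧ ColHW T ∧ InRows N T ∧ rowContent T = rowContent M ∧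
      ∀ d, {A | RowEquiv N A M ∧ rowContent A = d}.ncard = hwCount N (colContent T) d := by
  induction hn : ∑ p ∈ M, p.2 using Nat.strong_induction_on generalizing M with
  | _ n ih =>
    by_cases hc : ColHW M
    · refine ⟨M, hM, hc, hN, rfl, fun d => ?_⟩
      unfold hwCount
      congr 1
      ext A
      simp only [Set.mem_ofPred_eq]
      constructor
      · rintro ⟨h, hd⟩
        exact ⟨h.inRows_iff.2 hN, RowEquiv.colHW (.symm _ _ h) hc, h.colContent_eq, hd⟩
      · rintro ⟨h1, h2, h3, hd⟩
        obtain ⟨T, hT, hT'⟩ := exists_rowHW h1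
        obtain rfl := eq_of_rowHW_of_colHW hT' (hT.colHW h2) hM hc
          (hT.colContent_eq.symm.trans h3)
        exact ⟨hT, hd⟩
    · unfold ColHW at hc
      push Not at hc
      obtain ⟨j, B, hB⟩ := hc
      obtain ⟨T, t1, t2, t3, t4, t5⟩ := ih _ (hn ▸ hB.sum_lt) (hB.inRows hN) (hM.colRel hB) rfl
      refine ⟨T, t1, t2, t3, t4.trans hB.rowContent_eq, fun d => ?_⟩
      rw [← t5 d]
      -- the column operator maps the class of `M` bijectively to that of `B`
      refine ncard_eq_of_rel (ColRel j) ?_ ?_ (fun a b b' h h' => h.unique h')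
        (fun a a' b h h' => h.unique_left h')
      · rintro A ⟨hA, hd⟩
        obtain ⟨A', hA', hE⟩ := hA.lift.2 B hB
        exact ⟨A', ⟨.symm _ _ hE, hA'.rowContent_eq.trans hd⟩, hA'⟩
      · rintro A ⟨hA, hd⟩
        obtain ⟨A', hA', hE⟩ := hA.lift_symm.2 M hB
        obtain h := hA'.rowContent_eq
        exact ⟨A', ⟨.symm _ _ hE, h.symm.trans hd⟩, hA'⟩

/-- The `k`-th power of a row operator. -/
def RowIter (v : ℕ) : ℕ → Finset (ℕ × ℕ) → Finset (ℕ × ℕ) → Prop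
  | 0, M, A => M = A
  | k + 1, M, A => ∃ B, RowRel v M B ∧ RowIter v k B A

theorem RowIter.snoc {v k : ℕ} {M B A : Finset (ℕ × ℕ)} (h : RowIter v k M B)
    (h' : RowRel v B A) : RowIter v (k + 1) M A := by
  induction k generalizing M with
  | zero => obtain rfl := h; exact ⟨A, h', rfl⟩
  | succ k ih =>
    obtain ⟨C, hC, h⟩ := h
    exact ⟨C, hC, ih h⟩

theorem RowIter.unique {v k : ℕ} {M A B : Finset (ℕ × ℕ)} (h : RowIter v k M A)
    (h' : RowIter v k M B) : A = B := by
  induction k generalizing M with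
  | zero => exact h.symm.trans h'
  | succ k ih =>
    obtain ⟨C, hC, h⟩ := h
    obtain ⟨C', hC', h'⟩ := h'
    obtain rfl := hC.unique hC'
    exact ih h h'

theorem RowIter.unique_left {v k : ℕ} {M A B : Finset (ℕ × ℕ)} (h : RowIter v k M A)
    (h' : RowIter v k B A) : M = B := by
  induction k generalizing M B with
  | zero => exact Eq.trans h h'.symm
  | succ k ih =>
    obtain ⟨C, hC, h⟩ := h
    obtain ⟨C', hC', h'⟩ := h'
    obtain rfl := ih h h'
    exact hC.unique_left hC'

theorem RowIter.rowContent_eq {v k : ℕ} {M A : Finset (ℕ × ℕ)} (h : RowIter v k M A) :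
    rowContent A + Finsupp.single (v + 1) k = rowContent M + Finsupp.single v k := by
  induction k generalizing M with
  | zero => obtain rfl := h; simp
  | succ k ih =>
    obtain ⟨C, hC, h⟩ := h
    have h1 := ih h
    have h2 := hC.rowContent_eq
    rw [Finsupp.single_add, Finsupp.single_add, ← add_assoc, h1, add_right_comm, h2,
      add_right_comm, add_assoc]

theorem exists_rowIter {v k : ℕ} {M : Finset (ℕ × ℕ)} (h : ∃ x, (k : ℤ) ≤ rowDiff M v x) :
    ∃ A, RowIter v k M A := by
  induction k generalizing M with
  | zero => exact ⟨M, rfl⟩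
  | succ k ih =>
    obtain ⟨B, hB, hx⟩ := exists_rowRel (k := (k : ℤ)) (by omega) (by exact_mod_cast h)
    obtain ⟨A, hA⟩ := ih hx
    exact ⟨A, B, hB, hA⟩

theorem exists_rowIter_symm {v k : ℕ} {A : Finset (ℕ × ℕ)}
    (h : ∃ x, (rowContent A (v + 1) : ℤ) - rowContent A v + k ≤ rowDiff A v x) :
    ∃ M, RowIter v k M A := by
  induction k generalizing A with
  | zero => exact ⟨A, rfl⟩
  | succ k ih =>
    obtain ⟨B, hB, hx⟩ := exists_rowRel_symm (k := (k : ℤ)) (by omega)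
      (by push_cast at h; simpa only [add_assoc] using h)
    obtain ⟨M, hM⟩ := ih hx
    exact ⟨M, hM.snoc hB⟩

end equiv

/-- The number of column highest weight matrices is symmetric in the row content. -/
theorem hwCount_swap {N v : ℕ} (hv : v + 1 < N) (κ d d' : ℕ →₀ ℕ)
    (hd : ∀ x, d' x = d (Equiv.swap v (v + 1) x)) : hwCount N κ d' = hwCount N κ d := by
  wlog hle : d v ≤ d (v + 1) generalizing d d'
  · refine (this d' d (fun x => ?_) ?_).symm
    · rw [hd, Equiv.swap_apply_self]
    · rw [hd, hd, Equiv.swap_apply_left, Equiv.swap_apply_right]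
      omega
  -- the `k`-th power of the row operator is a bijection between both sides
  obtain ⟨k, hk⟩ := Nat.exists_eq_add_of_le hle
  have hdd : d' + Finsupp.single (v + 1) k = d + Finsupp.single v k := by
    ext x
    simp only [Finsupp.add_apply, Finsupp.single_apply, hd]
    by_cases h1 : x = v
    · subst h1; simp [hk]
    · by_cases h2 : x = v + 1
      · subst h2; simp [hk]
      · rw [swap_of_ne h1 h2, if_neg (Ne.symm h1), if_neg (Ne.symm h2)]
  have hX : ∀ {M A}, RowRel v M A → ((InRows N M ∧ ColHW M ∧ colContent M = κ) ↔
      (InRows N A ∧ ColHW A ∧ colContent A = κ)) := by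
    intro M A h
    have hE : RowEquiv N M A := .rel _ _ ⟨v, hv, h⟩
    rw [hE.inRows_iff, hE.colContent_eq]
    exact and_congr_right fun _ => and_congr_left fun _ =>
      ⟨hE.colHW, RowEquiv.colHW (.symm _ _ hE)⟩
  have hXk : ∀ {k M A}, RowIter v k M A → ((InRows N M ∧ ColHW M ∧ colContent M = κ) ↔
      (InRows N A ∧ ColHW A ∧ colContent A = κ)) := by
    intro k
    induction k with
    | zero => rintro M A rfl; rfl
    | succ k ih => rintro M A ⟨B, hB, h⟩; exact (hX hB).trans (ih h)
  symm
  refine ncard_eq_of_rel (RowIter v k) ?_ ?_ (fun a b b' h h' => h.unique h')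
        (fun a a' b h h' => h.unique_left h')
  · rintro M ⟨h1, h2, h3, h4⟩
    obtain ⟨K, hK⟩ := exists_col_bound M
    obtain ⟨A, hA⟩ := exists_rowIter (v := v) (k := k) (M := M)
      ⟨K, by rw [rowDiff_eq_of_le hK le_rfl, h4]; omega⟩
    obtain ⟨h5, h6, h7⟩ := (hXk hA).1 ⟨h1, h2, h3⟩
    refine ⟨A, ⟨h5, h6, h7, ?_⟩, hA⟩
    have := hA.rowContent_eq
    rw [h4, ← hdd] at this
    exact add_right_cancel this
  · rintro A ⟨h1, h2, h3, h4⟩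
    obtain ⟨M, hM⟩ := exists_rowIter_symm (v := v) (k := k) (A := A)
      ⟨0, by rw [rowDiff_zero, h4, hd, hd, Equiv.swap_apply_left, Equiv.swap_apply_right]; omega⟩
    obtain ⟨h5, h6, h7⟩ := (hXk hM).2 ⟨h1, h2, h3⟩
    refine ⟨M, ⟨h5, h6, h7, ?_⟩, hM⟩
    have := hM.rowContent_eq
    rw [h4, hdd] at this
    exact (add_right_cancel this).symm

/-! ### Words of sets -/

/-- The column sets of a word of sets: the positions at which the set contains `j`. -/
def colSets (L : List (Finset ℕ)) (j : ℕ) : Finset ℕ :=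
  (Finset.range L.length).filter fun v => j ∈ L.getD v ∅

theorem mem_colSets {L : List (Finset ℕ)} {j v : ℕ} : v ∈ colSets L j ↔ j ∈ L.getD v ∅ := by
  rw [colSets, Finset.mem_filter, Finset.mem_range, and_iff_right_iff_imp]
  intro h
  by_contra hv
  rw [List.getD_eq_default _ _ (by omega)] at h
  simp at h

/-- Two words of sets are congruent if replacing one by the other inside of any word of sets does
not change the rises. -/
def Cong (X Y : List (Finset ℕ)) : Prop :=
  ∀ L₁ L₂ k, riseList (colSets (L₁ ++ X ++ L₂)) k = riseList (colSets (L₁ ++ Y ++ L₂)) k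

theorem Cong.refl (X : List (Finset ℕ)) : Cong X X := fun _ _ _ => rfl

theorem Cong.symm {X Y : List (Finset ℕ)} (h : Cong X Y) : Cong Y X :=
  fun L₁ L₂ k => (h L₁ L₂ k).symm

theorem Cong.trans {X Y Z : List (Finset ℕ)} (h : Cong X Y) (h' : Cong Y Z) : Cong X Z :=
  fun L₁ L₂ k => (h L₁ L₂ k).trans (h' L₁ L₂ k)

theorem Cong.append {X Y : List (Finset ℕ)} (h : Cong X Y) (P Q : List (Finset ℕ)) :
    Cong (P ++ X ++ Q) (P ++ Y ++ Q) := fun L₁ L₂ k => by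
  have := h (L₁ ++ P) (Q ++ L₂) k
  simpa only [List.append_assoc] using this

theorem cong_empty : Cong [∅] [] := fun L₁ L₂ k => by
  have h := riseList_image (S := colSets (L₁ ++ [] ++ L₂))
    (φ := fun _ v => if v < L₁.length then v else v + 1)
    (fun j b _ b' _ hb => by split_ifs <;> omega)
    (fun j b _ b' _ => by split_ifs <;> omega) k
  rw [← h.2]
  congr 1
  funext j
  ext v
  simp only [Finset.mem_image, mem_colSets, List.append_nil]
  rw [List.append_assoc]
  constructor
  · intro hv
    rcases lt_trichotomy v L₁.length with h1 | h1 | h1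
    · rw [List.getD_append _ _ _ _ h1] at hv
      exact ⟨v, by rwa [List.getD_append _ _ _ _ h1], if_pos h1⟩
    · rw [List.getD_append_right _ _ _ _ h1.ge, h1, Nat.sub_self] at hv
      simp at hv
    · obtain ⟨w, rfl⟩ : ∃ w, v = L₁.length + (w + 1) := ⟨v - L₁.length - 1, by omega⟩
      rw [List.getD_append_right _ _ _ _ h1.le, Nat.add_sub_cancel_left] at hv
      refine ⟨L₁.length + w, ?_, ?_⟩
      · rw [List.getD_append_right _ _ _ _ (by omega), Nat.add_sub_cancel_left]
        simpa using hv
      · rw [if_neg (by omega)]; omega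
  · rintro ⟨w, hw, rfl⟩
    by_cases h1 : w < L₁.length
    · rw [if_pos h1, List.getD_append _ _ _ _ h1]
      rwa [List.getD_append _ _ _ _ h1] at hw
    · rw [if_neg h1, List.getD_append_right _ _ _ _ (by omega)]
      rw [List.getD_append_right _ _ _ _ (by omega)] at hw
      rw [show w + 1 - L₁.length = (w - L₁.length) + 1 by omega]
      simpa using hw

/-- The difference of the numbers of elements `< x`. -/
def setDiff (A B : Finset ℕ) (x : ℕ) : ℤ := Nat.count (· ∈ B) x - Nat.count (· ∈ A) x

theorem setDiff_succ (A B : Finset ℕ) (x : ℕ) : setDiff A B (x + 1) =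
    setDiff A B x + (if x ∈ B then 1 else 0) - (if x ∈ A then 1 else 0) := by
  simp only [setDiff, Nat.count_succ]
  push_cast
  ring

/-- The row operators do not change the rises: this is the point where the bracketing rule meets the
greedy matching. -/
theorem cong_rowMove {A B : Finset ℕ} {c : ℕ} (hB : c ∈ B) (hA : c ∉ A)
    (hl : ∀ x ≤ c, setDiff A B x ≤ setDiff A B c)
    (hr : ∀ x, c < x → setDiff A B x ≤ setDiff A B (c + 1)) :
    Cong [A, B] [insert c A, B.erase c] := fun L₁ L₂ k => by
  set v := L₁.length with hv
  have m0 : ∀ (X Y : Finset ℕ) k, v ∈ colSets (L₁ ++ [X, Y] ++ L₂) k ↔ k ∈ X := fun X Y k => by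
    rw [mem_colSets, List.append_assoc, List.getD_append_right _ _ _ _ hv.ge, hv, Nat.sub_self]
    simp
  have m1 : ∀ (X Y : Finset ℕ) k, v + 1 ∈ colSets (L₁ ++ [X, Y] ++ L₂) k ↔ k ∈ Y :=
    fun X Y k => by
      rw [mem_colSets, List.append_assoc, List.getD_append_right _ _ _ _ (by omega), hv,
        Nat.add_sub_cancel_left]
      simp
  have m2 : ∀ (X Y X' Y' : Finset ℕ) k x, x ≠ v → x ≠ v + 1 →
      (x ∈ colSets (L₁ ++ [X, Y] ++ L₂) k ↔ x ∈ colSets (L₁ ++ [X', Y'] ++ L₂) k) := by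
    intro X Y X' Y' k x h1 h2
    rw [mem_colSets, mem_colSets, List.append_assoc, List.append_assoc]
    rcases Nat.lt_or_ge x v with h | h
    · rw [List.getD_append _ _ _ _ h, List.getD_append _ _ _ _ h]
    · obtain ⟨y, rfl⟩ : ∃ y, x = L₁.length + (y + 2) := ⟨x - v - 2, by omega⟩
      rw [List.getD_append_right _ _ _ _ h, List.getD_append_right _ _ _ _ h,
        Nat.add_sub_cancel_left]
      simp
  refine (riseList_lower (j := c) (v := v) ((m1 _ _ _).2 hB) (fun h => hA ((m0 _ _ _).1 h))
    ?_ ?_ ?_ ?_ k).symm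
  · ext x
    rw [mem_image_swap]
    by_cases h1 : x = v
    · subst h1; rw [Equiv.swap_apply_left, m0, m1]; simp [hB]
    · by_cases h2 : x = v + 1
      · subst h2; rw [Equiv.swap_apply_right, m0, m1]; simp [hA]
      · rw [swap_of_ne h1 h2]; exact m2 _ _ _ _ _ _ h1 h2
  · intro k hk
    ext x
    by_cases h1 : x = v
    · subst h1; rw [m0, m0]; simp [hk]
    · by_cases h2 : x = v + 1
      · subst h2; rw [m1, m1]; simp [hk]
      · exact m2 _ _ _ _ _ _ h1 h2
  · simp only [m0, m1]
    -- going left from `c`, the first column not in `A ∩ B` is not in `A`, for otherwise it would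
    -- contain an unmatched opening bracket
    have key : ∀ n ≤ c, (∃ k₀ ≤ c, (∀ k, k₀ ≤ k → k < c → k ∈ B) ∧ ∀ k, k + 1 = k₀ → k ∉ A) ∨
        ∀ k, c - n ≤ k → k < c → k ∈ A ∧ k ∈ B := by
      intro n
      induction n with
      | zero => exact fun _ => Or.inr fun k h1 h2 => by omega
      | succ n ih =>
        intro hn
        rcases ih (by omega) with h | h
        · exact Or.inl h
        · obtain ⟨k, hk⟩ : ∃ k, k + 1 = c - n := ⟨c - (n + 1), by omega⟩
          have hd : ∀ y, k + 1 ≤ y → y ≤ c → setDiff A B y = setDiff A B (k + 1) := by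
            intro y hy
            induction y, hy using Nat.le_induction with
            | base => exact fun _ => rfl
            | succ y hy ihy =>
              intro hyc
              obtain ⟨a1, a2⟩ := h y (by omega) (by omega)
              rw [setDiff_succ, ihy (by omega), if_pos a1, if_pos a2]
              ring
          by_cases hkA : k ∈ A
          · by_cases hkB : k ∈ B
            · refine Or.inr fun k' h1 h2 => ?_
              rcases Nat.lt_or_ge k k' with h3 | h3
              · exact h k' (by omega) h2
              · obtain rfl : k' = k := by omega
                exact ⟨hkA, hkB⟩
            · exfalso
              have h1 := hl k (by omega)
              rw [hd c (by omega) le_rfl, setDiff_succ, if_pos hkA, if_neg hkB] at h1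
              omega
          · refine Or.inl ⟨k + 1, by omega, fun k' h1 h2 => (h k' (by omega) h2).2, ?_⟩
            intro k' hk'
            obtain rfl : k' = k := by omega
            exact hkA
    rcases key c le_rfl with h | h
    · exact h
    · exact ⟨0, Nat.zero_le _, fun k h1 h2 => (h k (by omega) h2).2, fun k hk => by omega⟩
  · simp only [m0, m1]
    -- going right from `c`, the first column not in `A ∩ B` is not in `B`, for otherwise it would
    -- contain an unmatched closing bracket
    have hex : ∃ m, c < m ∧ ¬(m ∈ A ∧ m ∈ B) := by
      refine ⟨c + B.sup id + 1, by omega, fun h => ?_⟩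
      have := Finset.le_sup (f := id) h.2
      simp only [id] at this
      omega
    classical
    set m := Nat.find hex with hm
    obtain ⟨m1, m2⟩ := Nat.find_spec hex
    have m3 : ∀ k, c < k → k < m → k ∈ A ∧ k ∈ B := by
      intro k h1 h2
      have := Nat.find_min hex h2
      by_contra h
      exact this ⟨h1, h⟩
    refine ⟨m, m1, m3, fun hmB => ?_⟩
    have hmA : m ∉ A := fun h => m2 ⟨h, hmB⟩
    have hd : ∀ y, c + 1 ≤ y → y ≤ m → setDiff A B y = setDiff A B (c + 1) := by
      intro y hy
      induction y, hy using Nat.le_induction with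
      | base => exact fun _ => rfl
      | succ y hy ihy =>
        intro hyc
        obtain ⟨a1, a2⟩ := m3 y (by omega) (by omega)
        rw [setDiff_succ, ihy (by omega), if_pos a1, if_pos a2]
        ring
    have h1 := hr (m + 1) (by omega)
    rw [setDiff_succ, hd m (by omega) le_rfl, if_pos hmB, if_neg hmA] at h1
    omega

theorem count_union_le (B C : Finset ℕ) (x : ℕ) :
    Nat.count (· ∈ B ∪ C) x ≤ Nat.count (· ∈ B) x + Nat.count (· ∈ C) x := by
  induction x with
  | zero => simp
  | succ x ih =>
    simp only [Nat.count_succ, Finset.mem_union] at ih ⊢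
    split_ifs <;> first | omega | simp_all

theorem count_mono_subset {B C : Finset ℕ} (h : B ⊆ C) (x : ℕ) :
    Nat.count (· ∈ B) x ≤ Nat.count (· ∈ C) x := Nat.count_mono_left fun _ _ hk => h hk

theorem count_eq_zero_of_forall_le {A : Finset ℕ} {x : ℕ} (h : ∀ a ∈ A, x ≤ a) :
    Nat.count (· ∈ A) x = 0 := by
  rw [Nat.count_eq_card_filter_range, Finset.card_eq_zero, Finset.filter_eq_empty_iff]
  intro y hy hyA
  have := h y hyA
  rw [Finset.mem_range] at hy
  omega

/-- A set `C` of small elements can be moved past `B` to the set `A`, provided that every element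
of `B` is matched by an element of `A`: the elements of `C`, starting with the largest, are the
unmatched closing brackets, which the row operator moves one by one. -/
theorem cong_block {A B C : Finset ℕ} (hA : ∀ c ∈ C, ∀ a ∈ A, c < a) (hB : ∀ c ∈ C, ∀ b ∈ B, c < b)
    (hm : ∀ x, Nat.count (· ∈ B) x ≤ Nat.count (· ∈ A) x) : Cong [A, B ∪ C] [A ∪ C, B] := by
  induction C using Finset.induction_on_max generalizing A with
  | empty => simpa using Cong.refl _
  | insert c C hc ih =>
    have hcC : c ∉ C := fun h => lt_irrefl _ (hc c h)
    have hcA : c ∉ A := fun h => lt_irrefl _ (hA c (by simp) c h)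
    have hcB : c ∉ B := fun h => lt_irrefl _ (hB c (by simp) c h)
    have h0 : ∀ x ≤ c + 1, Nat.count (· ∈ A) x = 0 := fun x hx =>
      count_eq_zero_of_forall_le fun a ha => by have := hA c (by simp) a ha; omega
    have h1 : Cong [A, B ∪ insert c C] [insert c A, (B ∪ insert c C).erase c] := by
      refine cong_rowMove (by simp) hcA (fun x hx => ?_) (fun x hx => ?_)
      · simp only [setDiff, h0 x (by omega), h0 c (by omega)]
        have := Nat.count_monotone (· ∈ B ∪ insert c C) hx
        omega
      · simp only [setDiff, h0 (c + 1) le_rfl]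
        have e1 := count_union_le B (insert c C) x
        have e2 : Nat.count (· ∈ insert c C) x = Nat.count (· ∈ insert c C) (c + 1) := by
          have : ∀ y, c + 1 ≤ y →
              Nat.count (· ∈ insert c C) y = Nat.count (· ∈ insert c C) (c + 1) := by
            intro y hy
            induction y, hy using Nat.le_induction with
            | base => rfl
            | succ y hy ihy =>
              rw [Nat.count_succ, ihy, if_neg, add_zero]
              rw [Finset.mem_insert]
              rintro (h | h)
              · omega
              · have := hc y h; omega
          exact this x hx
        have e3 := count_mono_subset (Finset.subset_union_right (s₁ := B) (s₂ := insert c C))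
          (c + 1)
        have e4 := hm x
        omega
    have h2 := ih (A := insert c A) (fun x hx a ha => by
        rcases Finset.mem_insert.1 ha with rfl | ha
        · exact hc x hx
        · exact hA x (Finset.mem_insert_of_mem hx) a ha)
      (fun x hx b hb => hB x (Finset.mem_insert_of_mem hx) b hb)
      (fun x => (hm x).trans (count_mono_subset (Finset.subset_insert _ _) x))
    have e1 : (B ∪ insert c C).erase c = B ∪ C := by
      rw [Finset.union_insert, Finset.erase_insert]
      simp [hcC, hcB]
    have e2 : insert c A ∪ C = A ∪ insert c C := by
      rw [Finset.insert_union, Finset.union_insert]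
    rw [e1] at h1
    rw [e2] at h2
    exact h1.trans h2

theorem count_singleton_le {s t : ℕ} (h : s ≤ t) (x : ℕ) :
    Nat.count (· ∈ ({t} : Finset ℕ)) x ≤ Nat.count (· ∈ ({s} : Finset ℕ)) x := by
  have : ∀ t x, Nat.count (· ∈ ({t} : Finset ℕ)) x = if t < x then 1 else 0 := by
    intro t x
    induction x with
    | zero => simp
    | succ x ih =>
      rw [Nat.count_succ, ih]
      simp only [Finset.mem_singleton]
      split_ifs <;> omega
  rw [this, this]
  split_ifs <;> omega

/-- Letters of a weakly increasing word let a set of smaller elements pass, which is absorbed by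
the first letter. -/
theorem cong_singletons {t : ℕ} {ts : List ℕ} {C : Finset ℕ} (hs : (t :: ts).Pairwise (· ≤ ·))
    (hC : ∀ c ∈ C, c < t) :
    Cong ((t :: ts).map singleton ++ [C]) (insert t C :: ts.map singleton) := by
  induction ts generalizing t with
  | nil =>
    have h1 := cong_block (A := {t}) (B := ∅) (C := C) (by simpa using hC) (by simp) (by simp)
    have h2 := cong_empty.append [{t} ∪ C] []
    simp only [Finset.empty_union] at h1
    rw [Finset.insert_eq]
    exact h1.trans (by simpa using h2)
  | cons t' ts ih =>
    rw [List.pairwise_cons] at hs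
    have htt : t ≤ t' := hs.1 t' (by simp)
    have h1 := (ih hs.2 (fun c hc => (hC c hc).trans_le htt)).append [{t}] []
    have h2 := (cong_block (A := {t}) (B := {t'}) (C := C) (by simpa using hC)
      (by simpa using fun c hc => (hC c hc).trans_le htt) (count_singleton_le htt)).append []
      (ts.map singleton)
    rw [← Finset.insert_eq, ← Finset.insert_eq] at h2
    exact Cong.trans (by simpa using h1) (by simpa using h2)

/-- Adding a row of bigger letters at the bottom of a sequence of columns: the letters of the row
pass the columns one after the other until each reaches its own column. -/
theorem cong_row (k m : ℕ) (hkm : k ≤ m) (t : ℕ → ℕ) (g : ℕ → Finset ℕ)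
    (ht : ∀ i i', i ≤ i' → i' < k → t i ≤ t i') (hg : ∀ i < k, ∀ c ∈ g i, c < t i) :
    Cong ((List.range k).map (fun i => {t i}) ++ (List.range m).map g)
      ((List.range m).map fun i => if i < k then insert (t i) (g i) else g i) := by
  induction k generalizing m t g with
  | zero => simpa using Cong.refl _
  | succ k ih =>
    obtain ⟨m, rfl⟩ : ∃ n, m = n + 1 := ⟨m - 1, by omega⟩
    have h1 := cong_singletons (t := t 0) (ts := (List.range k).map fun i => t (i + 1))
      (C := g 0) ?_ (hg 0 (by omega))
    · have h1 := h1.append [] ((List.range m).map fun i => g (i + 1))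
      have h2 := (ih m (by omega) (fun i => t (i + 1)) (fun i => g (i + 1))
        (fun i i' h h' => ht _ _ (by omega) (by omega))
        (fun i hi => hg (i + 1) (by omega))).append [insert (t 0) (g 0)] []
      rw [List.range_succ_eq_map, List.range_succ_eq_map]
      simp only [List.map_cons, List.map_map, Function.comp_def, List.append_assoc,
        List.nil_append, List.append_nil, List.cons_append, Nat.succ_eq_add_one,
        add_lt_add_iff_right, Nat.zero_lt_succ, if_true] at h1 h2 ⊢
      exact h1.trans h2
    · rw [List.pairwise_cons]
      constructor
      · intro a ha
        rw [List.mem_map] at ha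
        obtain ⟨i, hi, rfl⟩ := ha
        rw [List.mem_range] at hi
        exact ht _ _ (by omega) (by omega)
      · rw [List.pairwise_map]
        exact List.Pairwise.imp_of_mem (fun {a b} _ hb h =>
          ht _ _ (by omega) (by rw [List.mem_range] at hb; omega)) List.pairwise_lt_range

/-- The set of columns of the cells in row `v`. -/
def rowSet (M : Finset (ℕ × ℕ)) (v : ℕ) : Finset ℕ := (M.filter fun p => p.1 = v).image Prod.snd

theorem mem_rowSet {M : Finset (ℕ × ℕ)} {v c : ℕ} : c ∈ rowSet M v ↔ (v, c) ∈ M := by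
  simp only [rowSet, Finset.mem_image, Finset.mem_filter]
  constructor
  · rintro ⟨p, ⟨hp, rfl⟩, rfl⟩; exact hp
  · intro h; exact ⟨_, ⟨h, rfl⟩, rfl⟩

/-- The first `N` rows of a matrix as a word of sets. -/
def rowWord (N : ℕ) (M : Finset (ℕ × ℕ)) : List (Finset ℕ) := (List.range N).map (rowSet M)

theorem rowWord_split {N v : ℕ} (hv : v + 1 < N) (M : Finset (ℕ × ℕ)) :
    rowWord N M = (List.range v).map (rowSet M) ++ [rowSet M v, rowSet M (v + 1)] ++
      (List.range (N - (v + 2))).map fun i => rowSet M (v + 2 + i) := by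
  obtain ⟨n, rfl⟩ : ∃ n, N = v + 2 + n := ⟨N - (v + 2), by omega⟩
  rw [rowWord, List.range_add, List.range_add]
  simp [List.range_succ, Function.comp_def]

theorem RowEquiv.cong {N : ℕ} {M A : Finset (ℕ × ℕ)} (h : RowEquiv N M A) :
    Cong (rowWord N M) (rowWord N A) := by
  induction h with
  | rel M A h =>
    obtain ⟨v, hv, c, hs, hp⟩ := h
    rw [rowWord_split hv M, rowWord_split hv A]
    have e1 : ∀ w, w ≠ v → w ≠ v + 1 → rowSet A w = rowSet M w := by
      intro w h1 h2
      ext x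
      rw [mem_rowSet, mem_rowSet, hs.mem_iff]
      simp [h1, h2]
    have e2 : rowSet A v = insert c (rowSet M v) := by
      ext x
      rw [mem_rowSet, hs.mem_iff, Finset.mem_insert, mem_rowSet]
      simp
    have e3 : rowSet A (v + 1) = (rowSet M (v + 1)).erase c := by
      ext x
      rw [mem_rowSet, hs.mem_iff, Finset.mem_erase, mem_rowSet]
      simp
    have e4 : (List.range v).map (rowSet A) = (List.range v).map (rowSet M) :=
      List.map_congr_left fun w hw => by rw [List.mem_range] at hw; exact e1 w (by omega) (by omega)
    have e5 : ((List.range (N - (v + 2))).map fun i => rowSet A (v + 2 + i)) =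
        (List.range (N - (v + 2))).map fun i => rowSet M (v + 2 + i) :=
      List.map_congr_left fun w _ => e1 _ (by omega) (by omega)
    rw [e4, e5, e2, e3]
    have hd : ∀ x, setDiff (rowSet M v) (rowSet M (v + 1)) x = rowDiff M v x := fun x => by
      simp only [setDiff, rowDiff, mem_rowSet]
    refine (cong_rowMove (mem_rowSet.2 hs.mem) (fun h => hs.notMem (mem_rowSet.1 h)) ?_ ?_).append
      _ _
    · simpa only [hd] using hp.1
    · simpa only [hd] using hp.2
  | refl x => exact .refl _
  | symm x y _ ih => exact ih.symm
  | trans x y z _ _ h1 h2 => exact h1.trans h2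

/-! ### Semistandard tableaux as sequences of column sets -/

/-- The set of entries of column `c` of a tableau. -/
def colSet {nu : YoungDiagram} (T : SemistandardYoungTableau nu) (c : ℕ) : Finset ℕ :=
  (Finset.range (nu.colLen c)).image fun i => T i c

section colSet

variable {nu : YoungDiagram} (T : SemistandardYoungTableau nu)

theorem mem_colSet {c x : ℕ} : x ∈ colSet T c ↔ ∃ i, (i, c) ∈ nu ∧ T i c = x := by
  simp [colSet, YoungDiagram.mem_iff_lt_colLen]

theorem entry_lt_iff {i i' c : ℕ} (h : (i, c) ∈ nu) (h' : (i', c) ∈ nu) :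
    T i c < T i' c ↔ i < i' := by
  constructor
  · intro hlt
    by_contra hle
    exact absurd (T.col_weak (not_lt.1 hle) h) (by omega)
  · exact fun hlt => T.col_strict hlt h'

theorem entry_injOn {i i' c : ℕ} (h : (i, c) ∈ nu) (h' : (i', c) ∈ nu) (he : T i c = T i' c) :
    i = i' := by
  have h1 := entry_lt_iff T h h'
  have h2 := entry_lt_iff T h' h
  omega

theorem card_colSet (c : ℕ) : (colSet T c).card = nu.colLen c := by
  rw [colSet, Finset.card_image_of_injOn, Finset.card_range]
  intro i hi i' hi' h
  simp only [Finset.coe_range, Set.mem_Iio, ← YoungDiagram.mem_iff_lt_colLen] at hi hi'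
  exact entry_injOn T hi hi' h

theorem count_colSet (c x : ℕ) : Nat.count (· ∈ colSet T c) x =
    ((Finset.range (nu.colLen c)).filter fun i => T i c < x).card := by
  rw [Nat.count_eq_card_filter_range]
  symm
  refine Finset.card_bij (fun i _ => T i c) (fun i hi => ?_) (fun i hi i' hi' h => ?_)
    (fun y hy => ?_)
  · simp only [Finset.mem_filter, Finset.mem_range] at hi ⊢
    exact ⟨hi.2, (mem_colSet T).2 ⟨i, YoungDiagram.mem_iff_lt_colLen.2 hi.1, rfl⟩⟩
  · simp only [Finset.mem_filter, Finset.mem_range, ← YoungDiagram.mem_iff_lt_colLen] at hi hi'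
    exact entry_injOn T hi.1 hi'.1 h
  · simp only [Finset.mem_filter, Finset.mem_range] at hy
    obtain ⟨i, hi, rfl⟩ := (mem_colSet T).1 hy.2
    refine ⟨i, ?_, rfl⟩
    simp only [Finset.mem_filter, Finset.mem_range]
    exact ⟨YoungDiagram.mem_iff_lt_colLen.1 hi, hy.1⟩

theorem count_colSet_succ_le (c x : ℕ) :
    Nat.count (· ∈ colSet T (c + 1)) x ≤ Nat.count (· ∈ colSet T c) x := by
  rw [count_colSet, count_colSet]
  refine Finset.card_le_card fun i hi => ?_
  simp only [Finset.mem_filter, Finset.mem_range] at hi ⊢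
  refine ⟨hi.1.trans_le (nu.colLen_anti _ _ (Nat.le_succ c)), lt_of_le_of_lt ?_ hi.2⟩
  exact T.row_weak (Nat.lt_succ_self c) (YoungDiagram.mem_iff_lt_colLen.2 hi.1)

theorem nth_colSet {i c : ℕ} (h : (i, c) ∈ nu) : Nat.nth (· ∈ colSet T c) i = T i c := by
  have h1 : Nat.count (· ∈ colSet T c) (T i c) = i := by
    rw [count_colSet]
    have : (Finset.range (nu.colLen c)).filter (fun i' => T i' c < T i c) = Finset.range i := by
      ext i'
      simp only [Finset.mem_filter, Finset.mem_range]
      constructor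
      · rintro ⟨h1, h2⟩
        exact (entry_lt_iff T (YoungDiagram.mem_iff_lt_colLen.2 h1) h).1 h2
      · intro h1
        exact ⟨h1.trans (YoungDiagram.mem_iff_lt_colLen.1 h), T.col_strict h1 h⟩
    rw [this, Finset.card_range]
  have h2 : T i c ∈ colSet T c := (mem_colSet T).2 ⟨i, h, rfl⟩
  have h3 := Nat.nth_count (p := (· ∈ colSet T c)) h2
  rwa [h1] at h3

theorem colSet_injective {T T' : SemistandardYoungTableau nu}
    (h : ∀ c, colSet T c = colSet T' c) : T = T' := by
  ext i c
  by_cases hic : (i, c) ∈ nu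
  · rw [← nth_colSet T hic, ← nth_colSet T' hic, h]
  · rw [T.zeros hic, T'.zeros hic]

end colSet

theorem lt_card_of_ofPred {A : Finset ℕ} {i : ℕ} (h : i < A.card) :
    ∀ hf : (Set.ofPred (· ∈ A)).Finite, i < hf.toFinset.card := fun hf => by
  have : hf.toFinset = A := by ext x; simp
  rwa [this]

/-- A sequence of sets, of the sizes of the columns of a diagram, consists of the columns of a
tableau if the number of small elements decreases along the sequence. -/
theorem exists_tableau {nu : YoungDiagram} {C : ℕ → Finset ℕ} (hC : ∀ c, (C c).card = nu.colLen c)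
    (h : ∀ c x, Nat.count (· ∈ C (c + 1)) x ≤ Nat.count (· ∈ C c) x) :
    ∃ T : SemistandardYoungTableau nu, ∀ c, colSet T c = C c := by
  have hmem : ∀ {i c}, (i, c) ∈ nu → ∀ hf : (Set.ofPred (· ∈ C c)).Finite,
      i < hf.toFinset.card := fun {i c} hic =>
    lt_card_of_ofPred (by rw [hC]; exact YoungDiagram.mem_iff_lt_colLen.1 hic)
  have hrow : ∀ i c, (i, c + 1) ∈ nu → Nat.nth (· ∈ C c) i ≤ Nat.nth (· ∈ C (c + 1)) i := by
    intro i c hic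
    refine Nat.lt_succ_iff.1 (Nat.nth_lt_of_lt_count ?_)
    have h1 := h c (Nat.nth (· ∈ C (c + 1)) i + 1)
    rw [Nat.count_nth_succ (hmem hic)] at h1
    exact h1
  have hrow' : ∀ i j j', j ≤ j' → (i, j') ∈ nu →
      Nat.nth (· ∈ C j) i ≤ Nat.nth (· ∈ C j') i := by
    intro i j j' hj
    induction j', hj using Nat.le_induction with
    | base => exact fun _ => le_rfl
    | succ c hc ih =>
      exact fun hic => (ih (nu.up_left_mem le_rfl (Nat.le_succ c) hic)).trans (hrow i c hic)
  refine ⟨⟨fun i j => if (i, j) ∈ nu then Nat.nth (· ∈ C j) i else 0, fun {i j j'} hj hij => ?_,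
    fun {i i' j} hi hij => ?_, fun {i j} hij => if_neg hij⟩, fun c => ?_⟩
  · rw [if_pos hij, if_pos (nu.up_left_mem le_rfl hj.le hij)]
    exact hrow' i j j' hj.le hij
  · rw [if_pos hij, if_pos (nu.up_left_mem hi.le le_rfl hij)]
    exact Nat.nth_lt_nth' hi (hmem hij)
  · ext x
    rw [mem_colSet]
    constructor
    · rintro ⟨i, hi, rfl⟩
      change (if (i, c) ∈ nu then Nat.nth (· ∈ C c) i else 0) ∈ C c
      rw [if_pos hi]
      exact Nat.nth_mem (p := (· ∈ C c)) i (hmem hi)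
    · intro hx
      obtain ⟨i, hi, rfl⟩ := Nat.exists_lt_card_nth_eq (p := (· ∈ C c)) hx
      have hf : (Set.ofPred (· ∈ C c)).Finite := (C c).finite_toSet
      have h1 := hi hf
      have h2 : hf.toFinset = C c := by ext x; simp
      rw [h2, hC] at h1
      have hic := YoungDiagram.mem_iff_lt_colLen.2 h1
      refine ⟨i, hic, ?_⟩
      change (if (i, c) ∈ nu then Nat.nth (· ∈ C c) i else 0) = _
      rw [if_pos hic]

/-- The matrix whose row `c` consists of the entries of column `c` of a tableau. -/
def tabMatrix {nu : YoungDiagram} (T : SemistandardYoungTableau nu) : Finset (ℕ × ℕ) :=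
  nu.cells.image fun p => (p.2, T p.1 p.2)

section tabMatrix

variable {nu : YoungDiagram} (T : SemistandardYoungTableau nu)

theorem mem_tabMatrix {c x : ℕ} : (c, x) ∈ tabMatrix T ↔ x ∈ colSet T c := by
  rw [mem_colSet]
  simp only [tabMatrix, Finset.mem_image, YoungDiagram.mem_cells, Prod.exists, Prod.mk.injEq]
  constructor
  · rintro ⟨i, j, h, rfl, rfl⟩; exact ⟨i, h, rfl⟩
  · rintro ⟨i, h, rfl⟩; exact ⟨i, c, h, rfl, rfl⟩

theorem rowHW_tabMatrix : RowHW (tabMatrix T) := by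
  intro v x
  have h := count_colSet_succ_le T v x
  simp only [rowDiff, mem_tabMatrix]
  omega

theorem sum_tabMatrix {X : Type*} [AddCommMonoid X] (f : ℕ × ℕ → X) :
    ∑ p ∈ tabMatrix T, f p = ∑ p ∈ nu.cells, f (p.2, T p.1 p.2) := by
  rw [tabMatrix, Finset.sum_image]
  rintro ⟨i, j⟩ hi ⟨i', j'⟩ hi' h
  simp only [Prod.mk.injEq] at h
  obtain ⟨rfl, h⟩ := h
  rw [entry_injOn T ((YoungDiagram.mem_cells _).1 hi) ((YoungDiagram.mem_cells _).1 hi') h]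

theorem colContent_tabMatrix : colContent (tabMatrix T) = content nu.cells T :=
  sum_tabMatrix T fun p => Finsupp.single p.2 1

theorem rowContent_eq_card (M : Finset (ℕ × ℕ)) (v : ℕ) :
    rowContent M v = (rowSet M v).card := by
  rw [rowContent_apply, rowSet, Finset.card_image_of_injOn]
  rintro ⟨a, b⟩ h ⟨a', b'⟩ h' e
  simp only [Finset.coe_filter, Set.mem_ofPred_eq] at h h' e
  rw [h.2, h'.2, e]

theorem rowSet_tabMatrix (c : ℕ) : rowSet (tabMatrix T) c = colSet T c := by
  ext x; rw [mem_rowSet, mem_tabMatrix]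

theorem rowContent_tabMatrix (c : ℕ) : rowContent (tabMatrix T) c = nu.colLen c := by
  rw [rowContent_eq_card, rowSet_tabMatrix, card_colSet]

theorem tabMatrix_injective {T T' : SemistandardYoungTableau nu}
    (h : tabMatrix T = tabMatrix T') : T = T' :=
  colSet_injective fun c => by rw [← rowSet_tabMatrix, ← rowSet_tabMatrix, h]

end tabMatrix

theorem eq_of_colLen_eq {mu nu : YoungDiagram} (h : ∀ j, mu.colLen j = nu.colLen j) : mu = nu := by
  ext ⟨i, j⟩
  rw [YoungDiagram.mem_cells, YoungDiagram.mem_cells, YoungDiagram.mem_iff_lt_colLen,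
    YoungDiagram.mem_iff_lt_colLen, h]

theorem degree_rowContent (M : Finset (ℕ × ℕ)) : (rowContent M).degree = M.card := by
  simp [rowContent]

theorem degree_colContent (M : Finset (ℕ × ℕ)) : (colContent M).degree = M.card := by
  simp [colContent]

/-- A finitely supported weakly decreasing sequence gives the column lengths of a diagram. -/
theorem exists_diagram (f : ℕ →₀ ℕ) (hf : ∀ c, f (c + 1) ≤ f c) :
    ∃ nu : YoungDiagram, ∀ c, nu.colLen c = f c := by
  have hanti : Antitone f := antitone_nat_of_succ_le hf
  let nu : YoungDiagram :=
    { cells := f.support.biUnion fun c => (Finset.range (f c)).image fun i => (i, c)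
      isLowerSet := by
        rintro ⟨i, c⟩ ⟨i', c'⟩ ⟨h1, h2⟩ h
        simp only [Finset.coe_biUnion, Set.mem_iUnion, Finset.mem_coe, Finset.mem_image,
          Finset.mem_range, Prod.mk.injEq, Finsupp.mem_support_iff] at h ⊢
        obtain ⟨d, hd, k, hk, rfl, rfl⟩ := h
        have := hanti h2
        simp only at h1 this
        exact ⟨c', by omega, i', by omega, rfl, rfl⟩ }
  have hmem : ∀ i c, (i, c) ∈ nu ↔ i < f c := by
    intro i c
    rw [← YoungDiagram.mem_cells]
    simp only [nu, Finset.mem_biUnion, Finset.mem_image, Finset.mem_range, Prod.mk.injEq,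
      Finsupp.mem_support_iff]
    constructor
    · rintro ⟨d, -, k, hk, rfl, rfl⟩; exact hk
    · intro h; exact ⟨c, by omega, i, h, rfl, rfl⟩
  refine ⟨nu, fun c => ?_⟩
  have h : ∀ i, i < nu.colLen c ↔ i < f c := fun i => by
    rw [← YoungDiagram.mem_iff_lt_colLen, hmem]
  have h1 := h (nu.colLen c)
  have h2 := h (f c)
  omega

/-- Every row highest weight matrix comes from a tableau. -/
theorem exists_tabMatrix {M : Finset (ℕ × ℕ)} (hM : RowHW M) :
    ∃ (nu : YoungDiagram) (T : SemistandardYoungTableau nu), tabMatrix T = M := by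
  obtain ⟨nu, hnu⟩ := exists_diagram (rowContent M) fun c => by
    obtain ⟨K, hK⟩ := exists_col_bound M
    have := hM c K
    rw [rowDiff_eq_of_le hK le_rfl] at this
    omega
  obtain ⟨T, hT⟩ := exists_tableau (nu := nu) (C := rowSet M)
    (fun c => by rw [hnu, rowContent_eq_card]) (fun c x => by
      have := hM c x
      simp only [rowDiff] at this
      simp only [mem_rowSet]
      omega)
  refine ⟨nu, T, ?_⟩
  ext ⟨c, x⟩
  rw [mem_tabMatrix, hT, mem_rowSet]

theorem card_tabMatrix {nu : YoungDiagram} (T : SemistandardYoungTableau nu) :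
    (tabMatrix T).card = nu.card := by
  have := sum_tabMatrix T fun _ => 1
  simpa using this

/-! ### Counting highest weight matrices by tableaux -/

/-- The permutation that reverses the order of `0, …, N - 1`. -/
def rev (N : ℕ) : Equiv.Perm ℕ :=
  Function.Involutive.toPerm (fun x => if x < N then N - 1 - x else x) (fun x => by
    simp only
    split_ifs <;> omega)

theorem rev_of_lt {N x : ℕ} (h : x < N) : rev N x = N - 1 - x := if_pos h

theorem rev_lt_iff {N x : ℕ} : rev N x < N ↔ x < N := by
  change (if x < N then N - 1 - x else x) < N ↔ _
  split_ifs <;> omega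

theorem rev_rev (N x : ℕ) : rev N (rev N x) = x := (rev N).symm_apply_apply x

/-- The columns of a tableau with entries smaller than `N`, turned upside down. -/
def revMatrix (N : ℕ) {nu : YoungDiagram} (U : SemistandardYoungTableau nu) : Finset (ℕ × ℕ) :=
  (tabMatrix U).image fun p => (rev N p.2, p.1)

section revMatrix

variable {nu : YoungDiagram} (U : SemistandardYoungTableau nu) (N : ℕ)

theorem mem_revMatrix {x j : ℕ} : (x, j) ∈ revMatrix N U ↔ rev N x ∈ colSet U j := by
  rw [← mem_tabMatrix]
  simp only [revMatrix, Finset.mem_image, Prod.exists, Prod.mk.injEq]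
  constructor
  · rintro ⟨c, y, h, rfl, rfl⟩; rwa [rev_rev]
  · intro h; exact ⟨j, rev N x, h, rev_rev _ _, rfl⟩

theorem sum_revMatrix {X : Type*} [AddCommMonoid X] (f : ℕ × ℕ → X) :
    ∑ p ∈ revMatrix N U, f p = ∑ p ∈ tabMatrix U, f (rev N p.2, p.1) := by
  rw [revMatrix, Finset.sum_image]
  rintro ⟨i, j⟩ _ ⟨i', j'⟩ _ h
  simp only [Prod.mk.injEq, EmbeddingLike.apply_eq_iff_eq] at h
  rw [h.1, h.2]

theorem rowContent_revMatrix :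
    rowContent (revMatrix N U) = (content nu.cells U).mapDomain (rev N) := by
  rw [← colContent_tabMatrix, rowContent, sum_revMatrix, colContent, Finsupp.mapDomain_finsetSum]
  simp [Finsupp.mapDomain_single]

theorem colContent_revMatrix (j : ℕ) : colContent (revMatrix N U) j = nu.colLen j := by
  rw [← rowContent_tabMatrix U j, rowContent, colContent, sum_revMatrix]

theorem revMatrix_injective {U U' : SemistandardYoungTableau nu}
    (h : revMatrix N U = revMatrix N U') : U = U' := by
  refine colSet_injective fun c => ?_
  ext x
  rw [← rev_rev N x, ← mem_revMatrix, ← mem_revMatrix, h]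

end revMatrix

theorem count_rev_add_count {N x : ℕ} (S : Finset ℕ) (hx : x ≤ N) :
    Nat.count (fun z => rev N z ∈ S) (N - x) + Nat.count (· ∈ S) x =
      Nat.count (fun z => rev N z ∈ S) N := by
  induction x with
  | zero => simp
  | succ x ih =>
    rw [← ih (by omega), Nat.count_succ]
    obtain ⟨n, rfl⟩ : ∃ n, N = n + (x + 1) := ⟨N - (x + 1), by omega⟩
    rw [Nat.add_sub_cancel, show n + (x + 1) - x = n + 1 by omega, Nat.count_succ,
      rev_of_lt (x := n) (by omega), show n + (x + 1) - 1 - n = x by omega]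
    omega

/-- Column highest weight matrices are tableaux turned upside down: the highest weight condition
compares the numbers of cells of neighbouring columns in the last rows, the tableau condition those
of small entries. -/
theorem hwCount_eq {N : ℕ} {nu : YoungDiagram} {κ d : ℕ →₀ ℕ} (hκ : ∀ j, κ j = nu.colLen j)
    (hd : ∀ x, d x ≠ 0 → x < N) : hwCount N κ d = (SSYT nu (d.mapDomain (rev N))).card := by
  have hdd : (d.mapDomain (rev N)).mapDomain (rev N) = d := by
    rw [← Finsupp.mapDomain_comp]
    have : (rev N : ℕ → ℕ) ∘ rev N = id := funext fun x => rev_rev N x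
    rw [this, Finsupp.mapDomain_id]
  rw [← Set.ncard_coe_finset]
  symm
  refine Set.ncard_congr (fun U _ => revMatrix N U) (fun U hU => ?_)
    (fun U U' _ _ h => revMatrix_injective N h) (fun M hM => ?_)
  · have hU : content nu.cells U = d.mapDomain (rev N) := by
      simpa [SSYT] using hU
    have hrow : InRows N (revMatrix N U) := by
      rintro ⟨x, j⟩ hp
      rw [mem_revMatrix, mem_colSet] at hp
      obtain ⟨i, hi, hp⟩ := hp
      have h1 := mem_support_content (F := U) ((YoungDiagram.mem_cells _).2 hi)
      simp only [hp] at h1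
      rw [hU, Finsupp.mem_support_iff, Finsupp.mapDomain_equiv_apply] at h1
      have h2 := hd _ h1
      rwa [Equiv.symm_apply_apply] at h2
    refine ⟨hrow, (colHW_iff hrow).2 fun j x hx => ?_, ?_, ?_⟩
    · have h1 := count_rev_add_count (colSet U j) (x := N - x) (N := N) (by omega)
      have h2 := count_rev_add_count (colSet U (j + 1)) (x := N - x) (N := N) (by omega)
      have h3 := count_colSet_succ_le U j (N - x)
      rw [Nat.sub_sub_self hx] at h1 h2
      simp only [colDiff, mem_revMatrix]
      omega
    · ext j; rw [colContent_revMatrix, hκ]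
    · rw [rowContent_revMatrix, hU, hdd]
  · obtain ⟨hrow, hcol, hc, hr⟩ := hM
    have hmem : ∀ j y, y ∈ (Finset.range N).filter (fun y => (rev N y, j) ∈ M) ↔
        (rev N y, j) ∈ M := by
      intro j y
      rw [Finset.mem_filter, Finset.mem_range, and_iff_right_iff_imp]
      exact fun h => rev_lt_iff.1 (hrow _ h)
    have hcount : ∀ j x, x ≤ N →
        (Nat.count (· ∈ (Finset.range N).filter (fun y => (rev N y, j) ∈ M)) x : ℤ) =
          colContent M j - Nat.count (fun z => (z, j) ∈ M) (N - x) := by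
      intro j x hx
      have h1 := count_rev_add_count ((Finset.range N).filter (fun y => (rev N y, j) ∈ M)) hx
      rw [← count_col_eq hrow le_rfl]
      simp only [hmem, rev_rev] at h1 ⊢
      omega
    have hle : ∀ j x, x ≤ N →
        Nat.count (· ∈ (Finset.range N).filter (fun y => (rev N y, j + 1) ∈ M)) x ≤
          Nat.count (· ∈ (Finset.range N).filter (fun y => (rev N y, j) ∈ M)) x := by
      intro j x hx
      have h1 := hcount j x hx
      have h2 := hcount (j + 1) x hx
      have h3 := (colHW_iff hrow).1 hcol j (N - x) (by omega)
      rw [colDiff_eq_of_le hrow le_rfl, colDiff] at h3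
      omega
    have hstable : ∀ j x, N ≤ x →
        Nat.count (· ∈ (Finset.range N).filter (fun y => (rev N y, j) ∈ M)) x =
          Nat.count (· ∈ (Finset.range N).filter (fun y => (rev N y, j) ∈ M)) N := by
      intro j x hx
      induction x, hx using Nat.le_induction with
      | base => rfl
      | succ x hx ih => rw [Nat.count_succ, ih, if_neg (by simp; omega), add_zero]
    obtain ⟨U, hU⟩ := exists_tableau (nu := nu)
      (C := fun j => (Finset.range N).filter (fun y => (rev N y, j) ∈ M))
      (fun j => by
        rw [← hκ, ← hc]
        have h1 := hcount j N le_rfl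
        rw [Nat.sub_self, Nat.count_zero, Nat.count_eq_card_filter_range] at h1
        have h2 : (Finset.range N).filter
            (· ∈ (Finset.range N).filter (fun y => (rev N y, j) ∈ M)) =
            (Finset.range N).filter (fun y => (rev N y, j) ∈ M) := by
          ext y; simp
        rw [h2] at h1
        omega)
      (fun j x => by
        rcases le_total x N with hx | hx
        · exact hle j x hx
        · rw [hstable j x hx, hstable (j + 1) x hx]
          exact hle j N le_rfl)
    have hUM : revMatrix N U = M := by
      ext ⟨x, j⟩
      rw [mem_revMatrix, hU, hmem, rev_rev]
    refine ⟨U, ?_, hUM⟩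
    rw [← hUM, rowContent_revMatrix] at hr
    have : content nu.cells U = d.mapDomain (rev N) := by
      rw [← hr, ← Finsupp.mapDomain_comp]
      have : (rev N : ℕ → ℕ) ∘ rev N = id := funext fun x => rev_rev N x
      rw [this, Finsupp.mapDomain_id]
    simpa [SSYT] using this

/-- A function of finitely supported exponents that is invariant under adjacent transpositions is
invariant under all permutations. -/
theorem invariant_of_adjacent {X : Type*} {f : (ℕ →₀ ℕ) → X}
    (h : ∀ v d, f (d.mapDomain (Equiv.swap v (v + 1))) = f d) (s : Equiv.Perm ℕ) (d : ℕ →₀ ℕ) :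
    f (d.mapDomain s) = f d := by
  let G : Subgroup (Equiv.Perm ℕ) :=
    { carrier := {s | ∀ d : ℕ →₀ ℕ, f (d.mapDomain s) = f d}
      one_mem' := fun d => by rw [Equiv.Perm.coe_one, Finsupp.mapDomain_id]
      mul_mem' := fun {a b} ha hb d => by
        rw [Equiv.Perm.coe_mul, Finsupp.mapDomain_comp, ha, hb]
      inv_mem' := fun {a} ha d => by
        rw [← ha, ← Finsupp.mapDomain_comp, ← Equiv.Perm.coe_mul, mul_inv_cancel,
          Equiv.Perm.coe_one, Finsupp.mapDomain_id] }
  -- `s` need not be a product of transpositions, but it agrees with one on the support of `d`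
  have hswap : ∀ i n, Equiv.swap i (i + n) ∈ G := by
    intro i n
    induction n with
    | zero => rw [add_zero, Equiv.swap_self]; exact G.one_mem
    | succ n ih =>
      rcases Nat.eq_zero_or_pos n with rfl | hn
      · exact h i
      · have := Equiv.swap_mul_swap_mul_swap (x := i) (y := i + n) (z := i + n + 1)
          (by omega) (by omega)
        rw [Equiv.swap_comm, ← add_assoc, ← this]
        exact G.mul_mem (G.mul_mem (h _) ih) (h _)
  have hswap' : ∀ i j, Equiv.swap i j ∈ G := by
    intro i j
    rcases le_total i j with hij | hij
    · obtain ⟨n, rfl⟩ := Nat.exists_eq_add_of_le hij; exact hswap i n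
    · obtain ⟨n, rfl⟩ := Nat.exists_eq_add_of_le hij
      rw [Equiv.swap_comm]; exact hswap j n
  have hext : ∀ D : Finset ℕ, ∃ t ∈ G, ∀ x ∈ D, t x = s x := by
    intro D
    induction D using Finset.induction_on with
    | empty => exact ⟨1, G.one_mem, by simp⟩
    | insert a D ha ih =>
      obtain ⟨t, ht, hts⟩ := ih
      refine ⟨Equiv.swap (t a) (s a) * t, G.mul_mem (hswap' _ _) ht, fun x hx => ?_⟩
      rw [Equiv.Perm.mul_apply]
      rcases Finset.mem_insert.1 hx with rfl | hx
      · exact Equiv.swap_apply_left _ _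
      · have hxa : x ≠ a := fun h => ha (h ▸ hx)
        rw [Equiv.swap_apply_of_ne_of_ne (fun h => hxa (t.injective h))
          (fun h => hxa (s.injective (by rw [← hts x hx, h]))), hts x hx]
  obtain ⟨t, ht, hts⟩ := hext d.support
  rw [← Finsupp.mapDomain_congr hts]
  exact ht d

/-- The symmetry of Schur functions, by the row operators on column highest weight matrices. -/
theorem SSYT_card_swap (nu : YoungDiagram) (v : ℕ) (d : ℕ →₀ ℕ) :
    (SSYT nu (d.mapDomain (Equiv.swap v (v + 1)))).card = (SSYT nu d).card := by
  obtain ⟨κ, hκ⟩ : ∃ κ : ℕ →₀ ℕ, ∀ j, κ j = nu.colLen j := by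
    refine ⟨columnLengths nu, fun j => rfl⟩
  set N := d.support.sup id + v + 3 with hN
  have hd : ∀ x, d x ≠ 0 → x < N := fun x hx => by
    have : id x ≤ _ := Finset.le_sup (f := id) (Finsupp.mem_support_iff.2 hx)
    simp only [id] at this
    omega
  have hinv : ∀ e : ℕ →₀ ℕ, (e.mapDomain (rev N)).mapDomain (rev N) = e := by
    intro e
    rw [← Finsupp.mapDomain_comp]
    have : (rev N : ℕ → ℕ) ∘ rev N = id := funext fun x => rev_rev N x
    rw [this, Finsupp.mapDomain_id]
  have hrs : (rev N).symm = rev N := rfl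
  have hsup : ∀ e : ℕ →₀ ℕ, (∀ x, e x ≠ 0 → x < N) →
      ∀ x, e.mapDomain (rev N) x ≠ 0 → x < N := by
    intro e he x hx
    rw [Finsupp.mapDomain_equiv_apply, hrs] at hx
    exact rev_lt_iff.1 (he _ hx)
  have hd' : ∀ x, d.mapDomain (Equiv.swap v (v + 1)) x ≠ 0 → x < N := by
    intro x hx
    rw [Finsupp.mapDomain_equiv_apply, Equiv.symm_swap, Equiv.swap_apply_def] at hx
    split_ifs at hx with h1 h2
    · omega
    · omega
    · exact hd x hx
  have e1 := hwCount_eq hκ (hsup d hd)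
  have e2 := hwCount_eq hκ (hsup _ hd')
  rw [hinv] at e1 e2
  rw [← e1, ← e2]
  refine hwCount_swap (v := N - 2 - v) (by omega) κ _ _ fun x => ?_
  rw [Finsupp.mapDomain_equiv_apply, Finsupp.mapDomain_equiv_apply,
    Finsupp.mapDomain_equiv_apply, hrs, Equiv.symm_swap]
  congr 1
  have r1 : rev N (N - 2 - v) = v + 1 := by rw [rev_of_lt (by omega)]; omega
  have r2 : rev N (N - 2 - v + 1) = v := by rw [rev_of_lt (by omega)]; omega
  have := (rev N).injective.swap_apply (N - 2 - v) (N - 2 - v + 1) x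
  rwa [r1, r2, Equiv.swap_comm] at this

theorem SSYT_card_mapDomain (nu : YoungDiagram) (s : Equiv.Perm ℕ) (d : ℕ →₀ ℕ) :
    (SSYT nu (d.mapDomain s)).card = (SSYT nu d).card :=
  invariant_of_adjacent (f := fun d => (SSYT nu d).card) (SSYT_card_swap nu) s d

/-- The number of column highest weight matrices is a Kostka number. -/
theorem hwCount_eq_card {N : ℕ} {nu : YoungDiagram} {κ d : ℕ →₀ ℕ} (hκ : ∀ j, κ j = nu.colLen j)
    (hd : ∀ x, d x ≠ 0 → x < N) : hwCount N κ d = (SSYT nu d).card := by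
  rw [hwCount_eq hκ hd, SSYT_card_mapDomain]

/-! ### The reading word of a tableau -/

theorem cong_replicate_empty (N : ℕ) : Cong [] ((List.range N).map fun _ => (∅ : Finset ℕ)) := by
  induction N with
  | zero => exact .refl _
  | succ N ih =>
    have h1 := ih.append [] [∅]
    rw [List.range_succ, List.map_append]
    exact cong_empty.symm.trans (by simpa using h1)

/-- The reading word is congruent to the word whose letters are the columns. -/
theorem cong_readingWord {nu : YoungDiagram} (T : SemistandardYoungTableau nu) {N : ℕ}
    (hN : nu.rowLen 0 ≤ N) :
    Cong ((readingWord T).map singleton) (rowWord N (tabMatrix T)) := by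
  -- the columns of the part of the tableau in the rows `< n`
  let g : ℕ → ℕ → Finset ℕ := fun n c =>
    ((Finset.range n).filter fun i => i < nu.colLen c).image fun i => T i c
  have key : ∀ n, Cong (((List.range n).reverse.flatMap fun i =>
      (List.range (nu.rowLen i)).map fun j => T i j).map singleton)
      ((List.range N).map (g n)) := by
    intro n
    induction n with
    | zero => simpa [g] using cong_replicate_empty N
    | succ n ih =>
      have h1 := ih.append (((List.range (nu.rowLen n)).map fun j => T n j).map singleton) []
      have h2 := cong_row (nu.rowLen n) N ((nu.rowLen_anti 0 n (Nat.zero_le _)).trans hN)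
        (fun j => T n j) (g n)
        (fun i i' h h' => T.row_weak_of_le h (YoungDiagram.mem_iff_lt_rowLen.2 h'))
        (fun i hi c hc => by
          simp only [g, Finset.mem_image, Finset.mem_filter, Finset.mem_range] at hc
          obtain ⟨k, ⟨hk, -⟩, rfl⟩ := hc
          exact T.col_strict hk (YoungDiagram.mem_iff_lt_rowLen.2 hi))
      have e : (fun i => if i < nu.rowLen n then insert (T n i) (g n i) else g n i) =
          g (n + 1) := by
        funext c
        have hiff : c < nu.rowLen n ↔ n < nu.colLen c := by
          rw [← YoungDiagram.mem_iff_lt_rowLen, ← YoungDiagram.mem_iff_lt_colLen]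
        simp only [g, Finset.range_add_one, Finset.filter_insert, ← hiff]
        split_ifs
        · rw [Finset.image_insert]
        · rfl
      rw [e] at h2
      rw [List.range_succ, List.reverse_append, List.flatMap_append, List.map_append]
      refine Cong.trans (by simpa using h1) ?_
      simpa [List.map_map, Function.comp_def] using h2
  have e : (List.range N).map (g (nu.colLen 0)) = rowWord N (tabMatrix T) := by
    refine List.map_congr_left fun c _ => ?_
    rw [rowSet_tabMatrix, colSet]
    have h1 : (Finset.range (nu.colLen 0)).filter (fun i => i < nu.colLen c) =
        Finset.range (nu.colLen c) := by
      ext i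
      simp only [Finset.mem_filter, Finset.mem_range, and_iff_right_iff_imp]
      exact fun h => h.trans_le (nu.colLen_anti 0 c (Nat.zero_le _))
    simp only [g, h1]
  rw [← e]
  exact key _

/-! ### Charge as a statistic of the position sets -/

/-- The positions of the letter `j` in the word `w`. -/
def posSets (w : List ℕ) : ℕ → Finset ℕ := colSets (w.map singleton)

theorem mem_posSets {w : List ℕ} {j v : ℕ} : v ∈ posSets w j ↔ w[v]? = some j := by
  rw [posSets, mem_colSets, List.getD_eq_getElem?_getD, List.getElem?_map]
  cases h : w[v]? with
  | none => simp
  | some x => simp [eq_comm]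

theorem lt_of_mem_posSets {w : List ℕ} {j v : ℕ} (h : v ∈ posSets w j) : v < w.length := by
  rw [mem_posSets] at h
  exact (List.getElem?_eq_some_iff.1 h).1

theorem lastBefore_eq (w : List ℕ) (a p : ℕ) : lastBefore w a p =
    if h : ((posSets w a).filter (· < p)).Nonempty then
      some (((posSets w a).filter (· < p)).max' h) else none := by
  have hl : ∀ r, r ∈ (List.range p).filter (fun r => w[r]? = some a) ↔
      r ∈ (posSets w a).filter (· < p) := by
    intro r
    simp only [List.mem_filter, List.mem_range, Finset.mem_filter, mem_posSets, decide_eq_true_eq]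
    exact and_comm
  have hs : ((List.range p).filter fun r => w[r]? = some a).Pairwise (· < ·) :=
    List.Pairwise.filter _ List.pairwise_lt_range
  rw [lastBefore]
  split_ifs with h
  · have hne : ((List.range p).filter fun r => w[r]? = some a) ≠ [] := by
      obtain ⟨x, hx⟩ := h
      exact List.ne_nil_of_mem ((hl x).2 hx)
    rw [List.getLast?_eq_some_getLast hne]
    congr 1
    refine le_antisymm (Finset.le_max' _ _ ((hl _).1 (List.getLast_mem hne))) ?_
    refine Finset.max'_le _ _ _ fun y hy => ?_
    have hy := (hl y).2 hy
    rw [← List.dropLast_append_getLast hne, List.mem_append, List.mem_singleton] at hy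
    rcases hy with hy | hy
    · rw [← List.dropLast_append_getLast hne, List.pairwise_append] at hs
      exact (hs.2.2 y hy _ (by simp)).le
    · exact hy.le
  · rw [Finset.not_nonempty_iff_eq_empty] at h
    rw [List.getLast?_eq_none_iff, List.eq_nil_iff_forall_not_mem]
    intro r hr
    have := (hl r).1 hr
    rw [h] at this
    simp at this

/-- The marking procedure of the charge picks cyclically the next letter. -/
theorem nextMark_eq (w : List ℕ) (a p : ℕ) (hpa : p ∉ posSets w a) :
    nextMark w a p = if (posSets w a).Nonempty then some (pick p (posSets w a)) else none := by
  rw [nextMark, lastBefore_eq, lastBefore_eq]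
  have e1 : (posSets w a).filter (· < w.length) = posSets w a :=
    Finset.filter_true_of_mem fun x hx => lt_of_mem_posSets hx
  simp only [e1]
  split_ifs with h1 h2 h2
  · rw [Option.some_or]
    congr 1
    refine (IsPick.pick_eq ?_).symm
    have hm := Finset.max'_mem _ h1
    rw [Finset.mem_filter] at hm
    refine ⟨hm.1, fun c hc hcm => ?_⟩
    by_cases hcp : c < p
    · have := Finset.le_max' _ c
        (show c ∈ (posSets w a).filter (· < p) from Finset.mem_filter.2 ⟨hc, hcp⟩)
      omega
    · have : c ≠ p := fun h => hpa (h ▸ hc)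
      omega
  · exact absurd (h1.mono (Finset.filter_subset _ _)) h2
  · rw [Option.none_or]
    congr 1
    refine (IsPick.pick_eq ?_).symm
    refine ⟨Finset.max'_mem _ h2, fun c hc hcm => Or.inl ?_⟩
    have h3 : ¬ c < p := fun h => h1 ⟨c, Finset.mem_filter.2 ⟨hc, h⟩⟩
    have h4 : c ≠ p := fun h => hpa (h ▸ hc)
    have := Finset.le_max' _ c hc
    omega
  · rfl

/-- The first row of the filling determined by the column sets `S`, starting from `p`. -/
def mark (S : ℕ → Finset ℕ) (p : ℕ) : ℕ → ℕ
  | 0 => pick p (S 0)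
  | a + 1 => pick (mark S p a) (S (a + 1))

theorem mark_mem {S : ℕ → Finset ℕ} {p a : ℕ} (h : (S a).Nonempty) : mark S p a ∈ S a := by
  cases a with
  | zero => exact pick_mem h
  | succ a => exact pick_mem h

/-- Removing the first row from the column sets removes the first letter of each column. -/
theorem cols_eq_cons {S : ℕ → Finset ℕ} {p l : ℕ} (hp : ∀ x ∈ S 0, x ≤ p)
    (hS : ∀ j, (S j).Nonempty ↔ j < l) {j : ℕ} (hj : j < l) :
    cols S j = mark S p j :: cols (fun k => (S k).erase (mark S p k)) j := by
  induction j with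
  | zero =>
    have hne := (hS 0).2 hj
    simp only [cols]
    rw [sort_ge_eq_run (n := ((S 0).erase (mark S p 0)).card + 1) hp
      (by rw [Finset.card_erase_of_mem (mark_mem hne)]; have := hne.card_pos; omega),
      sort_ge_eq_run (n := ((S 0).erase (mark S p 0)).card)
        (fun x hx => hp x (Finset.mem_of_mem_erase hx)) le_rfl, List.replicate_succ, run_cons hne]
    rfl
  | succ j ih =>
    have hne := (hS (j + 1)).2 hj
    simp only [cols]
    rw [ih (by omega), run_cons hne]
    rfl

theorem cols_eq_nil {S : ℕ → Finset ℕ} {j : ℕ} (h : S j = ∅) : cols S j = [] := by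
  cases j with
  | zero => simp [cols, h]
  | succ j => simp [cols, h]

theorem riseList_eq_cons {S : ℕ → Finset ℕ} {p l : ℕ} (hp : ∀ x ∈ S 0, x ≤ p)
    (hS : ∀ j, (S j).Nonempty ↔ j < l) (k : ℕ) :
    riseList S k = if k + 1 < l then decide (mark S p k < mark S p (k + 1)) ::
      riseList (fun k => (S k).erase (mark S p k)) k else [] := by
  split_ifs with h
  · rw [riseList, cols_eq_cons hp hS h, cols_eq_cons hp hS (by omega : k < l)]
    rfl
  · have : S (k + 1) = ∅ := Finset.not_nonempty_iff_eq_empty.1 fun h' => h ((hS _).1 h')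
    rw [riseList, cols_eq_nil this, rises, List.zipWith_nil_right]

/-- The contribution of a row of length `len` to the statistic. -/
def rowStat (S : ℕ → Finset ℕ) (len i : ℕ) : ℕ :=
  ∑ k ∈ Finset.range (len - 1), if (riseList S k)[i]? = some true then len - (k + 1) else 0

/-- The marks of the charge algorithm are the first row of the filling. -/
theorem marksFrom_eq {w : List ℕ} {l : ℕ} (hl : ∀ j, (posSets w j).Nonempty ↔ j < l) :
    ∀ fuel a p, a ≤ l → p ∉ posSets w a →
      (a < l → pick p (posSets w a) = mark (posSets w) w.length a) →
      marksFrom w fuel a p =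
        (List.range' a (min fuel (l - a))).map (mark (posSets w) w.length) := by
  intro fuel
  induction fuel with
  | zero => intro a p _ _ _; simp [marksFrom]
  | succ fuel ih =>
    intro a p ha hpa hm
    rw [marksFrom, nextMark_eq w a p hpa]
    by_cases hal : a < l
    · have hne := (hl a).2 hal
      rw [if_pos hne, hm hal]
      have hmem := mark_mem (p := w.length) hne
      have e : min (fuel + 1) (l - a) = min fuel (l - (a + 1)) + 1 := by omega
      rw [e, List.range'_succ, List.map_cons]
      simp only
      rw [ih (a + 1) _ hal (fun h => ?_) (fun _ => rfl)]
      rw [mem_posSets] at h hmem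
      rw [h] at hmem
      simp at hmem
    · rw [if_neg (fun h => hal ((hl a).1 h)), show l - a = 0 by omega]
      simp

theorem marks_eq {w : List ℕ} {l : ℕ} (hl : ∀ j, (posSets w j).Nonempty ↔ j < l) :
    marks w = (List.range l).map (mark (posSets w) w.length) := by
  have hle : l ≤ w.length := by
    have : ((Finset.range l).image (mark (posSets w) w.length)).card ≤
        (Finset.range w.length).card := by
      refine Finset.card_le_card fun x hx => ?_
      obtain ⟨a, ha, rfl⟩ := Finset.mem_image.1 hx
      exact Finset.mem_range.2
        (lt_of_mem_posSets (mark_mem ((hl a).2 (Finset.mem_range.1 ha))))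
    rwa [Finset.card_image_of_injOn, Finset.card_range, Finset.card_range] at this
    intro a ha b hb hab
    have h1 := mark_mem (p := w.length) ((hl a).2 (by simpa using ha))
    have h2 := mark_mem (p := w.length) ((hl b).2 (by simpa using hb))
    rw [mem_posSets] at h1 h2
    rw [hab, h2] at h1
    simpa using h1.symm
  rw [marks, marksFrom_eq hl _ 0 _ (Nat.zero_le _)
    (fun h => lt_irrefl _ (lt_of_mem_posSets h)) (fun _ => rfl), Nat.sub_zero, min_eq_right hle,
    List.range_eq_range']

theorem filter_zipIdx (w : List ℕ) (p : ℕ → Bool) :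
    (w.zipIdx.filter fun x => p x.2).map Prod.fst =
      ((List.range w.length).filter p).map fun i => w.getD i 0 := by
  have e : w.zipIdx = (List.range w.length).map fun i => (w.getD i 0, i) := by
    refine List.ext_getElem (by simp) fun i h1 h2 => ?_
    simp only [List.length_zipIdx] at h1
    simp [List.getD_eq_getElem?_getD, h1]
  rw [e, List.filter_map, List.map_map]
  rfl

theorem idxOf_map_lt_iff {P : List ℕ} (hP : P.Pairwise (· < ·)) {f : ℕ → ℕ}
    (hf : ∀ x ∈ P, ∀ y ∈ P, f x = f y → x = y) {a b : ℕ} (ha : a ∈ P) (hb : b ∈ P) :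
    (P.map f).idxOf (f a) < (P.map f).idxOf (f b) ↔ a < b := by
  have hnd : P.Nodup := hP.imp (fun h => h.ne)
  have hnd' : (P.map f).Nodup := hnd.map_on fun x hx y hy h => hf x hx y hy h
  have key : ∀ i (hi : i < P.length), (P.map f).idxOf (f P[i]) = i := by
    intro i hi
    have := hnd'.idxOf_getElem i (by simpa using hi)
    simpa using this
  obtain ⟨i, hi, rfl⟩ := List.getElem_of_mem ha
  obtain ⟨k, hk, rfl⟩ := List.getElem_of_mem hb
  rw [key, key]
  rw [List.pairwise_iff_getElem] at hP
  constructor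
  · exact fun h => hP i k hi hk h
  · intro h
    by_contra hle
    rcases Nat.lt_or_ge k i with h1 | h1
    · have := hP k i hk hi h1
      omega
    · obtain rfl : i = k := by omega
      omega

/-- The charge of the first standard subword counts the rises of the first row of the filling. -/
theorem permCharge_firstSubword {w : List ℕ} {l : ℕ} (hl : ∀ j, (posSets w j).Nonempty ↔ j < l) :
    permCharge (firstSubword w) = ∑ k ∈ Finset.range (l - 1),
      if mark (posSets w) w.length k < mark (posSets w) w.length (k + 1) then l - (k + 1)
        else 0 := by
  set m := mark (posSets w) w.length with hm
  have hmw : ∀ a, a < l → w.getD (m a) 0 = a := fun a ha => by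
    have := mark_mem (p := w.length) ((hl a).2 ha)
    rw [mem_posSets] at this
    rw [List.getD_eq_getElem?_getD, hm, this]
    rfl
  set P := (List.range w.length).filter (fun i => decide (i ∈ marks w)) with hP
  have hs : firstSubword w = P.map fun i => w.getD i 0 :=
    filter_zipIdx w fun i => decide (i ∈ marks w)
  have hPs : P.Pairwise (· < ·) := List.Pairwise.filter _ List.pairwise_lt_range
  have hmem : ∀ x, x ∈ P ↔ ∃ a, a < l ∧ m a = x := by
    intro x
    rw [hP, List.mem_filter, marks_eq hl]
    simp only [List.mem_range, decide_eq_true_eq, List.mem_map, ← hm]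
    refine and_iff_right_of_imp ?_
    rintro ⟨a, ha, rfl⟩
    exact lt_of_mem_posSets (mark_mem ((hl a).2 ha))
  have hinj : ∀ x ∈ P, ∀ y ∈ P, w.getD x 0 = w.getD y 0 → x = y := by
    intro x hx y hy h
    obtain ⟨a, ha, rfl⟩ := (hmem x).1 hx
    obtain ⟨b, hb, rfl⟩ := (hmem y).1 hy
    rw [hmw a ha, hmw b hb] at h
    rw [h]
  have hlen : P.length = l := by
    have h1 : P.toFinset = (Finset.range l).image m := by
      ext x
      simp [hmem]
    rw [← List.toFinset_card_of_nodup (hPs.imp fun h => h.ne), h1, Finset.card_image_of_injOn,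
      Finset.card_range]
    intro a ha b hb hab
    rw [← hmw a (by simpa using ha), hab, hmw b (by simpa using hb)]
  rw [permCharge, hs, List.length_map, hlen]
  refine Finset.sum_congr rfl fun k hk => ?_
  rw [Finset.mem_range] at hk
  have h1 := idxOf_map_lt_iff hPs hinj ((hmem (m k)).2 ⟨k, by omega, rfl⟩)
    ((hmem (m (k + 1))).2 ⟨k + 1, by omega, rfl⟩)
  rw [hmw k (by omega), hmw (k + 1) (by omega)] at h1
  simp only [h1]

/-- Removing the first standard subword removes the first row of the filling, up to a relabelling of
the positions that preserves their order. -/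
theorem riseList_removeFirstSubword {w : List ℕ} {l : ℕ}
    (hl : ∀ j, (posSets w j).Nonempty ↔ j < l) :
    (∀ j, (posSets (removeFirstSubword w) j).card = (posSets w j).card - 1) ∧
      ∀ k, riseList (posSets (removeFirstSubword w)) k =
        riseList (fun k => (posSets w k).erase (mark (posSets w) w.length k)) k := by
  set m := mark (posSets w) w.length with hm
  set P := (List.range w.length).filter (fun i => decide (i ∉ marks w)) with hP
  have hs : removeFirstSubword w = P.map fun i => w.getD i 0 :=
    filter_zipIdx w fun i => decide (i ∉ marks w)
  have hPs : P.Pairwise (· < ·) := List.Pairwise.filter _ List.pairwise_lt_range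
  have hmem : ∀ x, x ∈ P ↔ x < w.length ∧ ∀ a < l, m a ≠ x := by
    intro x
    rw [hP, List.mem_filter, marks_eq hl]
    simp [← hm]
  have hS : ∀ j v, v ∈ posSets (removeFirstSubword w) j ↔
      ∃ h : v < P.length, w[P[v]]? = some j := by
    intro j v
    rw [mem_posSets, hs, List.getElem?_map]
    by_cases hv : v < P.length
    · rw [List.getElem?_eq_getElem hv]
      have h1 : P[v] < w.length := ((hmem _).1 (List.getElem_mem hv)).1
      simp [hv, h1, List.getD_eq_getElem?_getD]
    · rw [List.getElem?_eq_none (by omega)]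
      simp [hv]
  have himg : ∀ j, (posSets (removeFirstSubword w) j).image (fun v => P.getD v 0) =
      (posSets w j).erase (m j) := by
    intro j
    ext x
    rw [Finset.mem_image, Finset.mem_erase, mem_posSets]
    constructor
    · rintro ⟨v, hv, rfl⟩
      obtain ⟨h1, h2⟩ := (hS j v).1 hv
      rw [List.getD_eq_getElem _ _ h1]
      have hj : j < l := (hl j).1 ⟨_, mem_posSets.2 h2⟩
      exact ⟨(((hmem _).1 (List.getElem_mem h1)).2 j hj).symm, h2⟩
    · rintro ⟨h1, h2⟩
      have hx : x ∈ P := by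
        refine (hmem x).2 ⟨(List.getElem?_eq_some_iff.1 h2).1, fun a ha hax => ?_⟩
        have h3 := mark_mem (p := w.length) ((hl a).2 ha)
        rw [mem_posSets, ← hm, hax, h2] at h3
        obtain rfl : j = a := by simpa using h3
        exact h1 hax.symm
      obtain ⟨v, hv, rfl⟩ := List.getElem_of_mem hx
      exact ⟨v, (hS j v).2 ⟨hv, h2⟩, List.getD_eq_getElem _ _ hv⟩
  have hmono : ∀ j j' b b', b ∈ posSets (removeFirstSubword w) j →
      b' ∈ posSets (removeFirstSubword w) j' → b < b' → P.getD b 0 < P.getD b' 0 := by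
    intro j j' b b' hb hb' hlt
    obtain ⟨h1, -⟩ := (hS j b).1 hb
    obtain ⟨h2, -⟩ := (hS j' b').1 hb'
    rw [List.getD_eq_getElem _ _ h1, List.getD_eq_getElem _ _ h2]
    exact List.pairwise_iff_getElem.1 hPs b b' h1 h2 hlt
  constructor
  · intro j
    rw [← Finset.card_image_of_injOn (f := fun v => P.getD v 0), himg]
    · by_cases hj : j < l
      · rw [Finset.card_erase_of_mem (mark_mem ((hl j).2 hj))]
      · have : posSets w j = ∅ := Finset.not_nonempty_iff_eq_empty.1 fun h => hj ((hl j).1 h)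
        simp [this]
    · intro b hb b' hb' h
      simp only at h
      rcases lt_trichotomy b b' with h1 | h1 | h1
      · have := hmono j j b b' hb hb' h1; omega
      · exact h1
      · have := hmono j j b' b hb' hb h1; omega
  · intro k
    have := (riseList_image (S := posSets (removeFirstSubword w)) (φ := fun _ v => P.getD v 0)
      (fun j b hb b' hb' h => hmono j j b b' hb hb' h)
      (fun j a ha b hb => ?_) k).2
    · rw [← this]
      congr 1
      funext j
      exact himg j
    · constructor
      · intro h
        by_contra hlt
        have := hmono j (j + 1) a b ha hb (by omega)
        omega
      · intro h
        rcases Nat.lt_or_ge b a with h1 | h1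
        · exact (hmono (j + 1) j b a hb ha h1).le
        · obtain rfl : a = b := by omega
          exact le_rfl

/-- The charge of a word is the statistic of its position sets. -/
theorem chargeAux_eq {n : ℕ} {w : List ℕ} {len : ℕ → ℕ}
    (h : ∀ i j, j < len i ↔ i < (posSets w j).card) :
    chargeAux n w = ∑ i ∈ Finset.range n, rowStat (posSets w) (len i) i := by
  induction n generalizing w len with
  | zero => simp [chargeAux]
  | succ n ih =>
    have hl : ∀ j, (posSets w j).Nonempty ↔ j < len 0 := fun j => by
      rw [h, Finset.card_pos]
    have hp : ∀ x ∈ posSets w 0, x ≤ w.length := fun x hx => (lt_of_mem_posSets hx).le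
    obtain ⟨hc, hr⟩ := riseList_removeFirstSubword hl
    rw [chargeAux, permCharge_firstSubword hl, ih (len := fun i => len (i + 1))
      (fun i j => by rw [h, hc]; omega), Finset.sum_range_succ', add_comm]
    congr 1
    · refine Finset.sum_congr rfl fun i _ => ?_
      simp only [rowStat]
      refine Finset.sum_congr rfl fun k hk => ?_
      rw [Finset.mem_range] at hk
      have hlen : len (i + 1) ≤ len 0 := by
        by_contra hlt
        have := (h (i + 1) (len 0)).1 (by omega)
        have := (h 0 (len 0)).2 (by omega)
        omega
      have hk' : k + 1 < len 0 := by omega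
      rw [hr, riseList_eq_cons hp hl k, if_pos hk', List.getElem?_cons_succ]
    · simp only [rowStat]
      refine Finset.sum_congr rfl fun k hk => ?_
      rw [Finset.mem_range] at hk
      have hk' : k + 1 < len 0 := by omega
      rw [riseList_eq_cons hp hl k, if_pos hk']
      simp

/-! ### Fillings built by greedy matching -/

/-- The entries `a`, `b` of a row and an entry `c` below `b` are in the cyclic order that makes `b`
a better match for `a` than `c`. -/
def CycLt (a b c : ℕ) : Prop := (a < c ∧ c < b) ∨ (c < b ∧ b ≤ a) ∨ (b ≤ a ∧ a < c)

/-- The conditions on the triples of two neighbouring columns say that the right one is obtained by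
greedy matching from the left one; `cycLt_run` is the converse. -/
theorem run_map_range {n m : ℕ} {f g : ℕ → ℕ} (hnm : n ≤ m)
    (h : ∀ i i', i < i' → i' < n → CycLt (f i) (g i) (g i')) :
    run ((List.range m).map f) ((Finset.range n).image g) = (List.range n).map g := by
  induction n generalizing m f g with
  | zero => simp
  | succ n ih =>
    obtain ⟨m, rfl⟩ : ∃ m', m = m' + 1 := ⟨m - 1, by omega⟩
    have h0 : IsPick (f 0) ((Finset.range (n + 1)).image g) (g 0) := by
      refine ⟨Finset.mem_image_of_mem _ (by simp), fun c hc hne => ?_⟩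
      obtain ⟨i, hi, rfl⟩ := Finset.mem_image.1 hc
      rw [Finset.mem_range] at hi
      exact h 0 i (Nat.pos_of_ne_zero fun h => hne (by rw [h])) hi
    have h1 : ((Finset.range (n + 1)).image g).erase (g 0) =
        (Finset.range n).image fun i => g (i + 1) := by
      ext x
      simp only [Finset.mem_erase, Finset.mem_image, Finset.mem_range]
      constructor
      · rintro ⟨hx, i, hi, rfl⟩
        cases i with
        | zero => exact absurd rfl hx
        | succ i => exact ⟨i, by omega, rfl⟩
      · rintro ⟨i, hi, rfl⟩
        refine ⟨fun he => ?_, i + 1, by omega, rfl⟩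
        have := h 0 (i + 1) (by omega) (by omega)
        rw [he, CycLt] at this
        omega
    rw [List.range_succ_eq_map, List.range_succ_eq_map, List.map_cons, List.map_cons, List.map_map,
      List.map_map, run_cons_of_isPick h0, h1]
    congr 1
    exact ih (f := fun i => f (i + 1)) (by omega) fun i i' hi hi' =>
      h (i + 1) (i' + 1) (by omega) (by omega)

theorem cycLt_run {l : List ℕ} {B : Finset ℕ} {i i' : ℕ} (hi : i < i')
    (hi' : i' < (run l B).length) :
    CycLt (l.getD i 0) ((run l B).getD i 0) ((run l B).getD i' 0) := by
  induction l generalizing B i i' with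
  | nil => simp at hi'
  | cons a l ih =>
    rcases B.eq_empty_or_nonempty with rfl | hB
    · simp at hi'
    · have hn := nodup_run (a :: l) B
      rw [run_cons hB] at hi' hn ⊢
      obtain ⟨i', rfl⟩ : ∃ k, i' = k + 1 := ⟨i' - 1, by omega⟩
      simp only [List.length_cons, Nat.add_lt_add_iff_right] at hi'
      cases i with
      | zero =>
        have hm : (run l (B.erase (pick a B))).getD i' 0 ∈ run l (B.erase (pick a B)) := by
          rw [List.getD_eq_getElem _ _ hi']
          exact List.getElem_mem hi'
        have := mem_of_mem_run hm
        rw [Finset.mem_erase] at this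
        exact (isPick_pick hB).2 _ this.2 this.1
      | succ i => exact ih (by omega) hi'

/-- A filling `G` of `lam` with decreasing first column in which every entry is matched greedily
with the entry to its left. -/
def IsGreedy (lam : YoungDiagram) (G : ℕ → ℕ → ℕ) : Prop :=
  (∀ i i', i < i' → i' < lam.colLen 0 → G i' 0 < G i 0) ∧
    ∀ j i i', i < i' → i' < lam.colLen (j + 1) → CycLt (G i j) (G i (j + 1)) (G i' (j + 1))

theorem IsGreedy.injOn {lam : YoungDiagram} {G : ℕ → ℕ → ℕ} (h : IsGreedy lam G) {i i' j : ℕ}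
    (hi : i < lam.colLen j) (hi' : i' < lam.colLen j) (e : G i j = G i' j) : i = i' := by
  wlog hlt : i < i' generalizing i i'
  · rcases Nat.lt_or_ge i' i with h1 | h1
    · exact (this hi' hi e.symm h1).symm
    · omega
  cases j with
  | zero => have := h.1 i i' hlt hi'; omega
  | succ j => have := h.2 j i i' hlt hi'; rw [CycLt] at this; omega

theorem IsGreedy.cols_eq {lam : YoungDiagram} {G : ℕ → ℕ → ℕ} (h : IsGreedy lam G)
    {S : ℕ → Finset ℕ} (hS : ∀ j, S j = (Finset.range (lam.colLen j)).image fun i => G i j)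
    (j : ℕ) : cols S j = (List.range (lam.colLen j)).map fun i => G i j := by
  induction j with
  | zero =>
    have h1 := sort_ge_eq_run (B := S 0) (a := (S 0).sup id) (n := lam.colLen 0)
      (fun b hb => Finset.le_sup (f := id) hb)
      (by rw [hS]; exact Finset.card_image_le.trans (Finset.card_range _).le)
    have h2 : List.replicate (lam.colLen 0) ((S 0).sup id) =
        (List.range (lam.colLen 0)).map fun _ => (S 0).sup id := by
      simp [List.map_const']
    rw [cols, h1, h2]
    conv_lhs => rw [hS 0]
    refine run_map_range le_rfl fun i i' hi hi' => Or.inr (Or.inl ⟨h.1 i i' hi hi', ?_⟩)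
    exact Finset.le_sup (f := id) (Finset.mem_image_of_mem _ (by simp; omega))
  | succ j ih =>
    rw [cols, ih, hS]
    exact run_map_range (lam.colLen_anti j (j + 1) (Nat.le_succ j)) fun i i' => h.2 j i i'

theorem length_cols {lam : YoungDiagram} {S : ℕ → Finset ℕ}
    (hS : ∀ j, (S j).card = lam.colLen j) (j : ℕ) : (cols S j).length = lam.colLen j := by
  induction j with
  | zero => rw [cols, Finset.length_sort, hS]
  | succ j ih =>
    rw [cols, length_run, ih, hS, min_eq_right (lam.colLen_anti j (j + 1) (Nat.le_succ j))]

theorem isGreedy_cols {lam : YoungDiagram} {S : ℕ → Finset ℕ}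
    (hS : ∀ j, (S j).card = lam.colLen j) : IsGreedy lam fun i j => (cols S j).getD i 0 := by
  refine ⟨fun i i' hi hi' => ?_, fun j i i' hi hi' => ?_⟩
  · rw [← length_cols hS] at hi'
    simp only
    rw [List.getD_eq_getElem _ _ hi', List.getD_eq_getElem _ _ (hi.trans hi')]
    have := List.pairwise_iff_getElem.1 (Finset.sortedGT_sort (S 0)).pairwise
    exact this i i' (hi.trans hi') hi' hi
  · rw [← length_cols hS] at hi'
    exact cycLt_run hi hi'

theorem mem_iff_exists_cols {lam : YoungDiagram} {S : ℕ → Finset ℕ}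
    (hS : ∀ j, (S j).card = lam.colLen j) {j x : ℕ} :
    x ∈ S j ↔ ∃ i < lam.colLen j, (cols S j).getD i 0 = x := by
  have h : (cols S j).toFinset = S j := by
    refine Finset.eq_of_subset_of_card_le (fun x hx => mem_of_mem_cols (List.mem_toFinset.1 hx)) ?_
    rw [List.toFinset_card_of_nodup (nodup_cols S j), length_cols hS, hS]
  rw [← h, List.mem_toFinset, List.mem_iff_getElem, ← length_cols hS]
  constructor
  · rintro ⟨i, hi, rfl⟩; exact ⟨i, hi, List.getD_eq_getElem _ _ hi⟩
  · rintro ⟨i, hi, rfl⟩; exact ⟨i, hi, (List.getD_eq_getElem _ _ hi).symm⟩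

/-! ### Extending a skew filling to the inner shape -/

theorem mem_skewCells {lam mu : YoungDiagram} {i j : ℕ} :
    (i, j) ∈ skewCells lam mu ↔ i < lam.colLen j ∧ mu.colLen j ≤ i := by
  rw [skewCells, Finset.mem_sdiff, YoungDiagram.mem_cells, YoungDiagram.mem_cells,
    YoungDiagram.mem_iff_lt_colLen, YoungDiagram.mem_iff_lt_colLen, not_lt]

theorem isInversionTriple_top {b c : ℕ} : IsInversionTriple ⊤ b c ↔ c < b := by
  simp [IsInversionTriple, Prod.Lex.toLex_lt_toLex]

theorem isInversionTriple_coe {a b c : ℕ} : IsInversionTriple a b c ↔ CycLt a b c := by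
  simp only [IsInversionTriple, Prod.Lex.toLex_lt_toLex, CycLt, Nat.cast_lt, Nat.cast_inj]
  omega

/-- A filling `β` of `mu` by numbers `≥ N` that decreases down the columns and from each column to
the next one.  It replaces the value `∞` on the boxes of `mu`, all of whose entries are then
matched with entries of `mu`. -/
structure IsInner (mu : YoungDiagram) (N : ℕ) (β : ℕ → ℕ → ℕ) : Prop where
  le : ∀ i j, i < mu.colLen j → N ≤ β i j
  col : ∀ i i' j, i < i' → i' < mu.colLen j → β i' j < β i j
  next : ∀ i i' j, i < mu.colLen j → i' < mu.colLen (j + 1) → β i' (j + 1) < β i j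

/-- The filling of `lam` that is `β` on `mu` and `F` on `lam / mu`. -/
def extend (mu : YoungDiagram) (β F : ℕ → ℕ → ℕ) (i j : ℕ) : ℕ :=
  if i < mu.colLen j then β i j else F i j

theorem isGreedy_extend {lam mu : YoungDiagram} {N : ℕ} {β : ℕ → ℕ → ℕ}
    (hβ : IsInner mu N β) (F : COF lam mu)
    (hF : ∀ i j, (i, j) ∈ skewCells lam mu → F.entry i j < N) :
    IsGreedy lam (extend mu β F.entry) := by
  have key : ∀ i i' j, i < i' → i < mu.colLen j → i' < lam.colLen j →
      extend mu β F.entry i' j < extend mu β F.entry i j := by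
    intro i i' j h h1 h2
    rw [extend, extend, if_pos h1]
    split_ifs with h3
    · exact hβ.col i i' j h h3
    · exact (hF i' j (mem_skewCells.2 ⟨h2, by omega⟩)).trans_le (hβ.le i j h1)
  constructor
  · intro i i' h h'
    by_cases hi : i < mu.colLen 0
    · exact key i i' 0 h hi h'
    · rw [extend, extend, if_neg hi, if_neg (by omega)]
      exact F.first_column i i' h (mem_skewCells.2 ⟨by omega, by omega⟩)
        (mem_skewCells.2 ⟨by omega, by omega⟩)
  · intro j i i' h h'
    by_cases hi : i < mu.colLen (j + 1)
    · refine Or.inr (Or.inl ⟨key i i' (j + 1) h hi h', ?_⟩)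
      have h1 : i < mu.colLen j := hi.trans_le (mu.colLen_anti j (j + 1) (Nat.le_succ j))
      rw [extend, extend, if_pos hi, if_pos h1]
      exact (hβ.next i i j h1 hi).le
    · have hl := lam.colLen_anti j (j + 1) (Nat.le_succ j)
      have m1 : (i, j + 1) ∈ skewCells lam mu := mem_skewCells.2 ⟨by omega, by omega⟩
      have m2 : (i', j + 1) ∈ skewCells lam mu := mem_skewCells.2 ⟨by omega, by omega⟩
      have ht := F.triples i i' j h m1 m2
      have e1 : extend mu β F.entry i (j + 1) = F.entry i (j + 1) := if_neg hi
      have e2 : extend mu β F.entry i' (j + 1) = F.entry i' (j + 1) := if_neg (by omega)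
      rw [e1, e2]
      by_cases hj : i < mu.colLen j
      · rw [extValue, if_neg (fun h => by have := mem_skewCells.1 h; omega),
          isInversionTriple_top] at ht
        rw [extend, if_pos hj]
        exact Or.inr (Or.inl ⟨ht, (hF _ _ m1).le.trans (hβ.le i j hj)⟩)
      · rw [extValue, if_pos (mem_skewCells.2 ⟨by omega, by omega⟩), isInversionTriple_coe] at ht
        rwa [extend, if_neg hj]

/-- Conversely, a greedy filling that is `β` on `mu` restricts to a skew specialized Macdonald
filling. -/
def restrict {lam mu : YoungDiagram} {N : ℕ} {β G : ℕ → ℕ → ℕ}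
    (hβ : IsInner mu N β) (hG : IsGreedy lam G) (h1 : ∀ i j, i < mu.colLen j → G i j = β i j)
    (h2 : ∀ i j, (i, j) ∈ skewCells lam mu → G i j < N) : COF lam mu where
  entry i j := if (i, j) ∈ skewCells lam mu then G i j else 0
  zeros i j h := if_neg h
  column_distinct i i' j h h' e := by
    rw [if_pos h, if_pos h'] at e
    exact hG.injOn (mem_skewCells.1 h).1 (mem_skewCells.1 h').1 e
  first_column i i' h m m' := by
    rw [if_pos m, if_pos m']
    exact hG.1 i i' h (mem_skewCells.1 m').1
  triples i i' j h m m' := by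
    have hc := hG.2 j i i' h (mem_skewCells.1 m').1
    have hl := lam.colLen_anti j (j + 1) (Nat.le_succ j)
    have hm := mem_skewCells.1 m
    rw [if_pos m, if_pos m', extValue]
    split_ifs with hj
    · rwa [isInversionTriple_coe]
    · rw [mem_skewCells] at hj
      have hj' : i < mu.colLen j := by omega
      have h3 := h2 _ _ m
      have h4 := h2 _ _ m'
      have h5 := hβ.le i j hj'
      rw [isInversionTriple_top]
      rw [h1 i j hj', CycLt] at hc
      omega

/-- In the filling given by sets of the shape "`β` on `mu` and smaller numbers", the boxes of `mu`
contain `β`. -/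
theorem cols_getD_eq_inner {lam mu : YoungDiagram} {N : ℕ} {β : ℕ → ℕ → ℕ}
    (hβ : IsInner mu N β) {S : ℕ → Finset ℕ} (hS : ∀ j, (S j).card = lam.colLen j)
    (hin : ∀ i j, i < mu.colLen j → β i j ∈ S j)
    (hout : ∀ j, ∀ x ∈ S j, N ≤ x → ∃ i < mu.colLen j, β i j = x) :
    ∀ j i, i < mu.colLen j → (cols S j).getD i 0 = β i j := by
  have hG := isGreedy_cols hS
  have key : ∀ j, (∀ i i', i < i' → i' < lam.colLen j → i < mu.colLen j →
      (cols S j).getD i' 0 = β i j → (cols S j).getD i' 0 < (cols S j).getD i 0) →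
      ∀ i, i < mu.colLen j → (cols S j).getD i 0 = β i j := by
    intro j hj i
    induction i using Nat.strong_induction_on with
    | _ i ih =>
      intro hi
      obtain ⟨i', hi', e⟩ := (mem_iff_exists_cols hS).1 (hin i j hi)
      rcases lt_trichotomy i i' with h | rfl | h
      · have h1 := hj i i' h hi' hi e
        have h2 := hβ.le i j hi
        have h3 : (cols S j).getD i 0 ∈ S j := (mem_iff_exists_cols hS).2 ⟨i, h.trans hi', rfl⟩
        obtain ⟨k, hk, e'⟩ := hout j _ h3 (by omega)
        have hki : k < i := by
          by_contra hle
          rcases Nat.lt_or_ge i k with h4 | h4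
          · have := hβ.col i k j h4 hk; omega
          · obtain rfl : i = k := by omega
            omega
        have := hG.injOn (j := j) (hki.trans (h.trans hi')) (h.trans hi') ((ih k hki hk).trans e')
        omega
      · exact e
      · have h1 := hβ.col i' i j h hi
        rw [ih i' h (h.trans hi)] at e
        omega
  intro j
  induction j with
  | zero => exact key 0 fun i i' h h' _ _ => hG.1 i i' h h'
  | succ j ihj =>
    refine key (j + 1) fun i i' h h' hi e => ?_
    have h1 : i < mu.colLen j := hi.trans_le (mu.colLen_anti j (j + 1) (Nat.le_succ j))
    have h2 := hG.2 j i i' h h'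
    have h3 := hβ.next i i j h1 hi
    simp only at h2
    rw [CycLt, ihj i h1, e] at h2
    omega

/-! ### The column sets of a matrix followed by the charge suffix -/

theorem colSets_append (X Y : List (Finset ℕ)) (j : ℕ) :
    colSets (X ++ Y) j = colSets X j ∪ (colSets Y j).image (X.length + ·) := by
  ext v
  simp only [Finset.mem_union, Finset.mem_image, mem_colSets]
  rcases Nat.lt_or_ge v X.length with h | h
  · rw [List.getD_append _ _ _ _ h]
    constructor
    · exact Or.inl
    · rintro (h' | ⟨u, -, rfl⟩)
      · exact h'
      · omega
  · rw [List.getD_append_right _ _ _ _ h, List.getD_eq_default X _ h]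
    constructor
    · exact fun h' => Or.inr ⟨_, h', by omega⟩
    · rintro (h' | ⟨u, h', rfl⟩)
      · simp at h'
      · rwa [Nat.add_sub_cancel_left]

theorem lt_of_mem_colSets {X : List (Finset ℕ)} {j v : ℕ} (h : v ∈ colSets X j) : v < X.length := by
  rw [colSets, Finset.mem_filter, Finset.mem_range] at h
  exact h.1

theorem card_colSets_append (X Y : List (Finset ℕ)) (j : ℕ) :
    (colSets (X ++ Y) j).card = (colSets X j).card + (colSets Y j).card := by
  rw [colSets_append, Finset.card_union_of_disjoint,
    Finset.card_image_of_injective _ (add_right_injective _)]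
  rw [Finset.disjoint_left]
  intro v h h'
  obtain ⟨u, -, rfl⟩ := Finset.mem_image.1 h'
  have := lt_of_mem_colSets h
  omega

theorem card_posSets (w : List ℕ) (j : ℕ) : (posSets w j).card = w.count j := by
  induction w with
  | nil => simp [posSets, colSets]
  | cons x w ih =>
    have h := card_colSets_append [{x}] (w.map singleton) j
    rw [posSets] at ih ⊢
    rw [List.map_cons, ← List.singleton_append, h, ih, List.count_cons, add_comm]
    congr 1
    by_cases hx : x = j
    · subst hx
      simp [colSets, Finset.filter_singleton]
    · simp [colSets, hx, Ne.symm hx]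

theorem count_chargeSuffix (kap : YoungDiagram) (j : ℕ) :
    (chargeSuffix kap).count j = kap.rowLen j := by
  have key : ∀ n, ((List.range n).reverse.flatMap fun i => List.replicate (kap.rowLen i) i).count j
      = if j < n then kap.rowLen j else 0 := by
    intro n
    induction n with
    | zero => simp
    | succ n ih =>
      rw [List.range_succ, List.reverse_append, List.flatMap_append, List.count_append, ih]
      simp only [List.reverse_cons, List.reverse_nil, List.nil_append, List.flatMap_cons,
        List.flatMap_nil, List.append_nil, List.count_replicate, beq_iff_eq]
      split_ifs <;> first | omega | (subst_vars; rfl)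
  rw [chargeSuffix, key]
  split_ifs with h
  · rfl
  · by_contra h'
    exact h (YoungDiagram.mem_iff_lt_colLen.1
      (YoungDiagram.mem_iff_lt_rowLen.2 (Nat.pos_of_ne_zero (Ne.symm h'))))

theorem pairwise_chargeSuffix (kap : YoungDiagram) : (chargeSuffix kap).Pairwise (· ≥ ·) := by
  rw [chargeSuffix, List.pairwise_flatMap]
  refine ⟨fun a _ => ?_, ?_⟩
  · rw [List.pairwise_replicate]
    exact Or.inr le_rfl
  · rw [List.pairwise_reverse]
    refine List.pairwise_lt_range.imp fun {a b} h x hx y hy => ?_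
    rw [List.eq_of_mem_replicate hx, List.eq_of_mem_replicate hy]
    exact h.le

/-- The filling of `mu` by the positions of the letters of the charge suffix: the boxes of column
`j` contain, in decreasing order, the positions of the letter `j`, moved up by `N`. -/
def inner (mu : YoungDiagram) (N i j : ℕ) : ℕ :=
  N + ((posSets (chargeSuffix mu.transpose) j).sort (· ≥ ·)).getD i 0

theorem card_posSets_chargeSuffix (mu : YoungDiagram) (j : ℕ) :
    (posSets (chargeSuffix mu.transpose) j).card = mu.colLen j := by
  rw [card_posSets, count_chargeSuffix, YoungDiagram.rowLen_transpose]

theorem exists_inner_iff {mu : YoungDiagram} {N j x : ℕ} :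
    (∃ i < mu.colLen j, inner mu N i j = x) ↔
      ∃ u ∈ posSets (chargeSuffix mu.transpose) j, N + u = x := by
  constructor
  · rintro ⟨i, hi, rfl⟩
    rw [← card_posSets_chargeSuffix, ← Finset.length_sort (· ≥ ·)] at hi
    refine ⟨_, ?_, rfl⟩
    rw [List.getD_eq_getElem _ _ hi, ← Finset.mem_sort (· ≥ ·)]
    exact List.getElem_mem hi
  · rintro ⟨u, hu, rfl⟩
    rw [← Finset.mem_sort (· ≥ ·)] at hu
    obtain ⟨i, hi, rfl⟩ := List.getElem_of_mem hu
    refine ⟨i, ?_, ?_⟩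
    · rwa [Finset.length_sort, card_posSets_chargeSuffix] at hi
    · rw [inner, List.getD_eq_getElem _ _ hi]

theorem isInner_inner (mu : YoungDiagram) (N : ℕ) : IsInner mu N (inner mu N) where
  le i j _ := Nat.le_add_right _ _
  col i i' j h h' := by
    rw [← card_posSets_chargeSuffix, ← Finset.length_sort (· ≥ ·)] at h'
    rw [inner, inner, List.getD_eq_getElem _ _ h', List.getD_eq_getElem _ _ (h.trans h')]
    have := List.pairwise_iff_getElem.1 (Finset.sortedGT_sort
      (posSets (chargeSuffix mu.transpose) j)).pairwise i i' (h.trans h') h' h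
    omega
  next i i' j h h' := by
    obtain ⟨u, hu, e⟩ := (exists_inner_iff (N := N)).1 ⟨i, h, rfl⟩
    obtain ⟨u', hu', e'⟩ := (exists_inner_iff (N := N)).1 ⟨i', h', rfl⟩
    rw [← e, ← e']
    rw [mem_posSets] at hu hu'
    obtain ⟨l, hu⟩ := List.getElem?_eq_some_iff.1 hu
    obtain ⟨l', hu'⟩ := List.getElem?_eq_some_iff.1 hu'
    have hp := List.pairwise_iff_getElem.1 (pairwise_chargeSuffix mu.transpose)
    rcases lt_trichotomy u u' with h1 | h1 | h1
    · have := hp u u' l l' h1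
      omega
    · subst h1
      omega
    · omega

/-- The column sets of the matrix `M`, followed by those of the charge suffix. -/
def extSets (mu : YoungDiagram) (N : ℕ) (M : Finset (ℕ × ℕ)) : ℕ → Finset ℕ :=
  colSets (rowWord N M ++ (chargeSuffix mu.transpose).map singleton)

theorem mem_colSets_rowWord {N v j : ℕ} {M : Finset (ℕ × ℕ)} (hM : InRows N M) :
    v ∈ colSets (rowWord N M) j ↔ (v, j) ∈ M := by
  rw [mem_colSets]
  rcases Nat.lt_or_ge v N with h | h
  · rw [List.getD_eq_getElem _ _ (by simpa [rowWord] using h)]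
    simp [rowWord, mem_rowSet]
  · rw [List.getD_eq_default _ _ (by simpa [rowWord] using h)]
    refine iff_of_false (by simp) fun hv => ?_
    have := hM _ hv
    simp only at this
    omega

theorem mem_extSets {mu : YoungDiagram} {N v j : ℕ} {M : Finset (ℕ × ℕ)} (hM : InRows N M) :
    v ∈ extSets mu N M j ↔ (v, j) ∈ M ∨ ∃ i < mu.colLen j, inner mu N i j = v := by
  rw [extSets, colSets_append, Finset.mem_union, mem_colSets_rowWord hM, exists_inner_iff,
    Finset.mem_image, rowWord, List.length_map, List.length_range]
  rfl

theorem card_extSets {mu : YoungDiagram} {N : ℕ} {M : Finset (ℕ × ℕ)} (hM : InRows N M) (j : ℕ) :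
    (extSets mu N M j).card = colContent M j + mu.colLen j := by
  rw [extSets, card_colSets_append, ← card_posSets_chargeSuffix, posSets]
  congr 1
  rw [colContent_apply, ← Finset.card_image_of_injOn (f := Prod.fst)]
  · congr 1
    ext v
    rw [mem_colSets_rowWord hM]
    simp [eq_comm]
  · rintro ⟨a, b⟩ h ⟨a', b'⟩ h' e
    simp only [Finset.coe_filter, Set.mem_ofPred_eq] at h h' e
    rw [e, h.2, h'.2]

/-- The weighted number of rises of the filling of `lam` given by a matrix and the charge suffix.
It is the major index for the matrix of a filling and the charge for the matrix of a tableau. -/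
def matStat (lam mu : YoungDiagram) (N : ℕ) (M : Finset (ℕ × ℕ)) : ℕ :=
  ∑ i ∈ Finset.range (lam.colLen 0), rowStat (extSets mu N M) (lam.rowLen i) i

theorem matStat_eq_of_rowEquiv {lam mu : YoungDiagram} {N : ℕ} {M A : Finset (ℕ × ℕ)}
    (h : RowEquiv N M A) : matStat lam mu N M = matStat lam mu N A := by
  have h1 := h.cong [] ((chargeSuffix mu.transpose).map singleton)
  simp only [List.nil_append] at h1
  simp only [matStat, rowStat, extSets, h1]
  rfl

/-! ### Fillings and matrices -/

theorem columnLengths_apply (lam : YoungDiagram) (j : ℕ) : columnLengths lam j = lam.colLen j := rfl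

/-- The matrices with given row content and column content. -/
noncomputable def matrices (d a : ℕ →₀ ℕ) : Finset (Finset (ℕ × ℕ)) :=
  (d.support ×ˢ a.support).powerset.filter fun M => rowContent M = d ∧ colContent M = a

theorem fst_mem_support {M : Finset (ℕ × ℕ)} {p : ℕ × ℕ} (hp : p ∈ M) :
    p.1 ∈ (rowContent M).support := by
  rw [Finsupp.mem_support_iff, rowContent_apply, ← Nat.pos_iff_ne_zero, Finset.card_pos]
  exact ⟨p, by simp [hp]⟩

theorem snd_mem_support {M : Finset (ℕ × ℕ)} {p : ℕ × ℕ} (hp : p ∈ M) :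
    p.2 ∈ (colContent M).support := by
  rw [Finsupp.mem_support_iff, colContent_apply, ← Nat.pos_iff_ne_zero, Finset.card_pos]
  exact ⟨p, by simp [hp]⟩

theorem mem_matrices {d a : ℕ →₀ ℕ} {M : Finset (ℕ × ℕ)} :
    M ∈ matrices d a ↔ rowContent M = d ∧ colContent M = a := by
  rw [matrices, Finset.mem_filter, and_iff_right_iff_imp]
  rintro ⟨rfl, rfl⟩
  exact Finset.mem_powerset.2 fun p hp =>
    Finset.mem_product.2 ⟨fst_mem_support hp, snd_mem_support hp⟩

theorem inRows_of_rowContent {N : ℕ} {d : ℕ →₀ ℕ} (hd : ∀ x, d x ≠ 0 → x < N)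
    {M : Finset (ℕ × ℕ)} (hM : rowContent M = d) : InRows N M := fun p hp =>
  hd _ (by rw [← hM]; exact Finsupp.mem_support_iff.1 (fst_mem_support hp))

/-- The matrix of a filling: the pairs (entry, column). -/
def fillMatrix {lam mu : YoungDiagram} (F : COF lam mu) : Finset (ℕ × ℕ) :=
  (skewCells lam mu).image fun c => (F.entry c.1 c.2, c.2)

section
variable {lam mu : YoungDiagram}

theorem mem_fillMatrix {F : COF lam mu} {v j : ℕ} :
    (v, j) ∈ fillMatrix F ↔ ∃ i, (i, j) ∈ skewCells lam mu ∧ F.entry i j = v := by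
  rw [fillMatrix, Finset.mem_image]
  constructor
  · rintro ⟨⟨i, j'⟩, h, e⟩
    simp only [Prod.mk.injEq] at e
    obtain ⟨rfl, rfl⟩ := e
    exact ⟨i, h, rfl⟩
  · rintro ⟨i, h, rfl⟩
    exact ⟨(i, j), h, rfl⟩

theorem fillMatrix_injOn (F : COF lam mu) :
    Set.InjOn (fun c : ℕ × ℕ => (F.entry c.1 c.2, c.2)) (skewCells lam mu) := by
  rintro ⟨i, j⟩ h ⟨i', j'⟩ h' e
  simp only [Prod.mk.injEq] at e
  obtain ⟨e, rfl⟩ := e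
  rw [F.column_distinct i i' j h h' e]

theorem rowContent_fillMatrix (F : COF lam mu) :
    rowContent (fillMatrix F) = content (skewCells lam mu) F.entry := by
  rw [rowContent, fillMatrix, Finset.sum_image (fillMatrix_injOn F)]
  rfl

theorem card_skew_column (j : ℕ) :
    ((skewCells lam mu).filter fun c => c.2 = j).card = lam.colLen j - mu.colLen j := by
  have : (skewCells lam mu).filter (fun c => c.2 = j) =
      (Finset.Ico (mu.colLen j) (lam.colLen j)).image fun i => (i, j) := by
    ext ⟨i, j'⟩
    rw [Finset.mem_filter, mem_skewCells, Finset.mem_image]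
    simp only [Finset.mem_Ico, Prod.mk.injEq]
    constructor
    · rintro ⟨h, rfl⟩; exact ⟨i, ⟨h.2, h.1⟩, rfl, rfl⟩
    · rintro ⟨i, h, rfl, rfl⟩; exact ⟨⟨h.2, h.1⟩, rfl⟩
  rw [this, Finset.card_image_of_injective _ (fun a b h => (Prod.mk.inj h).1), Nat.card_Ico]

theorem colContent_fillMatrix (F : COF lam mu) :
    colContent (fillMatrix F) = columnLengths lam - columnLengths mu := by
  ext j
  rw [colContent_apply, Finsupp.tsub_apply, columnLengths_apply, columnLengths_apply,
    ← card_skew_column, fillMatrix, Finset.filter_image, Finset.card_image_of_injOn]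
  exact (fillMatrix_injOn F).mono (by intro c hc; simpa using (Finset.mem_filter.1 hc).1)

end

section
variable {lam mu : YoungDiagram} {N : ℕ}

theorem colLen_mono (hmu : mu ≤ lam) (j : ℕ) : mu.colLen j ≤ lam.colLen j := by
  by_contra h
  have h1 : (lam.colLen j, j) ∈ mu := YoungDiagram.mem_iff_lt_colLen.2 (by omega)
  have h2 : (lam.colLen j, j) ∈ lam := hmu h1
  exact lt_irrefl _ (YoungDiagram.mem_iff_lt_colLen.1 h2)

/-- The column sets of the matrix of a filling are the columns of the extended filling. -/
theorem extSets_fillMatrix (hmu : mu ≤ lam) (F : COF lam mu) (hN : InRows N (fillMatrix F))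
    (j : ℕ) : extSets mu N (fillMatrix F) j =
      (Finset.range (lam.colLen j)).image fun i => extend mu (inner mu N) F.entry i j := by
  have hle : mu.colLen j ≤ lam.colLen j := colLen_mono hmu j
  ext v
  rw [mem_extSets hN, mem_fillMatrix, Finset.mem_image]
  simp only [Finset.mem_range, mem_skewCells, extend]
  constructor
  · rintro (⟨i, hi, rfl⟩ | ⟨i, hi, rfl⟩)
    · exact ⟨i, hi.1, if_neg (by omega)⟩
    · exact ⟨i, by omega, if_pos hi⟩
  · rintro ⟨i, hi, rfl⟩
    split_ifs with h
    · exact Or.inr ⟨i, h, rfl⟩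
    · exact Or.inl ⟨i, ⟨hi, by omega⟩, rfl⟩

theorem entry_lt {F : COF lam mu} (hN : InRows N (fillMatrix F)) (i j : ℕ)
    (h : (i, j) ∈ skewCells lam mu) : F.entry i j < N :=
  hN _ (mem_fillMatrix.2 ⟨i, h, rfl⟩)

theorem cols_fillMatrix (hmu : mu ≤ lam) (F : COF lam mu) (hN : InRows N (fillMatrix F)) (j : ℕ) :
    cols (extSets mu N (fillMatrix F)) j =
      (List.range (lam.colLen j)).map fun i => extend mu (inner mu N) F.entry i j :=
  (isGreedy_extend (isInner_inner mu N) F (entry_lt hN)).cols_eq (extSets_fillMatrix hmu F hN) j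

theorem fillMatrix_injective (hmu : mu ≤ lam) {F F' : COF lam mu}
    (h : fillMatrix F = fillMatrix F') : F = F' := by
  obtain ⟨N, hN⟩ := exists_row_bound (fillMatrix F)
  refine COF.ext (funext fun i => funext fun j => ?_)
  by_cases hij : (i, j) ∈ skewCells lam mu
  · have h1 := cols_fillMatrix hmu F hN j
    rw [h] at hN h1
    rw [cols_fillMatrix hmu F' hN j] at h1
    have hm := mem_skewCells.1 hij
    have h2 := List.map_inj_left.1 h1 i (List.mem_range.2 hm.1)
    simp only [extend] at h2
    rw [if_neg (by omega), if_neg (by omega)] at h2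
    exact h2.symm
  · rw [F.zeros i j hij, F'.zeros i j hij]

/-- Every matrix with the right column content is the matrix of a filling. -/
theorem exists_fillMatrix (hmu : mu ≤ lam) {M : Finset (ℕ × ℕ)}
    (hM : colContent M = columnLengths lam - columnLengths mu) :
    ∃ F : COF lam mu, fillMatrix F = M := by
  obtain ⟨N, hN⟩ := exists_row_bound M
  -- the filling is built by greedy matching from the column sets
  set S := extSets mu N M with hSdef
  have hS : ∀ j, (S j).card = lam.colLen j := by
    intro j
    have hle : mu.colLen j ≤ lam.colLen j := colLen_mono hmu j
    rw [hSdef, card_extSets hN, hM, Finsupp.tsub_apply, columnLengths_apply, columnLengths_apply]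
    omega
  have hmem : ∀ j v, v ∈ S j ↔ (v, j) ∈ M ∨ ∃ i < mu.colLen j, inner mu N i j = v :=
    fun j v => mem_extSets hN
  have hβ := isInner_inner mu N
  have hG := isGreedy_cols hS
  have h1 : ∀ i j, i < mu.colLen j → (cols S j).getD i 0 = inner mu N i j := fun i j =>
    cols_getD_eq_inner hβ hS (fun i j hi => (hmem j _).2 (Or.inr ⟨i, hi, rfl⟩))
      (fun j x hx hNx => by
        rcases (hmem j x).1 hx with h | h
        · have := hN _ h
          simp only at this
          omega
        · exact h) j i
  have h2 : ∀ i j, (i, j) ∈ skewCells lam mu → ((cols S j).getD i 0, j) ∈ M := by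
    intro i j hij
    rw [mem_skewCells] at hij
    rcases (hmem j _).1 ((mem_iff_exists_cols hS).2 ⟨i, hij.1, rfl⟩) with h | ⟨i', hi', e⟩
    · exact h
    · rw [← h1 i' j hi'] at e
      have := hG.injOn (j := j) (by omega) hij.1 e
      omega
  refine ⟨restrict hβ hG h1 fun i j h => hN _ (h2 i j h), ?_⟩
  ext ⟨v, j⟩
  rw [mem_fillMatrix]
  simp only [restrict]
  constructor
  · rintro ⟨i, hi, rfl⟩
    rw [if_pos hi]
    exact h2 i j hi
  · intro h
    obtain ⟨i, hi, rfl⟩ := (mem_iff_exists_cols hS).1 ((hmem j v).2 (Or.inl h))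
    have hij : (i, j) ∈ skewCells lam mu := by
      refine mem_skewCells.2 ⟨hi, ?_⟩
      by_contra hlt
      have h3 := hN _ h
      simp only at h3
      rw [h1 i j (by omega)] at h3
      have := hβ.le i j (by omega)
      omega
    exact ⟨i, hij, if_pos hij⟩

theorem maj_eq_sum (F : ℕ → ℕ → ℕ) : maj lam mu F = ∑ i ∈ Finset.range (lam.colLen 0),
    ∑ k ∈ Finset.range (lam.rowLen i - 1),
      if (i, k + 1) ∈ descents lam mu F then lam.rowLen i - (k + 1) else 0 := by
  rw [maj, Finset.sum_sigma', ← Finset.sum_filter]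
  refine Finset.sum_bij' (fun c _ => ⟨c.1, c.2 - 1⟩) (fun p _ => (p.1, p.2 + 1)) ?_ ?_ ?_ ?_ ?_
  · rintro ⟨i, j⟩ h
    have h' := h
    rw [descents, Finset.mem_filter, mem_skewCells] at h'
    obtain ⟨⟨hl, -⟩, hj, -⟩ := h'
    simp only at hj
    have h3 : j < lam.rowLen i := by
      rw [← YoungDiagram.mem_iff_lt_rowLen, YoungDiagram.mem_iff_lt_colLen]; exact hl
    have := lam.colLen_anti 0 j (Nat.zero_le _)
    simp only [Finset.mem_filter, Finset.mem_sigma, Finset.mem_range]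
    refine ⟨⟨by omega, by omega⟩, ?_⟩
    rwa [Nat.sub_add_cancel hj]
  · rintro ⟨i, k⟩ h
    exact (Finset.mem_filter.1 h).2
  · rintro ⟨i, j⟩ h
    rw [descents, Finset.mem_filter] at h
    simp only [Nat.sub_add_cancel h.2.1]
  · rintro ⟨i, k⟩ h
    rfl
  · rintro ⟨i, j⟩ h
    rw [descents, Finset.mem_filter, mem_skewCells] at h
    have hj := h.2.1
    have h3 : j < lam.rowLen i := by
      rw [← YoungDiagram.mem_iff_lt_rowLen, YoungDiagram.mem_iff_lt_colLen]; exact h.1.1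
    simp only at hj
    simp only [leg]
    omega

/-- The major index of a filling is the statistic of its matrix. -/
theorem maj_eq_matStat (hmu : mu ≤ lam) (F : COF lam mu) (hN : InRows N (fillMatrix F)) :
    maj lam mu F.entry = matStat lam mu N (fillMatrix F) := by
  rw [maj_eq_sum, matStat]
  refine Finset.sum_congr rfl fun i _ => ?_
  rw [rowStat]
  refine Finset.sum_congr rfl fun k hk => ?_
  rw [Finset.mem_range] at hk
  have hik : i < lam.colLen (k + 1) := by
    rw [← YoungDiagram.mem_iff_lt_colLen, YoungDiagram.mem_iff_lt_rowLen]; omega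
  have hik' := hik.trans_le (lam.colLen_anti k (k + 1) (Nat.le_succ k))
  have hmu' := mu.colLen_anti k (k + 1) (Nat.le_succ k)
  have e : (riseList (extSets mu N (fillMatrix F)) k)[i]? =
      some (decide (extend mu (inner mu N) F.entry i k <
        extend mu (inner mu N) F.entry i (k + 1))) := by
    rw [riseList, rises, cols_fillMatrix hmu F hN, cols_fillMatrix hmu F hN,
      List.getElem?_zipWith]
    simp [hik, hik']
  rw [e]
  refine if_congr ?_ rfl rfl
  rw [Option.some_inj, decide_eq_true_eq, descents, Finset.mem_filter, mem_skewCells]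
  simp only [Nat.add_sub_cancel, extend, extValue, mem_skewCells]
  have hβ := isInner_inner mu N
  by_cases h1 : i < mu.colLen (k + 1)
  · have h2 : i < mu.colLen k := by omega
    rw [if_pos h1, if_pos h2]
    refine iff_of_false (by omega) ?_
    have := hβ.next i i k h2 h1
    omega
  · rw [if_neg h1]
    by_cases h2 : i < mu.colLen k
    · rw [if_pos h2, if_neg (by omega)]
      refine iff_of_false (by simp) ?_
      have h3 := hβ.le i k h2
      have h4 := entry_lt hN i (k + 1) (mem_skewCells.2 ⟨hik, by omega⟩)
      omega
    · rw [if_neg h2, if_pos ⟨hik', by omega⟩, Nat.cast_lt]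
      exact ⟨fun h => h.2.2, fun h => ⟨⟨hik, by omega⟩, by omega, h⟩⟩

/-- The coefficients of `skewE` as sums over matrices. -/
theorem skewE_apply (hmu : mu ≤ lam) {d : ℕ →₀ ℕ} (hd : ∀ x, d x ≠ 0 → x < N) :
    skewE lam mu d = ∑ M ∈ matrices d (columnLengths lam - columnLengths mu),
      (Polynomial.X : Polynomial ℤ) ^ matStat lam mu N M := by
  refine Finset.sum_bij (fun F _ => fillMatrix F) ?_ ?_ ?_ ?_
  · intro F hF
    rw [Set.Finite.mem_toFinset, Set.mem_ofPred_eq] at hF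
    exact mem_matrices.2 ⟨by rw [rowContent_fillMatrix, hF], colContent_fillMatrix F⟩
  · intro F _ F' _ h
    exact fillMatrix_injective hmu h
  · intro M hM
    obtain ⟨h1, h2⟩ := mem_matrices.1 hM
    obtain ⟨F, rfl⟩ := exists_fillMatrix hmu h2
    refine ⟨F, ?_, rfl⟩
    rw [Set.Finite.mem_toFinset, Set.mem_ofPred_eq, ← h1, rowContent_fillMatrix]
  · intro F hF
    rw [Set.Finite.mem_toFinset, Set.mem_ofPred_eq] at hF
    rw [maj_eq_matStat hmu F (inRows_of_rowContent hd (by rw [rowContent_fillMatrix, hF]))]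

end

/-! ### Classes of matrices and tableaux -/

theorem mem_SSYT {nu : YoungDiagram} {d : ℕ →₀ ℕ} {T : SemistandardYoungTableau nu} :
    T ∈ SSYT nu d ↔ content nu.cells T = d := by
  rw [SSYT, Set.Finite.mem_toFinset, Set.mem_ofPred_eq]

/-- A highest weight matrix for both kinds of operators is the diagram of a partition, so its
contents are conjugate. -/
theorem colContent_eq_rowLen {nu : YoungDiagram} {M : Finset (ℕ × ℕ)} (hr : RowHW M) (hc : ColHW M)
    (h : ∀ x, rowContent M x = nu.colLen x) (j : ℕ) : colContent M j = nu.rowLen j := by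
  obtain ⟨N, hN⟩ := exists_row_bound M
  have hanti : Antitone (colContent M) := antitone_nat_of_succ_le fun j => by
    have := (colHW_iff hN).1 hc j 0 (Nat.zero_le _)
    rw [colDiff_eq_of_le hN le_rfl] at this
    simp only [colDiff, Nat.count_zero] at this
    omega
  obtain ⟨K, hK⟩ := exists_col_bound M
  have hrow : ∀ x j, (x, j) ∈ M ↔ j < nu.colLen x := by
    intro x
    have h1 : rowSet M x = Finset.range (rowSet M x).card := by
      have hsub : ∀ j ∈ rowSet M x, Finset.range (j + 1) ⊆ rowSet M x := by
        intro j hj i hi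
        rw [mem_rowSet, mem_iff_lt_colContent hr hc] at hj ⊢
        exact hj.trans_le (hanti (Nat.lt_succ_iff.1 (Finset.mem_range.1 hi)))
      refine Finset.eq_of_subset_of_card_le (fun j hj => ?_) (Finset.card_range _).le
      have := Finset.card_le_card (hsub j hj)
      rw [Finset.card_range] at this
      exact Finset.mem_range.2 this
    intro j
    rw [← mem_rowSet, h1, Finset.mem_range, ← rowContent_eq_card, h]
  refine eq_of_forall_lt_iff fun x => ?_
  rw [← mem_iff_lt_colContent hr hc, hrow, ← YoungDiagram.mem_iff_lt_rowLen,
    YoungDiagram.mem_iff_lt_colLen]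

theorem inRows_tabMatrix {nu : YoungDiagram} (T : SemistandardYoungTableau nu) {N : ℕ}
    (hN : nu.rowLen 0 ≤ N) : InRows N (tabMatrix T) := by
  rintro ⟨c, x⟩ h
  rw [mem_tabMatrix, mem_colSet] at h
  obtain ⟨i, hi, -⟩ := h
  exact (YoungDiagram.mem_iff_lt_rowLen.1 hi).trans_le
    ((nu.rowLen_anti 0 i (Nat.zero_le _)).trans hN)

/-- The matrices in the class of a tableau of shape `nu` are counted by the tableaux of the
conjugate shape. -/
theorem ncard_class {nu : YoungDiagram} (T : SemistandardYoungTableau nu) {N : ℕ}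
    (hN : nu.rowLen 0 ≤ N) {d : ℕ →₀ ℕ} (hd : ∀ x, d x ≠ 0 → x < N) :
    {A | RowEquiv N A (tabMatrix T) ∧ rowContent A = d}.ncard = (SSYT nu.transpose d).card := by
  obtain ⟨M, h1, h2, -, h4, h5⟩ := exists_ncard_class (inRows_tabMatrix T hN) (rowHW_tabMatrix T)
  rw [h5, hwCount_eq_card (fun j => ?_) hd]
  rw [YoungDiagram.colLen_transpose]
  exact colContent_eq_rowLen h1 h2 (fun x => by rw [h4, rowContent_tabMatrix]) j

theorem count_readingWord {nu : YoungDiagram} (T : SemistandardYoungTableau nu) (a : ℕ) :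
    (readingWord T).count a = content nu.cells T a := by
  have h1 : ∀ i n, ((List.range n).map fun j => T i j).count a =
      ∑ j ∈ Finset.range n, if T i j = a then 1 else 0 := by
    intro i n
    induction n with
    | zero => simp
    | succ n ih =>
      rw [List.range_succ, List.map_append, List.count_append, ih, Finset.sum_range_succ]
      simp [List.count_singleton]
  have h2 : ∀ n, ((List.range n).reverse.flatMap fun i =>
      (List.range (nu.rowLen i)).map fun j => T i j).count a =
      ∑ i ∈ Finset.range n, ∑ j ∈ Finset.range (nu.rowLen i), if T i j = a then 1 else 0 := by
    intro n
    induction n with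
    | zero => simp
    | succ n ih =>
      rw [List.range_succ, List.reverse_append, List.flatMap_append, List.count_append, ih,
        Finset.sum_range_succ, ← h1, add_comm]
      simp
  rw [readingWord, h2, content, Finsupp.finsetSum_apply, Finset.sum_sigma']
  refine Finset.sum_bij' (fun p _ => (p.1, p.2)) (fun c _ => ⟨c.1, c.2⟩) ?_ ?_ ?_ ?_ ?_
  · rintro ⟨i, j⟩ h
    simp only [Finset.mem_sigma, Finset.mem_range] at h
    rw [YoungDiagram.mem_cells]
    exact YoungDiagram.mem_iff_lt_rowLen.2 h.2
  · rintro ⟨i, j⟩ h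
    rw [YoungDiagram.mem_cells] at h
    simp only [Finset.mem_sigma, Finset.mem_range]
    exact ⟨(YoungDiagram.mem_iff_lt_colLen.1 h).trans_le (nu.colLen_anti 0 j (Nat.zero_le _)),
      YoungDiagram.mem_iff_lt_rowLen.1 h⟩
  · intro _ _; rfl
  · intro _ _; rfl
  · rintro ⟨i, j⟩ _
    rw [Finsupp.single_apply]

section
variable {lam mu : YoungDiagram}

/-- The postfix charge of a tableau is the statistic of its matrix. -/
theorem matStat_tabMatrix (hmu : mu ≤ lam) {nu : YoungDiagram} {T : SemistandardYoungTableau nu}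
    (hT : content nu.cells T = columnLengths lam - columnLengths mu) {N : ℕ}
    (hN : nu.rowLen 0 ≤ N) :
    matStat lam mu N (tabMatrix T) = postfixCharge mu.transpose (readingWord T) := by
  set w := readingWord T ++ chargeSuffix mu.transpose with hw
  have hcard : ∀ j, (posSets w j).card = lam.colLen j := by
    intro j
    have := colLen_mono hmu j
    rw [card_posSets, hw, List.count_append, count_readingWord, count_chargeSuffix, hT,
      Finsupp.tsub_apply, columnLengths_apply, columnLengths_apply, YoungDiagram.rowLen_transpose]
    omega
  have hrise : ∀ k, riseList (extSets mu N (tabMatrix T)) k = riseList (posSets w) k := by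
    intro k
    have := cong_readingWord T hN [] ((chargeSuffix mu.transpose).map singleton) k
    rw [List.nil_append, List.nil_append, ← List.map_append] at this
    exact this.symm
  have hlen : lam.colLen 0 ≤ w.length := by
    rw [← hcard, card_posSets]
    exact List.count_le_length
  rw [postfixCharge, charge, ← hw, chargeAux_eq (len := lam.rowLen) fun i j => by
    rw [hcard, ← YoungDiagram.mem_iff_lt_rowLen, YoungDiagram.mem_iff_lt_colLen]]
  have e : matStat lam mu N (tabMatrix T) =
      ∑ i ∈ Finset.range (lam.colLen 0), rowStat (posSets w) (lam.rowLen i) i := by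
    simp only [matStat, rowStat, hrise]
  rw [e]
  refine Finset.sum_subset (Finset.range_mono hlen) fun i _ hi => ?_
  have h0 : lam.rowLen i = 0 := by
    by_contra h
    exact hi (Finset.mem_range.2 (YoungDiagram.mem_iff_lt_colLen.1
      (YoungDiagram.mem_iff_lt_rowLen.2 (Nat.pos_of_ne_zero h))))
  simp [rowStat, h0]

theorem card_of_mem_matrices (hmu : mu ≤ lam) {d : ℕ →₀ ℕ} {M : Finset (ℕ × ℕ)}
    (hM : M ∈ matrices d (columnLengths lam - columnLengths mu)) :
    M.card = (skewCells lam mu).card := by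
  obtain ⟨F, rfl⟩ := exists_fillMatrix hmu (mem_matrices.1 hM).2
  exact Finset.card_image_of_injOn (fillMatrix_injOn F)

theorem rowLen_le_card (nu : YoungDiagram) : nu.rowLen 0 ≤ nu.card := by
  rw [YoungDiagram.rowLen_eq_card]
  exact Finset.card_le_card (Finset.filter_subset _ _)

theorem mem_partitions {n : ℕ} {nu : YoungDiagram} : nu ∈ partitions n ↔ nu.card = n := by
  rw [partitions, Set.Finite.mem_toFinset, Set.mem_ofPred_eq]

/-- The coefficients of `skewE`: the classes of matrices under the row operators are indexed by
tableaux, and the statistic is constant on each class. -/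
theorem skewE_apply_eq_sum (hmu : mu ≤ lam) (d : ℕ →₀ ℕ) :
    skewE lam mu d = ∑ nu ∈ partitions (skewCells lam mu).card,
      ∑ T ∈ SSYT nu (columnLengths lam - columnLengths mu),
        (Polynomial.X : Polynomial ℤ) ^ postfixCharge mu.transpose (readingWord T) *
          ((SSYT nu.transpose d).card : Polynomial ℤ) := by
  classical
  set n := (skewCells lam mu).card with hn
  set a := columnLengths lam - columnLengths mu with ha
  obtain ⟨N, hnN, hd⟩ : ∃ N, n ≤ N ∧ ∀ x, d x ≠ 0 → x < N := by
    refine ⟨n + d.support.sup id + 1, by omega, fun x hx => ?_⟩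
    have : id x ≤ _ := Finset.le_sup (f := id) (Finsupp.mem_support_iff.2 hx)
    simp only [id] at this
    omega
  have hrow : ∀ nu ∈ partitions n, nu.rowLen 0 ≤ N := fun nu h =>
    (rowLen_le_card nu).trans ((mem_partitions.1 h).le.trans hnN)
  -- both sides are sums over the pairs of a matrix and the tableau of its class
  have h1 : ∀ nu ∈ partitions n, ∀ T ∈ SSYT nu a,
      (Polynomial.X : Polynomial ℤ) ^ postfixCharge mu.transpose (readingWord T) *
        ((SSYT nu.transpose d).card : Polynomial ℤ) = ∑ M ∈ matrices d a,
          if RowEquiv N M (tabMatrix T) then Polynomial.X ^ matStat lam mu N M else 0 := by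
    intro nu hnu T hT
    have hT' := mem_SSYT.1 hT
    rw [← matStat_tabMatrix hmu hT' (hrow nu hnu), ← ncard_class T (hrow nu hnu) hd,
      ← Finset.sum_filter, Finset.sum_congr rfl fun M hM => by
        rw [matStat_eq_of_rowEquiv (Finset.mem_filter.1 hM).2]]
    rw [Finset.sum_const, nsmul_eq_mul, mul_comm, ← Set.ncard_coe_finset]
    congr 3
    ext M
    simp only [Set.mem_ofPred_eq, Finset.coe_filter, mem_matrices]
    constructor
    · rintro ⟨h, h'⟩
      exact ⟨⟨h', by rw [h.colContent_eq, colContent_tabMatrix, hT']⟩, h⟩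
    · rintro ⟨⟨h, -⟩, h'⟩
      exact ⟨h', h⟩
  rw [skewE_apply hmu hd, Finset.sum_congr rfl fun nu hnu => Finset.sum_congr rfl (h1 nu hnu),
    Finset.sum_sigma', Finset.sum_comm]
  refine Finset.sum_congr rfl fun M hM => ?_
  obtain ⟨hMd, hMa⟩ := mem_matrices.1 hM
  obtain ⟨A, hA, hA'⟩ := exists_rowHW (inRows_of_rowContent hd hMd)
  obtain ⟨nu, T, rfl⟩ := exists_tabMatrix hA'
  have hT : content nu.cells T = a := by rw [← colContent_tabMatrix, ← hA.colContent_eq, hMa]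
  have hnu : nu.card = n := by
    rw [← card_tabMatrix T, ← degree_colContent, ← hA.colContent_eq, degree_colContent,
      card_of_mem_matrices hmu hM]
  rw [Finset.sum_eq_single ⟨nu, T⟩, if_pos hA]
  · rintro ⟨nu', T'⟩ _ hne
    refine if_neg fun h => hne ?_
    have e : tabMatrix T' = tabMatrix T := RowEquiv.eq_of_rowHW
      (.trans _ _ _ (.symm _ _ h) hA) (rowHW_tabMatrix T') (rowHW_tabMatrix T)
    obtain rfl : nu' = nu := eq_of_colLen_eq fun j => by
      rw [← rowContent_tabMatrix T', ← rowContent_tabMatrix T, e]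
    rw [tabMatrix_injective e]
  · intro h
    exact absurd (Finset.mem_sigma.2 ⟨mem_partitions.2 hnu, mem_SSYT.2 hT⟩) h

end

/-! ### Symmetry and Schur positivity -/

theorem skewE_eq_sum {lam mu : YoungDiagram} (hmu : mu ≤ lam) :
    skewE lam mu = ∑ nu ∈ partitions (skewCells lam mu).card,
      (∑ T ∈ SSYT nu (columnLengths lam - columnLengths mu),
        (Polynomial.X : Polynomial ℤ) ^ postfixCharge mu.transpose (readingWord T)) •
          schur nu.transpose := by
  ext1 d
  rw [map_sum]
  refine (skewE_apply_eq_sum hmu d).trans (Finset.sum_congr rfl fun nu _ => ?_)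
  rw [MvPowerSeries.coeff_smul, Finset.sum_mul]
  rfl

theorem isSymmetricFunction_skewE {lam mu : YoungDiagram} (hmu : mu ≤ lam) :
    IsSymmetricFunction (skewE lam mu) := by
  refine ⟨⟨(skewCells lam mu).card, fun d hd => ?_⟩, fun s d => ?_⟩
  · change skewE lam mu d ≠ 0 at hd
    rw [skewE_apply (N := d.support.sup id + 1) hmu fun x hx => Nat.lt_succ_of_le
      (Finset.le_sup (f := id) (Finsupp.mem_support_iff.2 hx))] at hd
    obtain ⟨M, hM, -⟩ := Finset.exists_ne_zero_of_sum_ne_zero hd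
    rw [← card_of_mem_matrices hmu hM, ← degree_rowContent, (mem_matrices.1 hM).1]
  · change skewE lam mu _ = skewE lam mu _
    rw [skewE_apply_eq_sum hmu, skewE_apply_eq_sum hmu]
    simp only [SSYT_card_mapDomain]

theorem isSchurPositive_skewE {lam mu : YoungDiagram} (hmu : mu ≤ lam) :
    IsSchurPositive (skewE lam mu) := by
  refine ⟨∑ nu ∈ partitions (skewCells lam mu).card, Finsupp.single nu.transpose
    (∑ T ∈ SSYT nu (columnLengths lam - columnLengths mu),
      (Polynomial.X : Polynomial ℕ) ^ postfixCharge mu.transpose (readingWord T)), ?_⟩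
  change _ = Finsupp.sum _ fun nu p => Polynomial.map (Nat.castRingHom ℤ) p • schur nu
  rw [← Finsupp.sum_finsetSum_index (fun nu => by simp) (fun nu p p' => by
    rw [Polynomial.map_add, add_smul]), skewE_eq_sum hmu]
  refine Finset.sum_congr rfl fun nu _ => ?_
  rw [Finsupp.sum_single_index (by simp), Polynomial.map_sum]
  simp

end SkewMacdonald

theorem mainTheorem6 (lam mu : YoungDiagram) (hmu : mu ≤ lam) :
    SkewMacdonald.skewE lam mu =
        ∑ nu ∈ SkewMacdonald.partitions (SkewMacdonald.skewCells lam mu).card,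
          (∑ T ∈ SkewMacdonald.SSYT nu
              (SkewMacdonald.columnLengths lam - SkewMacdonald.columnLengths mu),
            (Polynomial.X : Polynomial ℤ) ^
              SkewMacdonald.postfixCharge mu.transpose (SkewMacdonald.readingWord T)) •
            SkewMacdonald.schur nu.transpose ∧
      SkewMacdonald.IsSymmetricFunction (SkewMacdonald.skewE lam mu) ∧
      SkewMacdonald.IsSchurPositive (SkewMacdonald.skewE lam mu) :=
  ⟨SkewMacdonald.skewE_eq_sum hmu, SkewMacdonald.isSymmetricFunction_skewE hmu,
    SkewMacdonald.isSchurPositive_skewE hmu⟩
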